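/- **Setting.** Let $d\ge 1$, let $\mathcal D=C_c^\infty(\mathbb R^d)$ and let $\mathcal D'$ be the space of real distributions. Let $B_a$ be the open Euclidean ball of radius $a$ centred at $0$. Fix $\varphi\in\mathcal D$ with $\operatorname{supp}\varphi\subset B_1$ and $\int\varphi=1$, and put $\varphi^{(n)}_x=2^{nd}\varphi(2^n(\cdot-x))$. For $\eta\in\mathcal D$ and $\lambda>0$ put $\eta^\lambda_x=\lambda^{-d}\eta(\lambda^{-1}(\cdot-x))$. Probability spaces are written $(\Omega,\mathcal F,\mathbb P)$ and $\|\cdot\|_p$ is the $L^p(\Omega)$ norm. A random distribution is a map $\zeta:\Omega\to\mathcal D'$ such that $\langle\zeta,\eta\rangle$ is measurable for every $\eta\in\mathcal D$. **The space $\mathcal C^\alpha$.** For $\alpha<0$ and $r=\lceil-\alpha\rceil$ let $$\|\zeta\|_{\alpha;E}=\sup\bigl\{\lambda^{-\alpha}|\langle\zeta,\eta^\lambda_x\rangle| : \eta\in\mathcal D,\ \operatorname{supp}\eta\subset B_1,\ \|\eta\|_{C^r}\le1,\ \lambda\in(0,1),\ x\in E\bigr\},$$ where $\|\eta\|_{C^r}=\max_{k\le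 r}\|D^k\eta\|_\infty$. $\mathcal C^\alpha$ is the set of $\zeta\in\mathcal D'$ with $\|\zeta\|_{\alpha;E}<\infty$ for all compact $E$, with the metric $d_\alpha(\zeta,\zeta')=\sum_{m\ge1}2^{-m}\bigl(1\wedge\|\zeta-\zeta'\|_{\alpha;B_m}\bigr)$. **The space $\mathcal C^{\alpha_0}_p$.** A random distribution $\zeta$ belongs to $\mathcal C^{\alpha_0}_p$ if there is $C<\infty$ such that for all $n\ge1$ $$\sup_{x}\|\langle\zeta,\varphi^{(n)}_x\rangle\|_p\le C2^{-n\alpha_0},\qquad \|\langle\zeta,\varphi^{(n)}_x-\varphi^{(n)}_y\rangle\|_p\le C2^{-n(\alpha_0-1)}|x-y|\quad\text{whenever } 0<|x-y|\le2^{-n},$$ with $|\cdot|$ the sup norm on $\mathbb R^d$; $\|\zeta\|_{\mathcal C^{\alpha_0}_p}$ is the smallest such $C$. **Time regularity.** Hölder regularity on $\mathbb R_+$ is local in time and is measured through increments, for every positive exponent. $\mathcal C^{\gamma_0,\alpha_0}_p=\mathcal C^{\gamma_0}(\mathbb R_+,\mathcal C^{\alpha_0}_p)$ is the set of families $(\zeta_t)_{t\ge0}$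 in $\mathcal C^{\alpha_0}_p$ such that for every $T\ge0$ $$\|\zeta\|_{\gamma_0,\alpha_0,p;T}:=\sup_{t\le T}\|\zeta_t\|_{\mathcal C_p^{\alpha_0}}+\sup_{s\ne t\le T}\frac{\|\zeta_t-\zeta_s\|_{\mathcal C_p^{\alpha_0}}}{|t-s|^{\gamma_0}}<\infty .$$ $\mathcal C^\gamma(\mathbb R_+,\mathcal C^\alpha)$ is the set of paths $f:\mathbb R_+\to\mathcal C^\alpha$ such that, on every $[0,T]$, $d_\alpha(f_t,f_s)\le K_T|t-s|^\gamma$ for some $K_T<\infty$, and $d_\alpha(f_t,f_s)/|t-s|^{\gamma}\to0$ uniformly as $0<|t-s|\to0$. Its topology is given by the distances, for $T>0$, $$\rho_T(f,g)=\sup_{t\le T}d_\alpha(f_t,g_t)+\sup_{s\ne t\le T}\frac{d_\alpha(f_t-f_s,\,g_t-g_s)}{|t-s|^\gamma}.$$ **$L^p$ spaces.** $L^p(\Omega,\mathcal C^\alpha)$ is the set of (almost everywhere) strongly measurable $Z:\Omega\to\mathcal C^\alpha$ with $\|d_\alpha(Z,0)\|_p<\infty$. $L^p(\Omega,\mathcal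 C^\gamma(\mathbb R_+,\mathcal C^\alpha))$ is the set of (almost everywhere) strongly measurable $Z:\Omega\to\mathcal C^\gamma(\mathbb R_+,\mathcal C^\alpha)$ with $\|\rho_T(Z,0)\|_p<\infty$ for all $T$. **Proposition.** Let $\alpha_0<0$, $d<p<\infty$, $\gamma_0>\frac1p$, $\gamma\in(0,\gamma_0-\frac1p)$ and $\alpha<\alpha_0-\frac dp$. Then there are continuous embeddings $$\mathcal C^{\alpha_0}_p\subset L^p(\Omega,\mathcal C^\alpha),\qquad \mathcal C^{\gamma_0,\alpha_0}_p\subset L^p(\Omega,\mathcal C^\gamma(\mathbb R_+,\mathcal C^\alpha)).$$ Precisely: 1. Every $\zeta\in\mathcal C^{\alpha_0}_p$ is almost surely equal to an element of $L^p(\Omega,\mathcal C^\alpha)$, and there is a constant $C$, not depending on the probability space, such that $\|d_\alpha(\zeta,\zeta')\|_p\le C\|\zeta-\zeta'\|_{\mathcal C^{\alpha_0}_p}$ for all $\zeta,\zeta'\in\mathcal C^{\alpha_0}_p$. 2. Every $\zeta\in\mathcal C^{\gamma_0,\alpha_0}_p$ has a modification $Z\in L^p(\Omega,\mathcal C^\gamma(\mathbb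 R_+,\mathcal C^\alpha))$, that is, $Z_t=\zeta_t$ almost surely for every $t\ge0$. For every $T\ge0$ there is a constant $C_T$, not depending on the probability space, such that $\|\rho_T(Z,Z')\|_p\le C_T\|\zeta-\zeta'\|_{\gamma_0,\alpha_0,p;T}$ for all $\zeta,\zeta'\in\mathcal C^{\gamma_0,\alpha_0}_p$ and all strongly measurable $\mathcal C^\gamma(\mathbb R_+,\mathcal C^\alpha)$-valued modifications $Z$ of $\zeta$ and $Z'$ of $\zeta'$. -/

import Mathlib

open MeasureTheory TopologicalSpace
open scoped Distributions ENNReal NNReal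

universe u

noncomputable section

/-- The space `ℝ^d`. -/
abbrev Space (d : ℕ) : Type := EuclideanSpace ℝ (Fin d)

/-- The sup norm `max_i |x_i|` on `ℝ^d`. -/
def supNorm {d : ℕ} (x : Space d) : ℝ := ‖WithLp.ofLp x‖

/-- Smooth compactly supported test functions on `ℝ^d`. -/
abbrev TestFn (d : ℕ) : Type := 𝓓((⊤ : Opens (Space d)), ℝ)

/-- Distributions on `ℝ^d`: continuous linear functionals on the test functions. -/
abbrev Distr (d : ℕ) : Type := 𝓓'((⊤ : Opens (Space d)), ℝ)

/-- `η_x^r (y) = r^{-d} η ((y - x) / r)`, for `r > 0`. -/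
def TestFn.rescale {d : ℕ} (η : TestFn d) (r : ℝ) (hr : 0 < r) (x : Space d) : TestFn d where
  toFun y := (r ^ d)⁻¹ * η (r⁻¹ • (y - x))
  contDiff' := by
    refine contDiff_const.mul (η.contDiff.comp ?_)
    fun_prop
  hasCompactSupport' := by
    have h : HasCompactSupport fun y : Space d => η (r⁻¹ • (y - x)) :=
      η.hasCompactSupport.comp_homeomorph
        ((Homeomorph.subRight x).trans (Homeomorph.smulOfNeZero r⁻¹ (inv_ne_zero hr.ne')))
    exact h.mul_left
  tsupport_subset' := by simp

/-- `φ_x^{(n)} = 2^{nd} φ (2^n (· - x))`, the rescaling of `φ` to the scale `2^{-n}`. -/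
def TestFn.dyadic {d : ℕ} (φ : TestFn d) (n : ℕ) (x : Space d) : TestFn d :=
  φ.rescale ((2 : ℝ) ^ n)⁻¹ (by positivity) x

/-- Test functions with support in the open unit ball and integral one. -/
def IsMollifier {d : ℕ} (φ : TestFn d) : Prop :=
  tsupport φ ⊆ Metric.ball 0 1 ∧ ∫ x, φ x = 1

/-- Test functions with support in the open unit ball and `C^r` norm at most one, where the
`C^r` norm is the largest of the sup norms of the derivatives of order at most `r`. -/
def unitTestFns (d r : ℕ) : Set (TestFn d) :=
  {η | tsupport η ⊆ Metric.ball 0 1 ∧ ∀ k ≤ r, ∀ x, ‖iteratedFDeriv ℝ k η x‖ ≤ 1}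

/-- The seminorm `‖ζ‖_{α;E}`: the supremum of `r^{-α} |⟨ζ, η_x^r⟩|` over the unit test functions
`η` of order `⌈-α⌉`, the scales `r ∈ (0,1)` and the base points `x ∈ E`. -/
def holderSeminorm {d : ℕ} (α : ℝ) (E : Set (Space d)) (ζ : Distr d) : ℝ≥0∞ :=
  ⨆ (η : TestFn d) (_ : η ∈ unitTestFns d ⌈-α⌉₊) (r : ℝ) (hr : 0 < r) (_ : r < 1)
    (x : Space d) (_ : x ∈ E), ENNReal.ofReal (r ^ (-α)) * ‖ζ (η.rescale r hr x)‖ₑ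

/-- `∑_{m ≥ 1} 2^{-m} (1 ∧ q_m)`; the sequence is indexed from zero, so `q m` is `q_{m+1}`. -/
def metrise (q : ℕ → ℝ≥0∞) : ℝ≥0∞ := ∑' m : ℕ, (2⁻¹ : ℝ≥0∞) ^ (m + 1) * min 1 (q m)

/-- `d_α(ζ, 0) = ∑_{m ≥ 1} 2^{-m} (1 ∧ ‖ζ‖_{α;B_m})`. -/
def holderGauge {d : ℕ} (α : ℝ) (ζ : Distr d) : ℝ≥0∞ :=
  metrise fun m => holderSeminorm α (Metric.ball 0 (m + 1)) ζ

/-- The distance `d_α(ζ, ζ') = ∑_{m ≥ 1} 2^{-m} (1 ∧ ‖ζ - ζ'‖_{α;B_m})`. -/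
def holderDist {d : ℕ} (α : ℝ) (ζ ζ' : Distr d) : ℝ≥0∞ := holderGauge α (ζ - ζ')

/-- The space `C^α` of locally `α`-Hölder distributions, for `α < 0`. -/
structure HolderDistr (d : ℕ) (α : ℝ) where
  /-- the underlying distribution -/
  toDistr : Distr d
  finite : ∀ E : Set (Space d), IsCompact E → holderSeminorm α E toDistr < ∞

/-- For a subadditive `N` on an additive group of states, the `γ`-Hölder norm on `[0,T]`,
`sup_{t ≤ T} N (f t) + sup_{s ≠ t ≤ T} N (f t - f s) / |t - s|^γ`. -/
def timeHolderNorm {X : Type*} [Sub X] (N : X → ℝ≥0∞) (γ : ℝ) (T : ℝ≥0) (f : ℝ≥0 → X) : ℝ≥0∞ :=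
  (⨆ (t : ℝ≥0) (_ : t ≤ T), N (f t)) +
    ⨆ (s : ℝ≥0) (_ : s ≤ T) (t : ℝ≥0) (_ : t ≤ T) (_ : s ≠ t),
      N (f t - f s) / ENNReal.ofReal (dist t s ^ γ)

/-- The distance `sup_{t ≤ T} d_α(f t, g t) + sup_{s ≠ t ≤ T} d_α(f t - f s, g t - g s) / |t - s|^γ`
between paths restricted to `[0,T]`. -/
def pathDist {d : ℕ} (α γ : ℝ) (T : ℝ≥0) (f g : ℝ≥0 → Distr d) : ℝ≥0∞ :=
  timeHolderNorm (holderGauge α) γ T (f - g)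

/-- The space `C^γ(ℝ₊, C^α)` of locally (little) `γ`-Hölder paths in the metric space
`(C^α, d_α)`. -/
structure HolderPath (d : ℕ) (α γ : ℝ) where
  /-- the underlying path -/
  toPath : ℝ≥0 → HolderDistr d α
  holder : ∀ T : ℝ≥0, ∃ K : ℝ≥0, ∀ s ≤ T, ∀ t ≤ T,
    holderDist α (toPath t).toDistr (toPath s).toDistr ≤ K * ENNReal.ofReal (dist t s ^ γ)
  little : ∀ T : ℝ≥0, ∀ ε : ℝ≥0, 0 < ε → ∃ δ : ℝ, 0 < δ ∧ ∀ s ≤ T, ∀ t ≤ T, dist t s < δ →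
    holderDist α (toPath t).toDistr (toPath s).toDistr ≤ ε * ENNReal.ofReal (dist t s ^ γ)

/-- The distribution-valued path underlying an element of `C^γ(ℝ₊, C^α)`. -/
def HolderPath.eval {d : ℕ} {α γ : ℝ} (f : HolderPath d α γ) (t : ℝ≥0) : Distr d :=
  (f.toPath t).toDistr

/-! ### The metrics on `C^α` and on `C^γ(ℝ₊, C^α)` -/

theorem metrise_zero : metrise (fun _ => 0) = 0 := by simp [metrise]

theorem metrise_add_le {q q₁ q₂ : ℕ → ℝ≥0∞} (h : ∀ m, q m ≤ q₁ m + q₂ m) :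
    metrise q ≤ metrise q₁ + metrise q₂ := by
  unfold metrise
  rw [← ENNReal.tsum_add]
  refine ENNReal.tsum_le_tsum fun m => ?_
  rw [← mul_add]
  gcongr
  rcases le_total 1 (q₁ m) with h1 | h1
  · exact (min_le_left _ _).trans (by rw [min_eq_left h1]; exact le_self_add)
  rcases le_total 1 (q₂ m) with h2 | h2
  · exact (min_le_left _ _).trans (by rw [min_eq_left h2]; exact le_add_self)
  rw [min_eq_right h1, min_eq_right h2]
  exact (min_le_right _ _).trans (h m)

theorem holderSeminorm_zero {d : ℕ} (α : ℝ) (E : Set (Space d)) :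
    holderSeminorm α E 0 = 0 := by simp [holderSeminorm]

theorem holderSeminorm_neg {d : ℕ} (α : ℝ) (E : Set (Space d)) (ζ : Distr d) :
    holderSeminorm α E (-ζ) = holderSeminorm α E ζ := by simp [holderSeminorm]

theorem holderSeminorm_add_le {d : ℕ} (α : ℝ) (E : Set (Space d)) (ζ ζ' : Distr d) :
    holderSeminorm α E (ζ + ζ') ≤ holderSeminorm α E ζ + holderSeminorm α E ζ' := by
  unfold holderSeminorm
  refine iSup₂_le fun η hη => iSup₂_le fun r hr => iSup₂_le fun hr1 x => iSup_le fun hx => ?_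
  have key : ∀ θ : Distr d, ENNReal.ofReal (r ^ (-α)) * ‖θ (η.rescale r hr x)‖ₑ ≤
      ⨆ (η : TestFn d) (_ : η ∈ unitTestFns d ⌈-α⌉₊) (r : ℝ) (hr : 0 < r) (_ : r < 1)
        (x : Space d) (_ : x ∈ E), ENNReal.ofReal (r ^ (-α)) * ‖θ (η.rescale r hr x)‖ₑ :=
    fun θ => le_iSup₂_of_le η hη <| le_iSup₂_of_le r hr <| le_iSup₂_of_le hr1 x <|
      le_iSup_of_le hx le_rfl
  refine le_trans ?_ (add_le_add (key ζ) (key ζ'))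
  rw [← mul_add]
  gcongr
  exact enorm_add_le _ _

theorem holderGauge_zero {d : ℕ} (α : ℝ) : holderGauge α (0 : Distr d) = 0 := by
  simp [holderGauge, holderSeminorm_zero, metrise]

theorem holderGauge_neg {d : ℕ} (α : ℝ) (ζ : Distr d) :
    holderGauge α (-ζ) = holderGauge α ζ := by
  simp [holderGauge, holderSeminorm_neg]

theorem holderGauge_add_le {d : ℕ} (α : ℝ) (ζ ζ' : Distr d) :
    holderGauge α (ζ + ζ') ≤ holderGauge α ζ + holderGauge α ζ' :=
  metrise_add_le fun _ => holderSeminorm_add_le _ _ _ _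

theorem timeHolderNorm_add_le {d : ℕ} (α γ : ℝ) (T : ℝ≥0) (f g : ℝ≥0 → Distr d) :
    timeHolderNorm (holderGauge α) γ T (f + g) ≤
      timeHolderNorm (holderGauge α) γ T f + timeHolderNorm (holderGauge α) γ T g := by
  unfold timeHolderNorm
  rw [add_add_add_comm]
  refine add_le_add ?_ ?_
  · refine iSup₂_le fun t ht => (holderGauge_add_le α (f t) (g t)).trans (add_le_add ?_ ?_)
    · exact le_iSup₂_of_le t ht le_rfl
    · exact le_iSup₂_of_le t ht le_rfl
  · refine iSup₂_le fun s hs => iSup₂_le fun t ht => iSup_le fun hst => ?_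
    have h : (f + g) t - (f + g) s = (f t - f s) + (g t - g s) := by
      simp only [Pi.add_apply]; abel
    rw [h]
    refine (ENNReal.div_le_div_right (holderGauge_add_le α _ _) _).trans ?_
    rw [ENNReal.add_div]
    refine add_le_add ?_ ?_
    · exact le_iSup₂_of_le s hs <| le_iSup₂_of_le t ht <| le_iSup_of_le hst le_rfl
    · exact le_iSup₂_of_le s hs <| le_iSup₂_of_le t ht <| le_iSup_of_le hst le_rfl

theorem timeHolderNorm_neg {d : ℕ} (α γ : ℝ) (T : ℝ≥0) (f : ℝ≥0 → Distr d) :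
    timeHolderNorm (holderGauge α) γ T (-f) = timeHolderNorm (holderGauge α) γ T f := by
  have h : ∀ s t, (-f) t - (-f) s = -(f t - f s) := fun s t => by
    simp only [Pi.neg_apply]; abel
  unfold timeHolderNorm
  simp_rw [h, holderGauge_neg]
  simp only [Pi.neg_apply, holderGauge_neg]

theorem pathDist_self {d : ℕ} (α γ : ℝ) (T : ℝ≥0) (f : ℝ≥0 → Distr d) :
    pathDist α γ T f f = 0 := by
  unfold pathDist timeHolderNorm
  rw [sub_self]
  simp only [Pi.zero_apply, sub_self, holderGauge_zero, ENNReal.zero_div, ENNReal.iSup_zero,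
    add_zero]

theorem pathDist_comm {d : ℕ} (α γ : ℝ) (T : ℝ≥0) (f g : ℝ≥0 → Distr d) :
    pathDist α γ T f g = pathDist α γ T g f := by
  unfold pathDist
  rw [← timeHolderNorm_neg, neg_sub]

theorem pathDist_triangle {d : ℕ} (α γ : ℝ) (T : ℝ≥0) (f g h : ℝ≥0 → Distr d) :
    pathDist α γ T f h ≤ pathDist α γ T f g + pathDist α γ T g h := by
  unfold pathDist
  rw [← sub_add_sub_cancel f g h]
  exact timeHolderNorm_add_le _ _ _ _ _

/-- `C^α` with the metric `d_α`. -/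
instance {d : ℕ} {α : ℝ} : PseudoEMetricSpace (HolderDistr d α) where
  edist ζ ζ' := holderDist α ζ.toDistr ζ'.toDistr
  edist_self ζ := by simp [holderDist, holderGauge_zero]
  edist_comm ζ ζ' := by
    simp only [holderDist]
    rw [← holderGauge_neg, neg_sub]
  edist_triangle ζ ζ' ζ'' := by
    simp only [holderDist]
    rw [← sub_add_sub_cancel ζ.toDistr ζ'.toDistr ζ''.toDistr]
    exact holderGauge_add_le _ _ _

/-- `C^γ(ℝ₊, C^α)` with the metric that is associated with the distances on `[0,T]`,
`T = 1, 2, …`. -/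
instance {d : ℕ} {α γ : ℝ} : PseudoEMetricSpace (HolderPath d α γ) where
  edist f g := metrise fun m => pathDist α γ (m + 1) f.eval g.eval
  edist_self f := by simp only [pathDist_self, metrise_zero]
  edist_comm f g := by simp only [pathDist_comm α γ _ f.eval g.eval]
  edist_triangle f g h := metrise_add_le fun _ => pathDist_triangle _ _ _ _ _ _

/-! ### Random distributions -/

/-- Random distributions. -/
def IsRandomDistr {d : ℕ} {Ω : Type*} [MeasurableSpace Ω] (ζ : Ω → Distr d) : Prop :=
  ∀ η : TestFn d, Measurable fun ω => ζ ω η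

/-- The constant `C` satisfies, for every `n ≥ 1`, the bound
`‖⟨ζ, φ_x^{(n)}⟩‖_p ≤ C 2^{-n α₀}` for all `x`, and the bound
`‖⟨ζ, φ_x^{(n)} - φ_y^{(n)}⟩‖_p ≤ C 2^{-n (α₀ - 1)} |x - y|` for `0 < |x - y| ≤ 2^{-n}`. -/
def LatticeBound {d : ℕ} {Ω : Type*} [MeasurableSpace Ω] (μ : Measure Ω) (φ : TestFn d)
    (p α₀ : ℝ) (ζ : Ω → Distr d) (C : ℝ≥0∞) : Prop :=
  ∀ n : ℕ, 1 ≤ n →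
    (∀ x : Space d, eLpNorm (fun ω => ζ ω (φ.dyadic n x)) (ENNReal.ofReal p) μ ≤
      C * ENNReal.ofReal ((2 : ℝ) ^ (-(n * α₀)))) ∧
    ∀ x y : Space d, 0 < supNorm (x - y) → supNorm (x - y) ≤ (2 : ℝ) ^ (-(n : ℝ)) →
      eLpNorm (fun ω => ζ ω (φ.dyadic n x - φ.dyadic n y)) (ENNReal.ofReal p) μ ≤
        C * ENNReal.ofReal ((2 : ℝ) ^ (-(n * (α₀ - 1))) * supNorm (x - y))

/-- The norm of `C_p^{α₀}`: the smallest constant in the two bounds above (`∞` if there is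
none). -/
def latticeNorm {d : ℕ} {Ω : Type*} [MeasurableSpace Ω] (μ : Measure Ω) (φ : TestFn d)
    (p α₀ : ℝ) (ζ : Ω → Distr d) : ℝ≥0∞ :=
  sInf {C | LatticeBound μ φ p α₀ ζ C}

/-- Membership in `C_p^{α₀}`. -/
def MemLattice {d : ℕ} {Ω : Type*} [MeasurableSpace Ω] (μ : Measure Ω) (φ : TestFn d)
    (p α₀ : ℝ) (ζ : Ω → Distr d) : Prop :=
  IsRandomDistr ζ ∧ latticeNorm μ φ p α₀ ζ < ∞

/-- The norm of `C^{γ₀}([0,T], C_p^{α₀})`. -/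
def latticeTimeNorm {d : ℕ} {Ω : Type*} [MeasurableSpace Ω] (μ : Measure Ω) (φ : TestFn d)
    (p α₀ γ₀ : ℝ) (T : ℝ≥0) (ζ : ℝ≥0 → Ω → Distr d) : ℝ≥0∞ :=
  timeHolderNorm (latticeNorm μ φ p α₀) γ₀ T ζ

/-- Membership in `C_p^{γ₀,α₀} = C^{γ₀}(ℝ₊, C_p^{α₀})`. -/
def MemLatticeTime {d : ℕ} {Ω : Type*} [MeasurableSpace Ω] (μ : Measure Ω) (φ : TestFn d)
    (p α₀ γ₀ : ℝ) (ζ : ℝ≥0 → Ω → Distr d) : Prop :=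
  (∀ t, MemLattice μ φ p α₀ (ζ t)) ∧ ∀ T, latticeTimeNorm μ φ p α₀ γ₀ T ζ < ∞

/-- The `L^p(Ω)` norm of a nonnegative random variable. -/
def lpMoment {Ω : Type*} [MeasurableSpace Ω] (μ : Measure Ω) (p : ℝ) (X : Ω → ℝ≥0∞) : ℝ≥0∞ :=
  (∫⁻ ω, X ω ^ p ∂μ) ^ (1 / p)

/-- Membership in `L^p(Ω, C^α)`. -/
def MemLpHolderDistr {d : ℕ} {α : ℝ} {Ω : Type*} [MeasurableSpace Ω] (μ : Measure Ω) (p : ℝ)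
    (Z : Ω → HolderDistr d α) : Prop :=
  AEStronglyMeasurable Z μ ∧ lpMoment μ p (fun ω => holderDist α (Z ω).toDistr 0) < ∞

/-- Membership in `L^p(Ω, C^γ(ℝ₊, C^α))`. -/
def MemLpHolderPath {d : ℕ} {α γ : ℝ} {Ω : Type*} [MeasurableSpace Ω] (μ : Measure Ω) (p : ℝ)
    (Z : Ω → HolderPath d α γ) : Prop :=
  AEStronglyMeasurable Z μ ∧ ∀ T, lpMoment μ p (fun ω => pathDist α γ T (Z ω).eval 0) < ∞

end

/-!
The argument replaces the pointwise bounds by one weighted Besov norm whose `p`-th moment can be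
computed by Tonelli's theorem, and then proves two deterministic embeddings.

*Space.* Fix `β` with `α + d/p < β < α₀`. The Besov norm `Distr.besovNorm` is the `L^p` norm of the
coefficients `⟨ζ, φ_z^{(n)}⟩` over scales `n ≥ 1` (with weights `2^{nβp}`) and base points `z` (with
the weight `(1 + |z|)^{-(d+1)}`). Since `β < α₀`, its `p`-th moment is at most a constant times the
`p`-th power of the norm of `C_p^{α₀}` (`exists_lintegral_besovNorm_le`). It remains to show that
the Besov norm dominates `d_α(·, 0)` (`Distr.exists_holderGauge_le`), although `φ` is only assumed
to have integral one. The mollifications at the scales `2^{-n}, …, 2^{-(n+r-1)}` are combined by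
Richardson extrapolation into an operator `A_n` whose error on a test function `η` is of order
`2^{-nr} ‖D^r η‖` (`TestFn.abs_extrapolate_sub_le`). As `A_n ^ 2 η → η`, and since the operators
commute, `⟨ζ, η⟩` is the sum of `⟨ζ, A_N ^ 2 η⟩` and the telescoping series of
`⟨ζ, (A_{n+1} + A_n) (A_{n+1} - A_n) η⟩`; in each term one factor is evaluated through the
coefficients of `ζ` and the other one is small (`Distr.exists_abs_apply_le`). Hölder's inequality on
a ball of radius `λ` turns the `L^p` norm in `z` into the loss `d/p` of regularity.

*Time.* Fix `γ'` with `γ < γ' < γ₀ - 1/p`. The path norm `pathNorm` is the `ℓ^p` norm of the Besov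
norms of the dyadic increments in `[0,T]`, with the weights `2^{jγ'p}` at level `j`. Its `p`-th
moment is finite because the roughly `T 2^j` increments of level `j` have `p`-th moments of order
`2^{-jγ₀p}` (`exists_lintegral_pathNorm_le`). Dyadic chaining (`exists_chaining_const`) shows that
it dominates the distance on `[0,T]` (`exists_pathDist_le`), and that a family of finite path norm
extends from the dyadic times to an element of `C^γ(ℝ₊, C^α)` (`exists_holderPath`), where the
Besov norm is complete by Fatou's lemma (`Distr.exists_besovNorm_sub_le`). The extension is a
modification because, at a fixed time, the moments of the differences to the dyadic times below are
summable (`ae_tendsto_dyadicFloor`).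

*Measurability.* The spaces `C^α` and `C^γ(ℝ₊, C^α)` are not separable, but the random elements
constructed here depend continuously on their coefficients, which form a measurable map into a
product of separable `L^p` spaces (`stronglyMeasurable_of_tendsto_eLpNorm`).
-/

open Metric Filter
open scoped Topology

section Smoothing

open scoped ContDiff

/-! ### Test functions, translation and convolution -/

namespace TestFn

variable {d : ℕ}

theorem contDiff_infty (η : TestFn d) : ContDiff ℝ ∞ η := η.contDiff

theorem exists_iteratedFDeriv_bound (η : TestFn d) (i : ℕ) :
    ∃ M, 0 ≤ M ∧ ∀ x, ‖iteratedFDeriv ℝ i η x‖ ≤ M := by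
  obtain ⟨M, hM⟩ := (η.hasCompactSupport.iteratedFDeriv (𝕜 := ℝ) i).exists_bound_of_continuous
    (η.contDiff_infty.continuous_iteratedFDeriv (by exact_mod_cast le_top))
  exact ⟨M, (norm_nonneg _).trans (hM 0), hM⟩

/-- The translate `y ↦ ψ (y - x)` of a test function. -/
noncomputable def translate (ψ : TestFn d) (x : Space d) : TestFn d where
  toFun y := ψ (y - x)
  contDiff' := ψ.contDiff.comp (by fun_prop)
  hasCompactSupport' := ψ.hasCompactSupport.comp_homeomorph (Homeomorph.subRight x)
  tsupport_subset' := by simp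

@[simp] theorem translate_apply (ψ : TestFn d) (x y : Space d) : ψ.translate x y = ψ (y - x) := rfl

theorem rescale_apply (η : TestFn d) {r : ℝ} (hr : 0 < r) (x y : Space d) :
    η.rescale r hr x y = (r ^ d)⁻¹ * η (r⁻¹ • (y - x)) := rfl

theorem dyadic_eq_translate (φ : TestFn d) (n : ℕ) (x : Space d) :
    φ.dyadic n x = (φ.dyadic n 0).translate x := by
  ext y
  simp [dyadic, rescale_apply]

theorem iteratedFDeriv_translate (ψ : TestFn d) (x y : Space d) (i : ℕ) :
    iteratedFDeriv ℝ i (ψ.translate x) y = iteratedFDeriv ℝ i ψ (y - x) := by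
  have : (ψ.translate x : Space d → ℝ) = fun y => ψ (y - x) := rfl
  rw [this, iteratedFDeriv_comp_sub]

/-- The test function `η` vanishes outside the closed ball of radius `ρ` around `x`. -/
def VanishesOutside (η : TestFn d) (x : Space d) (ρ : ℝ) : Prop :=
  ∀ y, ρ < ‖y - x‖ → η y = 0

theorem VanishesOutside.tsupport_subset {η : TestFn d} {x : Space d} {ρ : ℝ}
    (h : η.VanishesOutside x ρ) : tsupport η ⊆ closedBall x ρ := by
  refine closure_minimal (fun y hy => ?_) isClosed_closedBall
  by_contra hc
  rw [mem_closedBall, dist_eq_norm, not_le] at hc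
  exact hy (h y hc)

theorem exists_vanishesOutside (η : TestFn d) : ∃ ρ, 0 ≤ ρ ∧ η.VanishesOutside 0 ρ := by
  obtain ⟨ρ, hρ⟩ := η.hasCompactSupport.isBounded.subset_closedBall (0 : Space d)
  refine ⟨max ρ 0, le_max_right _ _, fun y hy => ?_⟩
  by_contra hc
  have := hρ (subset_tsupport _ hc)
  rw [mem_closedBall, dist_eq_norm] at this
  exact absurd (hy.trans_le this) (not_lt.2 (le_max_left _ _))

theorem VanishesOutside.mono {η : TestFn d} {x : Space d} {ρ ρ' : ℝ}
    (h : η.VanishesOutside x ρ) (hρ : ρ ≤ ρ') : η.VanishesOutside x ρ' :=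
  fun y hy => h y (hρ.trans_lt hy)

/-- The terms of the Taylor series of a convolution are the convolutions with the derivatives. -/
theorem hasFTaylorSeriesUpTo_conv (ψ η : TestFn d) :
    HasFTaylorSeriesUpTo ∞ (fun x => ∫ z, ψ z * η (x - z))
      (fun x i => ∫ z, ψ z • iteratedFDeriv ℝ i η (x - z)) := by
  have hc : ∀ i, Continuous (iteratedFDeriv ℝ i η) := fun i =>
    η.contDiff_infty.continuous_iteratedFDeriv (by exact_mod_cast le_top)
  have hint : ∀ i x, Integrable (fun z => ψ z • iteratedFDeriv ℝ i η (x - z)) := fun i x =>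
    (ψ.continuous.smul ((hc i).comp (by fun_prop))).integrable_of_hasCompactSupport
      ψ.hasCompactSupport.smul_right
  have hder : ∀ i x, HasFDerivAt (fun x => ∫ z, ψ z • iteratedFDeriv ℝ i η (x - z))
      (ContinuousMultilinearMap.curryLeft (∫ z, ψ z • iteratedFDeriv ℝ (i + 1) η (x - z))) x := by
    intro i x
    obtain ⟨M, hM0, hM⟩ := η.exists_iteratedFDeriv_bound (i + 1)
    let L : (Space d [×(i + 1)]→L[ℝ] ℝ) →L[ℝ] (Space d →L[ℝ] (Space d [×i]→L[ℝ] ℝ)) :=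
      (continuousMultilinearCurryLeftEquiv ℝ (fun _ : Fin (i + 1) => Space d)
        ℝ).toContinuousLinearEquiv.toContinuousLinearMap
    have hLn : ∀ m, ‖L m‖ = ‖m‖ := fun m =>
      (continuousMultilinearCurryLeftEquiv ℝ (fun _ : Fin (i + 1) => Space d) ℝ).norm_map m
    have hL : ContinuousMultilinearMap.curryLeft (∫ z, ψ z • iteratedFDeriv ℝ (i + 1) η (x - z)) =
        ∫ z, ψ z • L (iteratedFDeriv ℝ (i + 1) η (x - z)) := by
      change L (∫ z, ψ z • iteratedFDeriv ℝ (i + 1) η (x - z)) = _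
      refine (ContinuousLinearMap.integral_comp_comm (𝕜 := ℝ)
        (Fₗ := Space d →L[ℝ] (Space d [×i]→L[ℝ] ℝ)) L (hint (i + 1) x)).symm.trans ?_
      simp only [map_smul]
    rw [hL]
    refine hasFDerivAt_integral_of_dominated_of_fderiv_le (s := Set.univ)
      (F' := fun x z => ψ z • L (iteratedFDeriv ℝ (i + 1) η (x - z)))
      (bound := fun z => ‖ψ z‖ * M) univ_mem
      (Eventually.of_forall fun x => (hint i x).aestronglyMeasurable) (hint i x)
      ?_ (Eventually.of_forall fun z x _ => ?_) ?_ (Eventually.of_forall fun z x _ => ?_)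
    · have := (hint (i + 1) x).aestronglyMeasurable
      simpa only [map_smul] using L.continuous.comp_aestronglyMeasurable this
    · rw [norm_smul, hLn]
      gcongr
      exact hM _
    · exact (ψ.continuous.norm.integrable_of_hasCompactSupport ψ.hasCompactSupport.norm).mul_const _
    · have h1 : HasFDerivAt (iteratedFDeriv ℝ i η) (L (iteratedFDeriv ℝ (i + 1) η (x - z)))
          (x - z) :=
        (η.contDiff_infty.ftaylorSeries).fderiv i (by exact_mod_cast ENat.natCast_lt_top i) _
      have h2 : HasFDerivAt (fun x => iteratedFDeriv ℝ i η (x - z))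
          (L (iteratedFDeriv ℝ (i + 1) η (x - z))) x := by
        have := h1.comp x ((hasFDerivAt_id x).sub_const z)
        rwa [ContinuousLinearMap.comp_id] at this
      exact h2.const_smul (ψ z)
  refine ⟨fun x => ?_, fun i _ x => hder i x, fun i _ => ?_⟩
  · have := (continuousMultilinearCurryFin0 ℝ (Space d) ℝ).toContinuousLinearEquiv
      |>.toContinuousLinearMap.integral_comp_comm (hint 0 x)
    change (continuousMultilinearCurryFin0 ℝ (Space d) ℝ) _ = _
    refine this.symm.trans ?_
    simp [iteratedFDeriv_zero_eq_comp]
  · exact continuous_iff_continuousAt.2 fun x => (hder i x).continuousAt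

/-- The convolution `x ↦ ∫ ψ z η (x - z) dz` of two test functions. -/
noncomputable def conv (ψ η : TestFn d) : TestFn d where
  toFun x := ∫ z, ψ z * η (x - z)
  contDiff' := (hasFTaylorSeriesUpTo_conv ψ η).contDiff
  hasCompactSupport' := by
    obtain ⟨ρ, -, h⟩ := ψ.exists_vanishesOutside
    obtain ⟨σ, -, h'⟩ := η.exists_vanishesOutside
    refine HasCompactSupport.intro (isCompact_closedBall 0 (ρ + σ)) fun x hx => ?_
    rw [mem_closedBall, dist_zero_right, not_le] at hx
    refine integral_eq_zero_of_ae (Eventually.of_forall fun z => ?_)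
    rcases lt_or_ge ρ ‖z‖ with hz | hz
    · simp [h z (by simpa using hz)]
    · have : η (x - z) = 0 := h' _ (by
        have := norm_sub_norm_le x z
        rw [sub_zero]; linarith)
      simp [this]
  tsupport_subset' := by simp

theorem conv_apply (ψ η : TestFn d) (x : Space d) : conv ψ η x = ∫ z, ψ z * η (x - z) := rfl

theorem VanishesOutside.conv {ψ η : TestFn d} {x : Space d} {ρ σ : ℝ}
    (hψ : ψ.VanishesOutside 0 σ) (hη : η.VanishesOutside x ρ) :
    (conv ψ η).VanishesOutside x (ρ + σ) := by
  intro y hy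
  refine integral_eq_zero_of_ae (Eventually.of_forall fun z => ?_)
  rcases lt_or_ge σ ‖z‖ with hz | hz
  · simp [hψ z (by simpa using hz)]
  · have : η (y - z) = 0 := hη _ (by
      have := norm_sub_norm_le (y - x) z
      rw [sub_right_comm]; linarith)
    simp [this]

theorem iteratedFDeriv_conv (ψ η : TestFn d) (i : ℕ) (x : Space d) :
    iteratedFDeriv ℝ i (conv ψ η) x = ∫ z, ψ z • iteratedFDeriv ℝ i η (x - z) :=
  ((hasFTaylorSeriesUpTo_conv ψ η).eq_iteratedFDeriv (by exact_mod_cast le_top) x).symm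

theorem conv_comm (ψ η : TestFn d) : conv ψ η = conv η ψ := by
  ext x
  rw [conv_apply, conv_apply, ← integral_sub_left_eq_self _ volume x]
  simp [mul_comm]

theorem integrable_mul_comp_sub (ψ η : TestFn d) (x : Space d) :
    Integrable fun z => ψ z * η (x - z) :=
  (ψ.continuous.mul (η.continuous.comp (by fun_prop))).integrable_of_hasCompactSupport
    ψ.hasCompactSupport.mul_right

/-- Convolution with a fixed test function, as a linear map. -/
noncomputable def convL (ψ : TestFn d) : TestFn d →ₗ[ℝ] TestFn d where
  toFun := conv ψ
  map_add' η θ := by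
    ext x
    simp only [conv_apply, FunLike.coe_add, Pi.add_apply, mul_add]
    exact integral_add (integrable_mul_comp_sub _ _ _) (integrable_mul_comp_sub _ _ _)
  map_smul' c η := by
    ext x
    simp only [conv_apply, FunLike.coe_smul, Pi.smul_apply, smul_eq_mul, RingHom.id_apply,
      mul_left_comm _ c]
    exact integral_const_mul _ _

@[simp] theorem convL_apply (ψ η : TestFn d) : convL ψ η = conv ψ η := rfl

theorem conv_left_comm (ψ θ η : TestFn d) : conv ψ (conv θ η) = conv θ (conv ψ η) := by
  ext x
  simp only [conv_apply]
  simp_rw [← integral_const_mul]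
  rw [integral_integral_swap]
  · refine integral_congr_ae (Eventually.of_forall fun z => integral_congr_ae
      (Eventually.of_forall fun w => ?_))
    simp only [sub_right_comm x z w]
    ring
  · obtain ⟨M, hM0, hM⟩ := η.exists_iteratedFDeriv_bound 0
    have h1 : Integrable (fun q : Space d × Space d => ψ q.1 * θ q.2) (volume.prod volume) :=
      (ψ.continuous.integrable_of_hasCompactSupport ψ.hasCompactSupport).mul_prod
        (θ.continuous.integrable_of_hasCompactSupport θ.hasCompactSupport)
    have h2 := h1.mul_bdd (c := M) (g := fun q : Space d × Space d => η (x - q.1 - q.2))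
      (by have := η.continuous; fun_prop) (Eventually.of_forall fun q => by
        have := hM (x - q.1 - q.2); rwa [norm_iteratedFDeriv_zero] at this)
    refine h2.congr (Eventually.of_forall fun q => ?_)
    simp [Function.uncurry, mul_assoc]

theorem commute_convL (ψ θ : TestFn d) : Commute (convL ψ : Module.End ℝ (TestFn d)) (convL θ) :=
  LinearMap.ext fun η => conv_left_comm ψ θ η

end TestFn

/-! ### Distributions applied to translates and convolutions -/

namespace TestFn

variable {d : ℕ}

theorem norm_iteratedFDeriv_sub_le {η : TestFn d} {i : ℕ} {M : ℝ}
    (hM : ∀ x, ‖iteratedFDeriv ℝ (i + 1) η x‖ ≤ M) (x y : Space d) :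
    ‖iteratedFDeriv ℝ i η x - iteratedFDeriv ℝ i η y‖ ≤ M * ‖x - y‖ := by
  refine convex_univ.norm_image_sub_le_of_norm_fderiv_le (𝕜 := ℝ) (fun z _ => ?_) (fun z _ => ?_)
    (Set.mem_univ y) (Set.mem_univ x)
  · exact (η.contDiff_infty.differentiable_iteratedFDeriv
      (by exact_mod_cast ENat.natCast_lt_top i)).differentiableAt
  · rw [norm_fderiv_iteratedFDeriv]
    exact hM z

theorem iteratedFDeriv_sub (η θ : TestFn d) (i : ℕ) (x : Space d) :
    iteratedFDeriv ℝ i (η - θ : TestFn d) x =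
      iteratedFDeriv ℝ i η x - iteratedFDeriv ℝ i θ x := by
  rw [FunLike.coe_sub]
  exact iteratedFDeriv_sub_apply (η.contDiff_infty.contDiffAt.of_le (by exact_mod_cast le_top))
    (θ.contDiff_infty.contDiffAt.of_le (by exact_mod_cast le_top))

theorem iteratedFDeriv_add (η θ : TestFn d) (i : ℕ) (x : Space d) :
    iteratedFDeriv ℝ i (η + θ : TestFn d) x =
      iteratedFDeriv ℝ i η x + iteratedFDeriv ℝ i θ x := by
  rw [FunLike.coe_add]
  exact iteratedFDeriv_add_apply (η.contDiff_infty.contDiffAt.of_le (by exact_mod_cast le_top))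
    (θ.contDiff_infty.contDiffAt.of_le (by exact_mod_cast le_top))

theorem iteratedFDeriv_smul (c : ℝ) (η : TestFn d) (i : ℕ) (x : Space d) :
    iteratedFDeriv ℝ i (c • η : TestFn d) x = c • iteratedFDeriv ℝ i η x := by
  rw [FunLike.coe_smul]
  exact iteratedFDeriv_const_smul_apply
    (η.contDiff_infty.contDiffAt.of_le (by exact_mod_cast le_top))

theorem VanishesOutside.translate {ψ : TestFn d} {σ : ℝ} (h : ψ.VanishesOutside 0 σ)
    (z : Space d) : (ψ.translate z).VanishesOutside z σ :=
  fun y hy => h _ (by simpa using hy)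

theorem VanishesOutside.of_ball {η : TestFn d} {x y : Space d} {ρ σ : ℝ}
    (h : η.VanishesOutside x ρ) (hσ : ρ + ‖x - y‖ ≤ σ) : η.VanishesOutside y σ := by
  intro z hz
  refine h z ?_
  have := norm_sub_le_norm_sub_add_norm_sub z x y
  linarith

theorem VanishesOutside.add {η θ : TestFn d} {x : Space d} {ρ : ℝ}
    (h : η.VanishesOutside x ρ) (h' : θ.VanishesOutside x ρ) : (η + θ).VanishesOutside x ρ :=
  fun y hy => by simp [h y hy, h' y hy]

theorem VanishesOutside.sub {η θ : TestFn d} {x : Space d} {ρ : ℝ}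
    (h : η.VanishesOutside x ρ) (h' : θ.VanishesOutside x ρ) : (η - θ).VanishesOutside x ρ :=
  fun y hy => by simp [h y hy, h' y hy]

theorem VanishesOutside.smul {η : TestFn d} {x : Space d} {ρ : ℝ}
    (h : η.VanishesOutside x ρ) (c : ℝ) : (c • η).VanishesOutside x ρ :=
  fun y hy => by simp [h y hy]

/-- The Banach space of bounded continuous fields of `i`-linear forms on `ℝ^d`. -/
def FormField (d i : ℕ) : Type :=
  BoundedContinuousFunction (Space d) (Space d [×i]→L[ℝ] ℝ)

noncomputable instance (i : ℕ) : NormedAddCommGroup (FormField d i) :=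
  inferInstanceAs (NormedAddCommGroup
    (BoundedContinuousFunction (Space d) (Space d [×i]→L[ℝ] ℝ)))

noncomputable instance (i : ℕ) : NormedSpace ℝ (FormField d i) :=
  inferInstanceAs (NormedSpace ℝ
    (BoundedContinuousFunction (Space d) (Space d [×i]→L[ℝ] ℝ)))

instance (i : ℕ) : CompleteSpace (FormField d i) :=
  inferInstanceAs (CompleteSpace
    (BoundedContinuousFunction (Space d) (Space d [×i]→L[ℝ] ℝ)))

/-- The derivatives of order at most `k` of a test function, as bounded continuous functions. -/
noncomputable def jet (k : ℕ) : TestFn d →ₗ[ℝ] ∀ i : Fin (k + 1), FormField d i where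
  toFun η i := BoundedContinuousFunction.ofNormedAddCommGroup (iteratedFDeriv ℝ i η)
    (η.contDiff_infty.continuous_iteratedFDeriv (by exact_mod_cast le_top))
    (η.exists_iteratedFDeriv_bound i).choose (η.exists_iteratedFDeriv_bound i).choose_spec.2
  map_add' η θ := by
    funext i
    exact BoundedContinuousFunction.ext fun x => iteratedFDeriv_add η θ i x
  map_smul' c η := by
    funext i
    exact BoundedContinuousFunction.ext fun x => iteratedFDeriv_smul c η i x

/-- Evaluation of a field of `i`-linear forms at a point. -/
noncomputable def FormField.evalCLM (i : ℕ) (x : Space d) :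
    FormField d i →L[ℝ] (Space d [×i]→L[ℝ] ℝ) :=
  BoundedContinuousFunction.evalCLM ℝ x

theorem FormField.ext_evalCLM {i : ℕ} {f g : FormField d i}
    (h : ∀ x, evalCLM i x f = evalCLM i x g) : f = g :=
  BoundedContinuousFunction.ext h

theorem evalCLM_jet (k : ℕ) (η : TestFn d) (i : Fin (k + 1)) (x : Space d) :
    FormField.evalCLM i x (jet k η i) = iteratedFDeriv ℝ i η x := rfl

theorem norm_iteratedFDeriv_le_norm_jet (k : ℕ) (η : TestFn d) (i : Fin (k + 1)) (x : Space d) :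
    ‖iteratedFDeriv ℝ i η x‖ ≤ ‖jet k η‖ :=
  (BoundedContinuousFunction.norm_coe_le_norm
    (show BoundedContinuousFunction (Space d) (Space d [×(i : ℕ)]→L[ℝ] ℝ) from jet k η i) x).trans
    (norm_le_pi_norm (jet k η) i)

theorem jet_injective (k : ℕ) : Function.Injective (jet (d := d) k) := by
  intro η θ h
  ext x
  have h0 : iteratedFDeriv ℝ 0 η x = iteratedFDeriv ℝ 0 θ x :=
    congrArg (fun F => FormField.evalCLM _ x (F 0)) h
  simpa using congrArg (fun F => F 0) h0

theorem continuous_jet_translate (k : ℕ) (ψ : TestFn d) :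
    Continuous fun z => jet k (ψ.translate z) := by
  refine continuous_pi fun i => ?_
  obtain ⟨M, hM0, hM⟩ := ψ.exists_iteratedFDeriv_bound (i + 1)
  refine (LipschitzWith.of_dist_le_mul (K := ⟨M, hM0⟩) fun z w => ?_).continuous
  refine (BoundedContinuousFunction.dist_le (by positivity)).2 fun x => ?_
  change dist (iteratedFDeriv ℝ i (ψ.translate z) x) (iteratedFDeriv ℝ i (ψ.translate w) x) ≤ _
  rw [dist_eq_norm, iteratedFDeriv_translate, iteratedFDeriv_translate]
  refine (norm_iteratedFDeriv_sub_le hM _ _).trans_eq ?_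
  rw [sub_sub_sub_cancel_left, dist_comm, dist_eq_norm]
  rfl

end TestFn

namespace Distr

open TestFn

variable {d : ℕ}

/-- On test functions supported in a fixed compact set, a distribution has finite order. -/
theorem exists_bound (ζ : Distr d) {K : Set (Space d)} (hK : IsCompact K) :
    ∃ (k : ℕ) (C : ℝ), 0 ≤ C ∧ ∀ ψ : TestFn d, tsupport ψ ⊆ K → ∀ M, 0 ≤ M →
      (∀ i ≤ k, ∀ x, ‖iteratedFDeriv ℝ i ψ x‖ ≤ M) → ‖ζ ψ‖ ≤ C * M := by
  let K' : Compacts (Space d) := ⟨K, hK⟩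
  have hsub : (K' : Set (Space d)) ⊆ (⊤ : Opens (Space d)) := fun _ _ => trivial
  let q : Seminorm ℝ 𝓓_{K'}(Space d, ℝ) :=
    (normSeminorm ℝ ℝ).comp (ζ.toLinearMap ∘ₗ
      (TestFunction.ofSupportedInCLM ℝ hsub : _ →L[ℝ] TestFn d).toLinearMap)
  have hq : Continuous q := by
    change Continuous fun ψ => ‖ζ (TestFunction.ofSupportedIn hsub ψ)‖
    exact (ζ.continuous.comp (TestFunction.continuous_ofSupportedIn hsub)).norm
  obtain ⟨s, C, -, hC⟩ := Seminorm.bound_of_continuous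
    (ContDiffMapSupportedIn.withSeminorms ℝ (Space d) ℝ ⊤ K') q hq
  refine ⟨s.sup id, C, C.2, fun ψ hψ M hM0 hM => ?_⟩
  let ψ' : 𝓓_{K'}(Space d, ℝ) :=
    .of_support_subset ψ.contDiff ((subset_tsupport _).trans hψ)
  have h1 : q ψ' = ‖ζ ψ‖ := rfl
  rw [← h1]
  refine (hC ψ').trans ?_
  change (C : ℝ) * _ ≤ _
  gcongr
  refine Seminorm.finset_sup_apply_le hM0 fun i hi => ?_
  rw [ContDiffMapSupportedIn.seminorm_top_le_iff ℝ hM0]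
  exact fun x _ => hM i (Finset.le_sup (f := id) hi) x

/-- On test functions supported in a fixed compact set, a distribution is a continuous functional
of finitely many derivatives: the bound of finite order extends from the space of jets of test
functions by the Hahn-Banach theorem. -/
theorem exists_eq_comp_jet (ζ : Distr d) {K : Set (Space d)} (hK : IsCompact K) :
    ∃ (k : ℕ) (L : (∀ i : Fin (k + 1), FormField d i) →L[ℝ] ℝ),
      ∀ ψ : TestFn d, tsupport ψ ⊆ K → ζ ψ = L (jet k ψ) := by
  obtain ⟨k, C, hC0, hC⟩ := ζ.exists_bound hK
  let S : Submodule ℝ (TestFn d) :=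
    { carrier := {ψ | ∀ x ∉ K, ψ x = 0}
      add_mem' := fun {ψ θ} h h' x hx => by simp [h x hx, h' x hx]
      zero_mem' := fun x _ => by simp
      smul_mem' := fun c ψ h x hx => by simp [h x hx] }
  have hS : ∀ ψ ∈ S, tsupport ψ ⊆ K := fun ψ hψ =>
    closure_minimal (fun x hx => by by_contra hc; exact hx (hψ x hc)) hK.isClosed
  let J := (jet k).comp S.subtype
  have hJ : Function.Injective J := (jet_injective k).comp S.injective_subtype
  let e := LinearEquiv.ofInjective J hJ
  let f : StrongDual ℝ (LinearMap.range J) :=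
    LinearMap.mkContinuous (ζ.toLinearMap ∘ₗ S.subtype ∘ₗ e.symm.toLinearMap) C fun v => by
      obtain ⟨ψ, rfl⟩ := e.surjective v
      simp only [LinearMap.comp_apply, LinearEquiv.coe_coe, LinearEquiv.symm_apply_apply]
      refine hC ψ (hS _ ψ.2) _ (norm_nonneg _) fun i hi x => ?_
      exact norm_iteratedFDeriv_le_norm_jet k _ ⟨i, Nat.lt_succ_of_le hi⟩ x
  obtain ⟨L, hL, -⟩ := exists_extension_norm_eq (LinearMap.range J) f
  refine ⟨k, L, fun ψ hψ => ?_⟩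
  have hψS : ψ ∈ S := fun x hx => image_eq_zero_of_notMem_tsupport fun h => hx (hψ h)
  have h2 := hL (e ⟨ψ, hψS⟩)
  have h3 : ((e ⟨ψ, hψS⟩ : LinearMap.range J) : ∀ i : Fin (k + 1), FormField d i) = jet k ψ := rfl
  rw [h3] at h2
  rw [h2]
  change ζ ψ = ζ (S.subtype (e.symm (e ⟨ψ, hψS⟩)))
  rw [LinearEquiv.symm_apply_apply]
  rfl

theorem continuous_apply_translate (ζ : Distr d) (ψ : TestFn d) :
    Continuous fun z => ζ (ψ.translate z) := by
  obtain ⟨σ, hσ0, hσ⟩ := ψ.exists_vanishesOutside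
  refine continuous_iff_continuousAt.2 fun z₀ => ?_
  obtain ⟨k, L, hL⟩ := ζ.exists_eq_comp_jet (isCompact_closedBall z₀ (σ + 1))
  refine ((L.continuous.comp (continuous_jet_translate k ψ)).continuousAt (x := z₀)).congr ?_
  filter_upwards [closedBall_mem_nhds z₀ one_pos] with z hz
  refine (hL _ ((hσ.translate z).of_ball ?_).tsupport_subset).symm
  rw [mem_closedBall, dist_eq_norm] at hz
  linarith

/-- The action of a distribution on a convolution, by commuting the functional with the integral in
the Banach space of jets. -/
theorem apply_conv (ζ : Distr d) (ψ η : TestFn d) :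
    ζ (conv ψ η) = ∫ z, η z * ζ (ψ.translate z) := by
  obtain ⟨σ, hσ0, hσ⟩ := ψ.exists_vanishesOutside
  obtain ⟨ρ, hρ0, hρ⟩ := η.exists_vanishesOutside
  obtain ⟨k, L, hL⟩ := ζ.exists_eq_comp_jet (isCompact_closedBall (0 : Space d) (ρ + σ))
  have hint : Integrable fun z => η z • jet k (ψ.translate z) :=
    (η.continuous.smul (continuous_jet_translate k ψ)).integrable_of_hasCompactSupport
      η.hasCompactSupport.smul_right
  have h1 : ∫ z, η z • jet k (ψ.translate z) = jet k (conv ψ η) := by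
    funext i
    refine FormField.ext_evalCLM fun x => ?_
    rw [evalCLM_jet, conv_comm, iteratedFDeriv_conv]
    let ev := (FormField.evalCLM (i : ℕ) x).comp
      (ContinuousLinearMap.proj (R := ℝ) (φ := fun i : Fin (k + 1) => FormField d i) i)
    refine (ContinuousLinearMap.integral_comp_comm ev hint).symm.trans ?_
    refine integral_congr_ae (Eventually.of_forall fun z => ?_)
    change ev (η z • jet k (ψ.translate z)) = _
    rw [map_smul]
    change η z • FormField.evalCLM _ x (jet k (ψ.translate z) i) = _
    rw [evalCLM_jet, iteratedFDeriv_translate]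
  rw [hL _ (hσ.conv hρ).tsupport_subset, ← h1, ← L.integral_comp_comm hint]
  refine integral_congr_ae (Eventually.of_forall fun z => ?_)
  change L (η z • jet k (ψ.translate z)) = _
  rw [map_smul, smul_eq_mul]
  rcases lt_or_ge ρ ‖z‖ with hz | hz
  · simp [hρ z (by simpa using hz)]
  · rw [← hL _ ((hσ.translate z).of_ball ?_).tsupport_subset]
    rw [sub_zero]; linarith

end Distr

/-! ### Approximation of test functions by mollification -/

/-- Extrapolation weights: a combination of values at the nodes `2^{-i}`, `i < r`, that reproduces
the value at `0` of every polynomial of degree less than `r`. -/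
theorem exists_extrapolation_weights (r : ℕ) :
    ∃ c : ℕ → ℝ, ∀ m < r, ∑ i ∈ Finset.range r, c i * ((2 : ℝ)⁻¹ ^ i) ^ m = 0 ^ m := by
  let v : ℕ → ℝ := fun i => (2 : ℝ)⁻¹ ^ i
  have hv : Set.InjOn v (Finset.range r : Set ℕ) := fun i _ j _ h =>
    pow_right_injective₀ (by norm_num) (by norm_num) h
  refine ⟨fun i => (Lagrange.basis (Finset.range r) v i).eval 0, fun m hm => ?_⟩
  have h := Lagrange.eq_interpolate (s := Finset.range r) (v := v) (f := Polynomial.X ^ m) hv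
    (by rw [Polynomial.degree_X_pow, Finset.card_range]; exact_mod_cast hm)
  have h' := congrArg (Polynomial.eval 0) h
  rw [Lagrange.interpolate_apply, Polynomial.eval_finsetSum] at h'
  simp only [Polynomial.eval_pow, Polynomial.eval_X, Polynomial.eval_mul, Polynomial.eval_C] at h'
  rw [h']
  exact Finset.sum_congr rfl fun i _ => mul_comm _ _

/-- Richardson extrapolation: the weighted values at the points `2^{-i} s` agree with the value at
`0` up to an error of order `s ^ r`. -/
theorem abs_extrapolation_sub_le {r : ℕ} (hr : 1 ≤ r) {c : ℕ → ℝ}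
    (hc : ∀ m < r, ∑ i ∈ Finset.range r, c i * ((2 : ℝ)⁻¹ ^ i) ^ m = 0 ^ m)
    {u : ℝ → ℝ} (hu : ContDiff ℝ ∞ u) {M : ℝ} (hM : ∀ s, ‖iteratedFDeriv ℝ r u s‖ ≤ M)
    {s : ℝ} (hs : 0 < s) :
    |∑ i ∈ Finset.range r, c i * u ((2 : ℝ)⁻¹ ^ i * s) - u 0| ≤
      (∑ i ∈ Finset.range r, |c i|) * (M * s ^ r) := by
  obtain ⟨n, rfl⟩ : ∃ n, r = n + 1 := ⟨r - 1, by omega⟩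
  have hM0 : 0 ≤ M := (norm_nonneg _).trans (hM 0)
  have hU : UniqueDiffOn ℝ (Set.Icc 0 s) := uniqueDiffOn_Icc hs
  set T := taylorWithinEval u n (Set.Icc 0 s) 0 with hT
  have hT0 : ∑ i ∈ Finset.range (n + 1), c i * T ((2 : ℝ)⁻¹ ^ i * s) = u 0 := by
    simp only [hT, taylor_within_apply, sub_zero, smul_eq_mul, Finset.mul_sum]
    rw [Finset.sum_comm]
    have h1 : ∀ k ∈ Finset.range (n + 1), ∑ i ∈ Finset.range (n + 1),
        c i * (((k.factorial : ℝ)⁻¹ * ((2 : ℝ)⁻¹ ^ i * s) ^ k) *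
          iteratedDerivWithin k u (Set.Icc 0 s) 0) =
        ((k.factorial : ℝ)⁻¹ * s ^ k * iteratedDerivWithin k u (Set.Icc 0 s) 0) * 0 ^ k := by
      intro k hk
      rw [← hc k (Finset.mem_range.1 hk), Finset.mul_sum]
      refine Finset.sum_congr rfl fun i _ => ?_
      rw [mul_pow]; ring
    rw [Finset.sum_congr rfl h1, Finset.sum_eq_single 0]
    · simp
    · intro k _ hk; simp [hk]
    · simp
  have hrem : ∀ i ∈ Finset.range (n + 1),
      |u ((2 : ℝ)⁻¹ ^ i * s) - T ((2 : ℝ)⁻¹ ^ i * s)| ≤ M * s ^ (n + 1) := by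
    intro i _
    have hle : (2 : ℝ)⁻¹ ^ i ≤ 1 := pow_le_one₀ (by norm_num) (by norm_num)
    have hpos : 0 < (2 : ℝ)⁻¹ ^ i := by positivity
    have hx : (2 : ℝ)⁻¹ ^ i * s ∈ Set.Icc 0 s := ⟨by positivity, by nlinarith⟩
    have hb := taylor_mean_remainder_bound (C := M) hs.le
      (hu.contDiffOn.of_le (by exact_mod_cast le_top)) hx fun y hy => by
        rw [iteratedDerivWithin_eq_iteratedDeriv hU
          (hu.contDiffAt.of_le (by exact_mod_cast le_top)) hy,
          ← norm_iteratedFDeriv_eq_norm_iteratedDeriv]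
        exact hM y
    refine hb.trans ?_
    rw [sub_zero]
    refine (div_le_self (by positivity) (by exact_mod_cast n.factorial_pos)).trans ?_
    gcongr
    exact hx.2
  rw [← hT0, ← Finset.sum_sub_distrib, Finset.sum_mul]
  refine (Finset.abs_sum_le_sum_abs _ _).trans (Finset.sum_le_sum fun i hi => ?_)
  rw [← mul_sub, abs_mul]
  gcongr
  exact hrem i hi

namespace TestFn

variable {d : ℕ}

theorem norm_iteratedFDeriv_line_le (η : TestFn d) {r : ℕ} {M : ℝ}
    (hM : ∀ x, ‖iteratedFDeriv ℝ r η x‖ ≤ M) (x y : Space d) (hy : ‖y‖ ≤ 1) (s : ℝ) :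
    ‖iteratedFDeriv ℝ r (fun s : ℝ => η (x - s • y)) s‖ ≤ M := by
  let g : ℝ →L[ℝ] Space d := ContinuousLinearMap.toSpanSingleton ℝ (-y)
  have h1 : (fun s : ℝ => η (x - s • y)) = (fun z => η (z + x)) ∘ g := by
    funext s
    simp [g, ContinuousLinearMap.toSpanSingleton_apply, sub_eq_neg_add]
  have h2 : ContDiff ℝ ∞ fun z => η (z + x) := η.contDiff_infty.comp (by fun_prop)
  rw [h1, g.iteratedFDeriv_comp_right h2 s (by exact_mod_cast le_top)]
  refine (ContinuousMultilinearMap.norm_compContinuousLinearMap_le _ _).trans ?_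
  rw [iteratedFDeriv_comp_add_right]
  have hg : ‖g‖ ≤ 1 := by simpa [g] using hy
  have hM0 : 0 ≤ M := (norm_nonneg _).trans (hM 0)
  calc _ ≤ M * 1 := by
        gcongr
        · exact hM _
        · exact Finset.prod_le_one (fun _ _ => norm_nonneg _) fun _ _ => hg
    _ = M := mul_one M

theorem conv_rescale_apply (φ η : TestFn d) {s : ℝ} (hs : 0 < s) (x : Space d) :
    conv (φ.rescale s hs 0) η x = ∫ y, φ y * η (x - s • y) := by
  rw [conv_apply]
  have h := Measure.integral_comp_smul (volume : Measure (Space d))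
    (fun y => φ y * η (x - s • y)) s⁻¹
  have h2 : ∀ z, φ (s⁻¹ • z) * η (x - s • s⁻¹ • z) = φ (s⁻¹ • z) * η (x - z) := fun z => by
    rw [smul_inv_smul₀ hs.ne']
  simp only [h2, finrank_euclideanSpace_fin] at h
  simp only [rescale_apply, sub_zero, mul_assoc]
  rw [integral_const_mul, h, smul_eq_mul, ← mul_assoc, inv_pow, inv_inv,
    abs_of_pos (by positivity), inv_mul_cancel₀ (by positivity), one_mul]

theorem integral_rescale (φ : TestFn d) {s : ℝ} (hs : 0 < s) (f : ℝ → ℝ)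
    (hf : ∀ c a : ℝ, 0 < c → f (c * a) = c * f a) :
    ∫ y, f (φ.rescale s hs 0 y) = ∫ y, f (φ y) := by
  have h := Measure.integral_comp_smul (volume : Measure (Space d)) (fun y => f (φ y)) s⁻¹
  simp only [finrank_euclideanSpace_fin] at h
  have hpos : 0 < (s ^ d)⁻¹ := by positivity
  simp only [rescale_apply, sub_zero, hf _ _ hpos]
  rw [integral_const_mul, h, smul_eq_mul, ← mul_assoc, inv_pow, inv_inv,
    abs_of_pos (by positivity), inv_mul_cancel₀ (by positivity), one_mul]

theorem VanishesOutside.rescale {φ : TestFn d} {ρ : ℝ} (h : φ.VanishesOutside 0 ρ) {s : ℝ}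
    (hs : 0 < s) (x : Space d) : (φ.rescale s hs x).VanishesOutside x (s * ρ) := by
  intro y hy
  rw [rescale_apply, h _ ?_, mul_zero]
  rw [sub_zero, norm_smul, norm_inv, Real.norm_of_nonneg hs.le]
  rwa [inv_mul_eq_div, lt_div_iff₀' hs]

theorem VanishesOutside.of_tsupport {φ : TestFn d} (h : tsupport φ ⊆ ball 0 1) :
    φ.VanishesOutside 0 1 := by
  intro y hy
  refine image_eq_zero_of_notMem_tsupport fun hc => ?_
  have := h hc
  rw [mem_ball, dist_eq_norm] at this
  exact lt_asymm hy this

theorem vanishesOutside_dyadic {φ : TestFn d} (hφ : IsMollifier φ) (n : ℕ) :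
    (φ.dyadic n 0).VanishesOutside 0 ((2 : ℝ)⁻¹ ^ n) := by
  have := (VanishesOutside.of_tsupport hφ.1).rescale (s := ((2 : ℝ) ^ n)⁻¹) (by positivity) 0
  rw [mul_one] at this
  rw [inv_pow]
  exact this

theorem integral_dyadic {φ : TestFn d} (hφ : IsMollifier φ) (n : ℕ) :
    ∫ y, φ.dyadic n 0 y = 1 := by
  rw [← hφ.2]
  exact integral_rescale φ (by positivity) id fun _ _ _ => rfl

theorem integral_abs_dyadic (φ : TestFn d) (n : ℕ) :
    ∫ y, |φ.dyadic n 0 y| = ∫ y, |φ y| :=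
  integral_rescale φ (by positivity) abs fun c a hc => by rw [abs_mul, abs_of_pos hc]

theorem norm_iteratedFDeriv_conv_le (ψ η : TestFn d) {i : ℕ} {M : ℝ}
    (hM : ∀ x, ‖iteratedFDeriv ℝ i η x‖ ≤ M) (x : Space d) :
    ‖iteratedFDeriv ℝ i (conv ψ η) x‖ ≤ (∫ y, |ψ y|) * M := by
  rw [iteratedFDeriv_conv, ← integral_mul_const]
  refine norm_integral_le_of_norm_le ?_ (Eventually.of_forall fun z => ?_)
  · exact (ψ.continuous.abs.integrable_of_hasCompactSupport ψ.hasCompactSupport.norm).mul_const _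
  · rw [norm_smul, Real.norm_eq_abs]
    gcongr
    exact hM _

theorem norm_iteratedFDeriv_conv_sub_le {ψ : TestFn d} {σ : ℝ} (hψ : ψ.VanishesOutside 0 σ)
    (hψ1 : ∫ y, ψ y = 1) (η : TestFn d) {i : ℕ} {M : ℝ}
    (hM : ∀ x, ‖iteratedFDeriv ℝ (i + 1) η x‖ ≤ M) (x : Space d) :
    ‖iteratedFDeriv ℝ i (conv ψ η - η : TestFn d) x‖ ≤ (∫ y, |ψ y|) * (M * σ) := by
  have hM0 : 0 ≤ M := (norm_nonneg _).trans (hM 0)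
  have hc : Continuous (iteratedFDeriv ℝ i η) :=
    η.contDiff_infty.continuous_iteratedFDeriv (by exact_mod_cast le_top)
  have h1 : iteratedFDeriv ℝ i η x = ∫ z, ψ z • iteratedFDeriv ℝ i η x := by
    rw [integral_smul_const, hψ1, one_smul]
  have hi1 : Integrable fun z => ψ z • iteratedFDeriv ℝ i η (x - z) :=
    (ψ.continuous.smul (hc.comp (by fun_prop))).integrable_of_hasCompactSupport
      ψ.hasCompactSupport.smul_right
  have hi2 : Integrable fun z => ψ z • iteratedFDeriv ℝ i η x :=
    (ψ.continuous.smul continuous_const).integrable_of_hasCompactSupport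
      ψ.hasCompactSupport.smul_right
  rw [iteratedFDeriv_sub, iteratedFDeriv_conv, h1, ← integral_sub hi1 hi2, ← integral_mul_const]
  refine norm_integral_le_of_norm_le ?_ (Eventually.of_forall fun z => ?_)
  · exact (ψ.continuous.abs.integrable_of_hasCompactSupport ψ.hasCompactSupport.norm).mul_const _
  · rw [← smul_sub, norm_smul, Real.norm_eq_abs]
    rcases lt_or_ge σ ‖z‖ with hz | hz
    · simp [hψ z (by simpa using hz)]
    · gcongr
      refine (norm_iteratedFDeriv_sub_le hM _ _).trans ?_
      rw [sub_sub_cancel_left, norm_neg]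
      gcongr

/-- The extrapolated mollification `∑_{i < r} c i · (η * φ^{(n + i)})`. -/
noncomputable def extrapolate (φ : TestFn d) (c : ℕ → ℝ) (r n : ℕ) :
    Module.End ℝ (TestFn d) :=
  ∑ i ∈ Finset.range r, c i • convL (φ.dyadic (n + i) 0)

theorem extrapolate_apply (φ : TestFn d) (c : ℕ → ℝ) (r n : ℕ) (η : TestFn d) :
    extrapolate φ c r n η = ∑ i ∈ Finset.range r, c i • conv (φ.dyadic (n + i) 0) η := by
  simp [extrapolate]

theorem commute_extrapolate (φ : TestFn d) (c : ℕ → ℝ) (r n m : ℕ) :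
    Commute (extrapolate φ c r n) (extrapolate φ c r m) :=
  Commute.sum_left _ _ _ fun _ _ => Commute.sum_right _ _ _ fun _ _ =>
    ((commute_convL _ _).smul_left _).smul_right _

theorem iteratedFDeriv_sum {ι : Type*} (s : Finset ι) (c : ι → ℝ) (f : ι → TestFn d) (i : ℕ)
    (x : Space d) : iteratedFDeriv ℝ i (∑ j ∈ s, c j • f j : TestFn d) x =
      ∑ j ∈ s, c j • iteratedFDeriv ℝ i (f j) x := by
  classical
  induction s using Finset.induction_on with
  | empty =>
    simp only [Finset.sum_empty]
    have : ((0 : TestFn d) : Space d → ℝ) = fun _ => 0 := rfl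
    rw [this, iteratedFDeriv_fun_zero]
    rfl
  | insert a s ha ih => rw [Finset.sum_insert ha, Finset.sum_insert ha, iteratedFDeriv_add,
      iteratedFDeriv_smul, ih]

theorem VanishesOutside.sum {ι : Type*} {s : Finset ι} {f : ι → TestFn d} {x : Space d} {ρ : ℝ}
    (h : ∀ j ∈ s, (f j).VanishesOutside x ρ) : (∑ j ∈ s, f j).VanishesOutside x ρ := by
  classical
  induction s using Finset.induction_on with
  | empty => intro y _; rfl
  | insert a s ha ih =>
    rw [Finset.sum_insert ha]
    exact (h a (Finset.mem_insert_self _ _)).add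
      (ih fun j hj => h j (Finset.mem_insert_of_mem hj))

section Mollifier

variable {φ : TestFn d} {r : ℕ} {c : ℕ → ℝ}

theorem VanishesOutside.extrapolate (hφ : IsMollifier φ) {η : TestFn d} {x : Space d} {ρ : ℝ}
    (hη : η.VanishesOutside x ρ) (n : ℕ) :
    (extrapolate φ c r n η).VanishesOutside x (ρ + (2 : ℝ)⁻¹ ^ n) := by
  rw [extrapolate_apply]
  refine VanishesOutside.sum fun i _ => (((vanishesOutside_dyadic hφ _).conv hη).smul _).mono
    (add_le_add_right ?_ _)
  exact pow_le_pow_of_le_one (by norm_num) (by norm_num) (Nat.le_add_right _ _)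

theorem norm_iteratedFDeriv_extrapolate_le (η : TestFn d) {i : ℕ} {M : ℝ}
    (hM : ∀ x, ‖iteratedFDeriv ℝ i η x‖ ≤ M) (n : ℕ) (x : Space d) :
    ‖iteratedFDeriv ℝ i (extrapolate φ c r n η) x‖ ≤
      (∑ i ∈ Finset.range r, |c i|) * (∫ y, |φ y|) * M := by
  rw [extrapolate_apply, iteratedFDeriv_sum, mul_assoc, Finset.sum_mul]
  refine (norm_sum_le _ _).trans (Finset.sum_le_sum fun j _ => ?_)
  rw [norm_smul, Real.norm_eq_abs]
  gcongr
  refine (norm_iteratedFDeriv_conv_le _ η hM x).trans_eq ?_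
  rw [integral_abs_dyadic]

theorem norm_iteratedFDeriv_extrapolate_sub_le (hφ : IsMollifier φ)
    (hc : ∑ i ∈ Finset.range r, c i = 1) (η : TestFn d) {i : ℕ} {M : ℝ}
    (hM : ∀ x, ‖iteratedFDeriv ℝ (i + 1) η x‖ ≤ M) (n : ℕ) (x : Space d) :
    ‖iteratedFDeriv ℝ i (extrapolate φ c r n η - η : TestFn d) x‖ ≤
      (∑ i ∈ Finset.range r, |c i|) * (∫ y, |φ y|) * (M * (2 : ℝ)⁻¹ ^ n) := by
  have hM0 : 0 ≤ M := (norm_nonneg _).trans (hM 0)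
  have h1 : extrapolate φ c r n η - η =
      ∑ i ∈ Finset.range r, c i • (conv (φ.dyadic (n + i) 0) η - η) := by
    simp only [smul_sub, Finset.sum_sub_distrib, ← Finset.sum_smul, hc, one_smul,
      extrapolate_apply]
  rw [h1, iteratedFDeriv_sum, mul_assoc, Finset.sum_mul]
  refine (norm_sum_le _ _).trans (Finset.sum_le_sum fun j _ => ?_)
  rw [norm_smul, Real.norm_eq_abs]
  gcongr
  refine (norm_iteratedFDeriv_conv_sub_le (vanishesOutside_dyadic hφ _) (integral_dyadic hφ _)
    η hM x).trans ?_
  rw [integral_abs_dyadic]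
  have hI : 0 ≤ ∫ y, |φ y| := integral_nonneg fun _ => abs_nonneg _
  have hpow : (2 : ℝ)⁻¹ ^ (n + j) ≤ 2⁻¹ ^ n :=
    pow_le_pow_of_le_one (by norm_num) (by norm_num) (Nat.le_add_right _ _)
  gcongr

/-- Extrapolation makes the mollification error of order `2^{-nr}`. -/
theorem abs_extrapolate_sub_le (hφ : IsMollifier φ) (hr : 1 ≤ r)
    (hc : ∀ m < r, ∑ i ∈ Finset.range r, c i * ((2 : ℝ)⁻¹ ^ i) ^ m = 0 ^ m) (η : TestFn d) {M : ℝ}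
    (hM : ∀ x, ‖iteratedFDeriv ℝ r η x‖ ≤ M) (n : ℕ) (x : Space d) :
    |(extrapolate φ c r n η - η : TestFn d) x| ≤
      (∑ i ∈ Finset.range r, |c i|) * (∫ y, |φ y|) * (M * ((2 : ℝ)⁻¹ ^ n) ^ r) := by
  have h1 : ∀ i, conv (φ.dyadic (n + i) 0) η x =
      ∫ y, φ y * η (x - ((2 : ℝ)⁻¹ ^ i * (2 : ℝ)⁻¹ ^ n) • y) := fun i => by
    rw [dyadic, conv_rescale_apply, ← inv_pow, pow_add, mul_comm]
  have hint : ∀ s : ℝ, Integrable fun y => φ y * η (x - s • y) := fun s =>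
    (φ.continuous.mul (η.continuous.comp (by fun_prop))).integrable_of_hasCompactSupport
      φ.hasCompactSupport.mul_right
  have hint0 : Integrable fun y => φ y * η x :=
    (φ.continuous.integrable_of_hasCompactSupport φ.hasCompactSupport).mul_const _
  have h2 : (extrapolate φ c r n η - η : TestFn d) x = ∫ y, φ y *
      (∑ i ∈ Finset.range r, c i * η (x - ((2 : ℝ)⁻¹ ^ i * (2 : ℝ)⁻¹ ^ n) • y) - η x) := by
    have h3 : extrapolate φ c r n η x =
        ∑ i ∈ Finset.range r, c i * conv (φ.dyadic (n + i) 0) η x := by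
      rw [extrapolate_apply]
      simp
    have h4 : η x = ∫ y, φ y * η x := by rw [integral_mul_const, hφ.2, one_mul]
    rw [FunLike.coe_sub, Pi.sub_apply, h3]
    conv_lhs => rw [h4]
    simp_rw [h1, ← integral_const_mul]
    rw [← integral_finsetSum _ fun i _ => (hint _).const_mul _, ← integral_sub
      (integrable_finsetSum _ fun i _ => (hint _).const_mul _) hint0]
    refine integral_congr_ae (Eventually.of_forall fun y => ?_)
    simp only [mul_sub, Finset.mul_sum, mul_left_comm]
  rw [h2, mul_right_comm, mul_comm, ← integral_mul_const, ← Real.norm_eq_abs]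
  refine norm_integral_le_of_norm_le ?_ (Eventually.of_forall fun y => ?_)
  · exact (φ.continuous.abs.integrable_of_hasCompactSupport φ.hasCompactSupport.norm).mul_const _
  · rw [norm_mul, Real.norm_eq_abs, Real.norm_eq_abs]
    rcases lt_or_ge 1 ‖y‖ with hy | hy
    · simp [VanishesOutside.of_tsupport hφ.1 y (by simpa using hy)]
    · gcongr
      have h5 := abs_extrapolation_sub_le hr hc (u := fun s : ℝ => η (x - s • y))
        (η.contDiff_infty.comp (by fun_prop)) (η.norm_iteratedFDeriv_line_le hM x y hy)
        (s := (2 : ℝ)⁻¹ ^ n) (by positivity)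
      simpa using h5

end Mollifier

end TestFn

end Smoothing

/-! ### Reconstruction of a distribution from its mollifications -/

namespace Distr

open TestFn

variable {d : ℕ}

theorem tendsto_apply_extrapolate_sq {φ : TestFn d} (hφ : IsMollifier φ) {r : ℕ} {c : ℕ → ℝ}
    (hc : ∑ i ∈ Finset.range r, c i = 1) (ζ : Distr d) (η : TestFn d) :
    Tendsto (fun n => ζ (extrapolate φ c r n (extrapolate φ c r n η))) atTop (𝓝 (ζ η)) := by
  set D := (∑ i ∈ Finset.range r, |c i|) * (∫ y, |φ y|) with hD
  have hD0 : 0 ≤ D := mul_nonneg (Finset.sum_nonneg fun _ _ => abs_nonneg _)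
    (integral_nonneg fun _ => abs_nonneg _)
  obtain ⟨ρ, hρ0, hρ⟩ := η.exists_vanishesOutside
  obtain ⟨k, C, hC0, hC⟩ := ζ.exists_bound (isCompact_closedBall (0 : Space d) (ρ + 1 + 1))
  choose M hM0 hM using fun i => η.exists_iteratedFDeriv_bound (i + 1)
  set M' := ∑ i ∈ Finset.range (k + 1), M i with hM'
  have hM'0 : 0 ≤ M' := Finset.sum_nonneg fun _ _ => hM0 _
  have hpow : ∀ n : ℕ, (2 : ℝ)⁻¹ ^ n ≤ 1 := fun n => pow_le_one₀ (by norm_num) (by norm_num)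
  have hbound : ∀ n, ‖ζ (extrapolate φ c r n (extrapolate φ c r n η)) - ζ η‖ ≤
      C * ((D * D + D) * M') * (2 : ℝ)⁻¹ ^ n := by
    intro n
    rw [← map_sub, mul_assoc]
    refine hC _ ?_ _ (by positivity) fun i hi x => ?_
    · refine VanishesOutside.tsupport_subset (VanishesOutside.sub ?_ (hρ.mono (by linarith)))
      refine ((hρ.extrapolate hφ n).extrapolate hφ n).mono ?_
      linarith [hpow n]
    · have h1 : extrapolate φ c r n (extrapolate φ c r n η) - η =
          extrapolate φ c r n (extrapolate φ c r n η - η) + (extrapolate φ c r n η - η) := by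
        rw [map_sub]; abel
      have h2 := fun x => norm_iteratedFDeriv_extrapolate_sub_le hφ hc η (hM i) n x
      have h3 := norm_iteratedFDeriv_extrapolate_le (φ := φ) (r := r) (c := c) _ h2 n x
      rw [h1, iteratedFDeriv_add]
      refine (norm_add_le _ _).trans ((add_le_add h3 (h2 x)).trans ?_)
      rw [← hD]
      have h4 : M i ≤ M' := Finset.single_le_sum (f := M) (fun _ _ => hM0 _)
        (Finset.mem_range.2 (Nat.lt_succ_of_le hi))
      calc D * (D * (M i * 2⁻¹ ^ n)) + D * (M i * 2⁻¹ ^ n)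
          = (D * D + D) * M i * 2⁻¹ ^ n := by ring
        _ ≤ (D * D + D) * M' * 2⁻¹ ^ n := by gcongr
  rw [tendsto_iff_norm_sub_tendsto_zero]
  refine squeeze_zero (fun _ => norm_nonneg _) hbound ?_
  simpa using (tendsto_pow_atTop_nhds_zero_of_lt_one (r := (2 : ℝ)⁻¹) (by norm_num)
    (by norm_num)).const_mul (C * ((D * D + D) * M'))

/-- If the mollifications of `ζ` at scale `2^{-m}`, tested against functions near `x`, grow at most
like `Q 2^{-mβ}`, then `ζ` is bounded on test functions near `x` in terms of `Q`, the sup norm and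
the derivatives of order `r > -β`.

With `A_n` the extrapolated mollification at scale `2^{-n}`, the proof sums the telescoping series
`A_{n+1} ^ 2 - A_n ^ 2 = (A_{n+1} + A_n) (A_{n+1} - A_n)`: the left factor is controlled by the
hypothesis, and the right factor is small of order `2^{-nr}`. -/
theorem exists_abs_apply_le {φ : TestFn d} (hφ : IsMollifier φ) {r : ℕ} (hr : 1 ≤ r) {β : ℝ}
    (hβ : β ≤ 0) (hrβ : 0 < r + β) :
    ∃ C : ℝ, 0 ≤ C ∧ ∀ (ζ : Distr d) (η : TestFn d) (x : Space d) (ρ : ℝ) (N : ℕ) (Q M₀ Mr : ℝ),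
      0 ≤ Q → η.VanishesOutside x ρ → (2 : ℝ)⁻¹ ^ N ≤ ρ → (∀ y, |η y| ≤ M₀) →
      (∀ y, ‖iteratedFDeriv ℝ r η y‖ ≤ Mr) →
      (∀ m ≥ N, ∀ (g : TestFn d) (M : ℝ), g.VanishesOutside x (2 * ρ) → (∀ y, |g y| ≤ M) →
        |ζ (conv (φ.dyadic m 0) g)| ≤ M * Q * (2 : ℝ) ^ (-(m * β))) →
      |ζ η| ≤ C * Q * (M₀ * (2 : ℝ) ^ (-(N * β)) + Mr * (2 : ℝ) ^ (-(N * (r + β)))) := by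
  obtain ⟨c, hc⟩ := exists_extrapolation_weights r
  have hc1 : ∑ i ∈ Finset.range r, c i = 1 := by simpa using hc 0 (by omega)
  set S := ∑ i ∈ Finset.range r, |c i| with hS
  set D := S * (∫ y, |φ y|) with hD
  have hS0 : 0 ≤ S := Finset.sum_nonneg fun _ _ => abs_nonneg _
  have hD0 : 0 ≤ D := mul_nonneg hS0 (integral_nonneg fun _ => abs_nonneg _)
  set B := (2 : ℝ) ^ (-(r * β)) with hB
  have hB0 : 0 < B := by positivity
  set q := (2 : ℝ) ^ (-(r + β)) with hq
  have hq0 : 0 < q := by positivity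
  have hq1 : q < 1 := Real.rpow_lt_one_of_one_lt_of_neg (by norm_num) (by linarith)
  have hqn : ∀ n : ℕ, (2 : ℝ) ^ (-(n * (r + β))) = q ^ n := fun n => by
    rw [hq, ← Real.rpow_mul_natCast (by norm_num)]; ring_nf
  set K := S * B * ((2 : ℝ) ^ (-β) + 1) * (2 * D) with hK
  have hK0 : 0 ≤ K := by positivity
  refine ⟨S * B * D + K * (1 - q)⁻¹, by
    have : 0 < 1 - q := by linarith
    positivity, ?_⟩
  intro ζ η x ρ N Q M₀ Mr hQ hη hN hM₀ hMr hmoll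
  have hM₀0 : 0 ≤ M₀ := (abs_nonneg _).trans (hM₀ 0)
  have hMr0 : 0 ≤ Mr := (norm_nonneg _).trans (hMr 0)
  -- a single extrapolated mollification is controlled by the hypothesis
  have h1 : ∀ n ≥ N, ∀ (g : TestFn d) (M : ℝ), g.VanishesOutside x (2 * ρ) →
      (∀ y, |g y| ≤ M) →
      |ζ (extrapolate φ c r n g)| ≤ S * B * (M * Q * (2 : ℝ) ^ (-(n * β))) := by
    intro n hn g M hg hM
    have hM0 : 0 ≤ M := (abs_nonneg _).trans (hM 0)
    rw [extrapolate_apply, map_sum, hS, mul_assoc, Finset.sum_mul]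
    refine (Finset.abs_sum_le_sum_abs _ _).trans (Finset.sum_le_sum fun i hi => ?_)
    rw [map_smul, smul_eq_mul, abs_mul]
    gcongr
    refine (hmoll (n + i) (by omega) g M hg hM).trans ?_
    have h2 : (2 : ℝ) ^ (-(((n + i : ℕ) : ℝ) * β)) ≤ B * (2 : ℝ) ^ (-(n * β)) := by
      rw [hB, ← Real.rpow_add (by norm_num)]
      refine Real.rpow_le_rpow_of_exponent_le (by norm_num) ?_
      have : (i : ℝ) ≤ r := by exact_mod_cast (Finset.mem_range.1 hi).le
      push_cast
      nlinarith
    calc _ ≤ M * Q * (B * (2 : ℝ) ^ (-(n * β))) := by gcongr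
      _ = _ := by ring
  have hpowN : ∀ n ≥ N, (2 : ℝ)⁻¹ ^ n ≤ ρ := fun n hn =>
    (pow_le_pow_of_le_one (by norm_num) (by norm_num) hn).trans hN
  set s : ℕ → ℝ := fun n => ζ (extrapolate φ c r n (extrapolate φ c r n η)) with hs
  have hsN : |s N| ≤ S * B * D * Q * (M₀ * (2 : ℝ) ^ (-(N * β))) := by
    refine (h1 N le_rfl (extrapolate φ c r N η) (D * M₀)
      ((hη.extrapolate hφ N).mono (by linarith)) fun y => ?_).trans_eq (by ring)
    have := norm_iteratedFDeriv_extrapolate_le (φ := φ) (r := r) (c := c) η (i := 0) (M := M₀)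
      (fun x => by rw [norm_iteratedFDeriv_zero]; exact hM₀ x) N y
    rwa [norm_iteratedFDeriv_zero] at this
  have hstep : ∀ n ≥ N, |s (n + 1) - s n| ≤ K * Q * Mr * q ^ n := by
    intro n hn
    set E := extrapolate φ c r (n + 1) η - extrapolate φ c r n η with hE
    have hcomm : extrapolate φ c r n (extrapolate φ c r (n + 1) η) =
        extrapolate φ c r (n + 1) (extrapolate φ c r n η) :=
      LinearMap.congr_fun (commute_extrapolate φ c r n (n + 1)) η
    have h2 : s (n + 1) - s n = ζ (extrapolate φ c r (n + 1) E) + ζ (extrapolate φ c r n E) := by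
      simp only [hs, hE, map_sub, hcomm]
      ring
    have hEv : E.VanishesOutside x (2 * ρ) := by
      refine VanishesOutside.sub ((hη.extrapolate hφ _).mono ?_) ((hη.extrapolate hφ _).mono ?_)
      · linarith [hpowN (n + 1) (by omega)]
      · linarith [hpowN n hn]
    have hEb : ∀ y, |E y| ≤ 2 * D * (Mr * ((2 : ℝ)⁻¹ ^ n) ^ r) := by
      intro y
      have e1 := abs_extrapolate_sub_le hφ hr hc η hMr (n + 1) y
      have e2 := abs_extrapolate_sub_le hφ hr hc η hMr n y
      have e3 : E y = (extrapolate φ c r (n + 1) η - η : TestFn d) y -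
          (extrapolate φ c r n η - η : TestFn d) y := by
        simp [hE]
      rw [e3]
      refine (abs_sub _ _).trans ?_
      have e4 : D * (Mr * ((2 : ℝ)⁻¹ ^ (n + 1)) ^ r) ≤ D * (Mr * ((2 : ℝ)⁻¹ ^ n) ^ r) := by
        gcongr D * (Mr * ?_ ^ r)
        exact pow_le_pow_of_le_one (by norm_num) (by norm_num) (Nat.le_succ n)
      linarith
    have h3 := h1 (n + 1) (by omega) E _ hEv hEb
    have h4 := h1 n hn E _ hEv hEb
    rw [h2]
    refine (abs_add_le _ _).trans ((add_le_add h3 h4).trans_eq ?_)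
    have h5 : (2 : ℝ) ^ (-(((n + 1 : ℕ) : ℝ) * β)) = (2 : ℝ) ^ (-β) * (2 : ℝ) ^ (-(n * β)) := by
      rw [← Real.rpow_add (by norm_num)]; push_cast; ring_nf
    have h6 : ((2 : ℝ)⁻¹ ^ n) ^ r * (2 : ℝ) ^ (-(n * β)) = q ^ n := by
      rw [← hqn, ← pow_mul, inv_pow, ← Real.rpow_natCast, ← Real.rpow_neg (by norm_num),
        ← Real.rpow_add (by norm_num)]
      push_cast; ring_nf
    rw [h5, hK, ← h6]
    ring
  have hsum : ∀ k, |s (N + k)| ≤ S * B * D * Q * (M₀ * (2 : ℝ) ^ (-(N * β))) +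
      K * Q * Mr * (q ^ N * ∑ j ∈ Finset.range k, q ^ j) := by
    intro k
    induction k with
    | zero => simpa using hsN
    | succ k ih =>
      have h2 := hstep (N + k) (by omega)
      rw [Finset.sum_range_succ, mul_add (q ^ N), ← pow_add, mul_add]
      have h3 : |s (N + k + 1)| ≤ |s (N + k)| + |s (N + k + 1) - s (N + k)| := by
        have := abs_add_le (s (N + k)) (s (N + k + 1) - s (N + k))
        rwa [add_sub_cancel] at this
      change |s (N + k + 1)| ≤ _
      linarith
  have hlim : Tendsto (fun k => |s (N + k)|) atTop (𝓝 |ζ η|) := by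
    have := (tendsto_apply_extrapolate_sq hφ hc1 ζ η).abs
    have h2 := (tendsto_add_atTop_iff_nat N).2 this
    simpa only [hs, add_comm] using h2
  refine le_of_tendsto hlim (Eventually.of_forall fun k => (hsum k).trans ?_)
  have hgeom : ∑ j ∈ Finset.range k, q ^ j ≤ (1 - q)⁻¹ := by
    rw [← tsum_geometric_of_lt_one hq0.le hq1]
    exact (summable_geometric_of_lt_one hq0.le hq1).sum_le_tsum _ fun _ _ => by positivity
  rw [hqn]
  have hX : 0 ≤ (2 : ℝ) ^ (-(N * β)) := by positivity
  have h1q : 0 < (1 - q)⁻¹ := by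
    have : 0 < 1 - q := by linarith
    positivity
  calc S * B * D * Q * (M₀ * (2 : ℝ) ^ (-(N * β))) +
        K * Q * Mr * (q ^ N * ∑ j ∈ Finset.range k, q ^ j)
      ≤ S * B * D * Q * (M₀ * (2 : ℝ) ^ (-(N * β))) + K * Q * Mr * (q ^ N * (1 - q)⁻¹) := by
        gcongr
    _ = S * B * D * Q * (M₀ * (2 : ℝ) ^ (-(N * β))) + K * (1 - q)⁻¹ * Q * (Mr * q ^ N) := by ring
    _ ≤ (S * B * D + K * (1 - q)⁻¹) * Q * (M₀ * (2 : ℝ) ^ (-(N * β)) + Mr * q ^ N) := by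
        have e1 : 0 ≤ S * B * D * Q * (Mr * q ^ N) := by positivity
        have e2 : 0 ≤ K * (1 - q)⁻¹ * Q * (M₀ * (2 : ℝ) ^ (-(N * β))) := by positivity
        nlinarith [e1, e2]

end Distr

/-! ### A weighted Besov norm that dominates the Hölder norms -/

/-- The finite measure `(1 + |z|)^{-(d+1)} dz` on `ℝ^d`. -/
noncomputable def weightMeasure (d : ℕ) : Measure (Space d) :=
  volume.withDensity fun z => ENNReal.ofReal ((1 + ‖z‖) ^ (-((d : ℝ) + 1)))

instance (d : ℕ) : IsFiniteMeasure (weightMeasure d) := by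
  refine isFiniteMeasure_withDensity_ofReal ?_
  refine (integrable_one_add_norm (E := Space d) (μ := volume) (r := (d : ℝ) + 1) ?_).2
  rw [finrank_euclideanSpace_fin]
  linarith

/-- The measure on pairs (scale index, base point) that gives the scale `2^{-(n+1)}` the weight
`2^{(n+1)βp}`. -/
noncomputable def scaleMeasure (d : ℕ) (p β : ℝ) : Measure (ℕ × Space d) :=
  (Measure.count.withDensity fun n : ℕ =>
    ENNReal.ofReal ((2 : ℝ) ^ (((n + 1 : ℕ) : ℝ) * β * p))).prod (weightMeasure d)

instance (d : ℕ) (p β : ℝ) : SigmaFinite (scaleMeasure d p β) := by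
  have : SigmaFinite (Measure.count.withDensity fun n : ℕ =>
      ENNReal.ofReal ((2 : ℝ) ^ (((n + 1 : ℕ) : ℝ) * β * p))) :=
    SigmaFinite.withDensity_ofReal _
  unfold scaleMeasure
  infer_instance

theorem lintegral_scaleMeasure {d : ℕ} {p β : ℝ} {f : ℕ × Space d → ℝ≥0∞} (hf : Measurable f) :
    ∫⁻ i, f i ∂scaleMeasure d p β =
      ∑' n : ℕ, ENNReal.ofReal ((2 : ℝ) ^ (((n + 1 : ℕ) : ℝ) * β * p)) *
        ∫⁻ z, f (n, z) ∂weightMeasure d := by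
  unfold scaleMeasure
  rw [lintegral_prod _ hf.aemeasurable, lintegral_withDensity_eq_lintegral_mul _
    (measurable_from_top) (measurable_from_top), lintegral_count]
  rfl

/-- The values `⟨ζ, φ_z^{(n+1)}⟩`, as a function of `(n, z)`. -/
noncomputable def Distr.coeff {d : ℕ} (φ : TestFn d) (ζ : Distr d) (i : ℕ × Space d) : ℝ :=
  ζ (φ.dyadic (i.1 + 1) i.2)

/-- The weighted Besov norm
`(∑_{n ≥ 1} 2^{nβp} ∫ |⟨ζ, φ_z^{(n)}⟩|^p (1 + |z|)^{-(d+1)} dz)^{1/p}`. -/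
noncomputable def Distr.besovNorm {d : ℕ} (φ : TestFn d) (p β : ℝ) (ζ : Distr d) : ℝ≥0∞ :=
  eLpNorm (ζ.coeff φ) (ENNReal.ofReal p) (scaleMeasure d p β)

namespace Distr

open TestFn

variable {d : ℕ} (φ : TestFn d) (p β : ℝ)

theorem continuous_apply_dyadic (ζ : Distr d) (n : ℕ) :
    Continuous fun z => ζ (φ.dyadic n z) := by
  have : (fun z => ζ (φ.dyadic n z)) = fun z => ζ ((φ.dyadic n 0).translate z) :=
    funext fun z => by rw [dyadic_eq_translate]
  rw [this]
  exact ζ.continuous_apply_translate _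

theorem continuous_coeff (ζ : Distr d) : Continuous (ζ.coeff φ) :=
  continuous_prod_of_discrete_left.2 fun n => ζ.continuous_apply_dyadic φ (n + 1)

theorem coeff_add (ζ ξ : Distr d) : (ζ + ξ).coeff φ = ζ.coeff φ + ξ.coeff φ := rfl

theorem coeff_sub (ζ ξ : Distr d) : (ζ - ξ).coeff φ = ζ.coeff φ - ξ.coeff φ := rfl

theorem coeff_neg (ζ : Distr d) : (-ζ).coeff φ = -ζ.coeff φ := rfl

theorem besovNorm_zero : besovNorm φ p β (0 : Distr d) = 0 := by
  have : (0 : Distr d).coeff φ = 0 := rfl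
  rw [besovNorm, this, eLpNorm_zero]

theorem besovNorm_neg (ζ : Distr d) : besovNorm φ p β (-ζ) = besovNorm φ p β ζ := by
  rw [besovNorm, coeff_neg, eLpNorm_neg, besovNorm]

theorem besovNorm_add_le (hp : 1 ≤ p) (ζ ξ : Distr d) :
    besovNorm φ p β (ζ + ξ) ≤ besovNorm φ p β ζ + besovNorm φ p β ξ := by
  rw [besovNorm, coeff_add]
  exact eLpNorm_add_le (ζ.continuous_coeff φ).aestronglyMeasurable
    (ξ.continuous_coeff φ).aestronglyMeasurable (by simpa using ENNReal.ofReal_le_ofReal hp)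

variable {φ p β}

theorem besovNorm_rpow (hp : 0 < p) (ζ : Distr d) :
    besovNorm φ p β ζ ^ p = ∫⁻ i, ‖ζ.coeff φ i‖ₑ ^ p ∂scaleMeasure d p β := by
  rw [besovNorm, eLpNorm_eq_lintegral_rpow_enorm_toReal (by simpa using hp) ENNReal.ofReal_ne_top,
    ENNReal.toReal_ofReal hp.le, ← ENNReal.rpow_mul, one_div, inv_mul_cancel₀ hp.ne',
    ENNReal.rpow_one]

/-- Each dyadic scale is controlled by the Besov norm. -/
theorem eLpNorm_apply_dyadic_le (hp : 0 < p) (ζ : Distr d) {m : ℕ} (hm : 1 ≤ m) :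
    eLpNorm (fun z => ζ (φ.dyadic m z)) (ENNReal.ofReal p) (weightMeasure d) ≤
      ENNReal.ofReal ((2 : ℝ) ^ (-(m * β))) * besovNorm φ p β ζ := by
  obtain ⟨n, rfl⟩ : ∃ n, m = n + 1 := ⟨m - 1, by omega⟩
  have h := besovNorm_rpow (φ := φ) (β := β) hp ζ
  rw [lintegral_scaleMeasure ((ζ.continuous_coeff φ).measurable.enorm.pow_const p)] at h
  have h1 : ENNReal.ofReal ((2 : ℝ) ^ (((n + 1 : ℕ) : ℝ) * β * p)) *
      ∫⁻ z, ‖ζ (φ.dyadic (n + 1) z)‖ₑ ^ p ∂weightMeasure d ≤ besovNorm φ p β ζ ^ p := by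
    rw [h]
    exact ENNReal.le_tsum (f := fun n : ℕ =>
      ENNReal.ofReal ((2 : ℝ) ^ (((n + 1 : ℕ) : ℝ) * β * p)) *
        ∫⁻ z, ‖ζ (φ.dyadic (n + 1) z)‖ₑ ^ p ∂weightMeasure d) n
  rw [eLpNorm_eq_lintegral_rpow_enorm_toReal (by simpa using hp) ENNReal.ofReal_ne_top,
    ENNReal.toReal_ofReal hp.le, one_div, ENNReal.rpow_inv_le_iff hp,
    ENNReal.mul_rpow_of_nonneg _ _ hp.le, ENNReal.ofReal_rpow_of_pos (by positivity),
    ← Real.rpow_mul (by norm_num)]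
  refine le_trans (le_of_eq ?_) (mul_le_mul_right h1 _)
  rw [← mul_assoc, ← ENNReal.ofReal_mul (by positivity), ← Real.rpow_add (by norm_num)]
  simp

theorem volume_restrict_le (x : Space d) {R : ℝ} (hR : 0 ≤ R) :
    volume.restrict (closedBall x R) ≤
      ENNReal.ofReal ((1 + ‖x‖ + R) ^ (d + 1)) • weightMeasure d := by
  refine Measure.le_iff.2 fun s hs => ?_
  rw [Measure.restrict_apply hs, Measure.smul_apply, smul_eq_mul, weightMeasure,
    withDensity_apply _ hs, ← lintegral_const_mul' _ _ ENNReal.ofReal_ne_top]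
  rw [← setLIntegral_one]
  refine (setLIntegral_mono' (hs.inter measurableSet_closedBall) fun z hz => ?_).trans
    (lintegral_mono_set Set.inter_subset_left)
  rw [← ENNReal.ofReal_mul (by positivity), ← ENNReal.ofReal_one]
  refine ENNReal.ofReal_le_ofReal ?_
  have h1 : 1 + ‖z‖ ≤ 1 + ‖x‖ + R := by
    have := hz.2
    rw [mem_closedBall, dist_eq_norm] at this
    have := norm_le_norm_add_norm_sub x z
    rw [norm_sub_rev] at this
    linarith
  have h2 : (1 + ‖z‖) ^ (-((d : ℝ) + 1)) = ((1 + ‖z‖) ^ (d + 1))⁻¹ := by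
    rw [Real.rpow_neg (by positivity), ← Real.rpow_natCast]
    push_cast; rfl
  rw [h2, ← div_eq_mul_inv, one_le_div (by positivity)]
  gcongr

/-- The constant in the Hölder inequality on balls. -/
noncomputable def ballConst (d : ℕ) (p : ℝ) : ℝ :=
  (volume (ball (0 : Space d) 1)).toReal ^ (1 - 1 / p)

theorem ballConst_nonneg : 0 ≤ ballConst d p := by unfold ballConst; positivity

/-- Mollifications of a distribution, tested against a bounded function that lives on a ball. -/
theorem abs_apply_conv_le (hp : 1 ≤ p) {ζ : Distr d} (hζ : besovNorm φ p β ζ ≠ ∞) {m : ℕ}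
    (hm : 1 ≤ m) {g : TestFn d} {M : ℝ} {x : Space d} {R : ℝ} (hR : 0 < R)
    (hg : g.VanishesOutside x R) (hM : ∀ y, |g y| ≤ M) :
    |ζ (conv (φ.dyadic m 0) g)| ≤
      M * (ballConst d p * R ^ (d - d / p) * (1 + ‖x‖ + R) ^ (d + 1) *
        (besovNorm φ p β ζ).toReal) * (2 : ℝ) ^ (-(m * β)) := by
  have hp0 : 0 < p := by linarith
  have hM0 : 0 ≤ M := (abs_nonneg _).trans (hM 0)
  have hpe : 1 ≤ ENNReal.ofReal p := by simpa using ENNReal.ofReal_le_ofReal hp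
  set f : Space d → ℝ := fun z => ζ (φ.dyadic m z) with hf
  have hfm : AEStronglyMeasurable f (volume.restrict (closedBall x R)) :=
    (ζ.continuous_apply_dyadic φ m).aestronglyMeasurable
  have h1 : ‖ζ (conv (φ.dyadic m 0) g)‖ₑ ≤
      ENNReal.ofReal M * eLpNorm f 1 (volume.restrict (closedBall x R)) := by
    rw [apply_conv]
    refine (enorm_integral_le_lintegral_enorm _).trans ?_
    rw [eLpNorm_one_eq_lintegral_enorm, ← lintegral_const_mul' _ _ ENNReal.ofReal_ne_top,
      ← lintegral_indicator measurableSet_closedBall]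
    refine lintegral_mono fun z => ?_
    by_cases hz : z ∈ closedBall x R
    · rw [Set.indicator_of_mem hz, enorm_mul, ← dyadic_eq_translate]
      gcongr
      rw [← ofReal_norm]
      exact ENNReal.ofReal_le_ofReal (hM z)
    · rw [mem_closedBall, dist_eq_norm, not_le] at hz
      simp [hg z hz]
  have h2 : eLpNorm f 1 (volume.restrict (closedBall x R)) ≤
      eLpNorm f (ENNReal.ofReal p) (volume.restrict (closedBall x R)) *
        ENNReal.ofReal (ballConst d p * R ^ (d - d / p)) := by
    refine (eLpNorm_le_eLpNorm_mul_rpow_measure_univ hpe hfm).trans_eq ?_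
    rw [Measure.restrict_apply_univ, Measure.addHaar_closedBall _ _ hR.le,
      finrank_euclideanSpace_fin, ENNReal.toReal_ofReal hp0.le, ENNReal.toReal_one,
      show (1 : ℝ) / 1 - 1 / p = 1 - 1 / p by norm_num]
    have e1 : 0 ≤ 1 - 1 / p := by
      rw [sub_nonneg, div_le_one hp0]; exact hp
    rw [ENNReal.mul_rpow_of_nonneg _ _ e1, ENNReal.ofReal_rpow_of_pos (by positivity), ballConst,
      ENNReal.ofReal_mul (by positivity), ← ENNReal.ofReal_rpow_of_nonneg ENNReal.toReal_nonneg e1,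
      ENNReal.ofReal_toReal measure_ball_lt_top.ne, mul_comm (ENNReal.ofReal _),
      ← Real.rpow_natCast,
      ← Real.rpow_mul hR.le]
    congr 4
    ring
  have h3 : eLpNorm f (ENNReal.ofReal p) (volume.restrict (closedBall x R)) ≤
      ENNReal.ofReal ((1 + ‖x‖ + R) ^ (d + 1)) *
        (ENNReal.ofReal ((2 : ℝ) ^ (-(m * β))) * besovNorm φ p β ζ) := by
    refine (eLpNorm_mono_measure _ (volume_restrict_le x hR.le)).trans ?_
    have e1 : (1 : ℝ) ≤ (1 + ‖x‖ + R) ^ (d + 1) :=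
      one_le_pow₀ (by have := norm_nonneg x; linarith)
    rw [eLpNorm_smul_measure_of_ne_zero (by simpa using by positivity), smul_eq_mul]
    refine mul_le_mul' ?_ (eLpNorm_apply_dyadic_le hp0 ζ hm)
    refine (ENNReal.rpow_le_rpow_of_exponent_le (z := 1)
      (by simpa using ENNReal.ofReal_le_ofReal e1) ?_).trans_eq (ENNReal.rpow_one _)
    rw [one_div, ENNReal.toReal_inv, ENNReal.toReal_ofReal hp0.le]
    exact inv_le_one_of_one_le₀ hp
  have h4 := h1.trans (mul_le_mul_right (h2.trans (mul_le_mul_left h3 _)) _)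
  have hb := ballConst_nonneg (d := d) (p := p)
  rw [← ENNReal.ofReal_toReal hζ, ← ENNReal.ofReal_mul (by positivity),
    ← ENNReal.ofReal_mul (by positivity), ← ENNReal.ofReal_mul (by positivity),
    ← ENNReal.ofReal_mul hM0, ← ofReal_norm, ENNReal.ofReal_le_ofReal_iff (by positivity)] at h4
  refine h4.trans_eq (by ring)

end Distr

/-! ### Domination of the Hölder norms -/

namespace TestFn

variable {d : ℕ}

theorem norm_iteratedFDeriv_rescale_le (η : TestFn d) {k : ℕ} {M : ℝ}
    (hM : ∀ x, ‖iteratedFDeriv ℝ k η x‖ ≤ M) {s : ℝ} (hs : 0 < s) (x y : Space d) :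
    ‖iteratedFDeriv ℝ k (η.rescale s hs x) y‖ ≤ (s ^ d)⁻¹ * (M * (s ^ k)⁻¹) := by
  let g : Space d →L[ℝ] Space d := s⁻¹ • ContinuousLinearMap.id ℝ (Space d)
  have hη : ContDiff ℝ k η := η.contDiff_infty.of_le (by exact_mod_cast le_top)
  have h1 : (η.rescale s hs x : Space d → ℝ) = (s ^ d)⁻¹ • fun y => (η ∘ g) (y - x) := by
    funext y
    simp [rescale_apply, g]
  have hg : ‖g‖ ≤ s⁻¹ := by
    refine ContinuousLinearMap.opNorm_le_bound _ (by positivity) fun v => ?_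
    simp [g, norm_smul, abs_of_pos hs]
  have hM0 : 0 ≤ M := (norm_nonneg _).trans (hM 0)
  have hc : ContDiff ℝ k fun y => (η ∘ g) (y - x) := (hη.comp g.contDiff).comp (by fun_prop)
  rw [h1, iteratedFDeriv_const_smul_apply hc.contDiffAt, norm_smul, norm_inv, norm_pow,
    Real.norm_of_nonneg hs.le, iteratedFDeriv_comp_sub, g.iteratedFDeriv_comp_right hη _ le_rfl]
  gcongr
  refine (ContinuousMultilinearMap.norm_compContinuousLinearMap_le _ _).trans ?_
  gcongr
  · exact hM _
  · rw [Finset.prod_const, Finset.card_univ, Fintype.card_fin, ← inv_pow]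
    gcongr

end TestFn

namespace Distr

open TestFn

variable {d : ℕ} {φ : TestFn d} {p β : ℝ}

/-- The Besov norm bounds the action on a test function, in terms of its support, its sup norm and
its derivatives of order `r`. -/
theorem exists_abs_apply_le_besovNorm (hφ : IsMollifier φ) (hp : 1 ≤ p) {r : ℕ} (hr : 1 ≤ r)
    (hβ : β ≤ 0) (hrβ : 0 < r + β) :
    ∃ C : ℝ, 0 ≤ C ∧ ∀ (ζ : Distr d), besovNorm φ p β ζ ≠ ∞ →
      ∀ (η : TestFn d) (x : Space d) (ρ : ℝ) (N : ℕ) (M₀ Mr : ℝ), 1 ≤ N →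
      η.VanishesOutside x ρ → (2 : ℝ)⁻¹ ^ N ≤ ρ → (∀ y, |η y| ≤ M₀) →
      (∀ y, ‖iteratedFDeriv ℝ r η y‖ ≤ Mr) →
      |ζ η| ≤ C * (ρ ^ (d - d / p) * (1 + ‖x‖ + 2 * ρ) ^ (d + 1) * (besovNorm φ p β ζ).toReal) *
        (M₀ * (2 : ℝ) ^ (-(N * β)) + Mr * (2 : ℝ) ^ (-(N * (r + β)))) := by
  obtain ⟨C, hC0, hC⟩ := exists_abs_apply_le hφ hr hβ hrβ
  have hb := ballConst_nonneg (d := d) (p := p)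
  refine ⟨C * (ballConst d p * 2 ^ (d - d / p)), by positivity, ?_⟩
  intro ζ hζ η x ρ N M₀ Mr hN hη hNρ hM₀ hMr
  have hρ : 0 < ρ := lt_of_lt_of_le (by positivity) hNρ
  refine (hC ζ η x ρ N (ballConst d p * (2 * ρ) ^ (d - d / p) * (1 + ‖x‖ + 2 * ρ) ^ (d + 1) *
    (besovNorm φ p β ζ).toReal) M₀ Mr (by positivity) hη hNρ hM₀ hMr
    fun m hm g M hg hM => abs_apply_conv_le hp hζ (hN.trans hm) (by positivity) hg hM).trans_eq ?_
  rw [Real.mul_rpow (by norm_num) hρ.le]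
  ring

/-- On test functions that live on a fixed ball, a distribution with finite Besov norm is bounded
by the sup norm of finitely many derivatives. -/
theorem exists_abs_apply_le_of_vanishesOutside (hφ : IsMollifier φ) (hp : 1 ≤ p) {r : ℕ}
    (hr : 1 ≤ r) (hβ : β ≤ 0) (hrβ : 0 < r + β) (ρ : ℝ) :
    ∃ C : ℝ, 0 ≤ C ∧ ∀ (ζ : Distr d), besovNorm φ p β ζ ≠ ∞ →
      ∀ (η : TestFn d) (M : ℝ), η.VanishesOutside 0 ρ → (∀ y, |η y| ≤ M) →
      (∀ y, ‖iteratedFDeriv ℝ r η y‖ ≤ M) → |ζ η| ≤ C * (besovNorm φ p β ζ).toReal * M := by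
  obtain ⟨C, hC0, hC⟩ := exists_abs_apply_le_besovNorm hφ hp hr hβ hrβ
  set σ := max ρ 1 with hσ
  have hσ1 : 1 ≤ σ := le_max_right _ _
  refine ⟨C * (σ ^ (d - d / p) * (1 + 2 * σ) ^ (d + 1)) *
    ((2 : ℝ) ^ (-β) + (2 : ℝ) ^ (-(r + β))), by positivity, fun ζ hζ η M hη hM hMr => ?_⟩
  refine (hC ζ hζ η 0 σ 1 M M le_rfl (hη.mono (le_max_left _ _)) (by
    rw [pow_one]; linarith) hM hMr).trans_eq ?_
  rw [norm_zero, add_zero, Nat.cast_one, one_mul, one_mul]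
  ring

theorem exists_enorm_apply_le (hφ : IsMollifier φ) (hp : 1 ≤ p) (hβ : β ≤ 0) (η : TestFn d) :
    ∃ C : ℝ≥0, ∀ ζ : Distr d, ‖ζ η‖ₑ ≤ C * besovNorm φ p β ζ := by
  obtain ⟨r, hr⟩ := exists_nat_gt (max 1 (-β))
  have hr1 : 1 ≤ r := by exact_mod_cast ((le_max_left _ _).trans hr.le : (1 : ℝ) ≤ r)
  have hrβ : 0 < r + β := by linarith [(le_max_right _ _).trans_lt hr]
  obtain ⟨ρ, -, hρ⟩ := η.exists_vanishesOutside
  obtain ⟨C, hC0, hC⟩ := exists_abs_apply_le_of_vanishesOutside (φ := φ) hφ hp hr1 hβ hrβ ρ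
  obtain ⟨M₀, hM₀0, hM₀⟩ := η.exists_iteratedFDeriv_bound 0
  obtain ⟨Mr, -, hMr⟩ := η.exists_iteratedFDeriv_bound r
  refine ⟨(C * max M₀ Mr + 1).toNNReal, fun ζ => ?_⟩
  have hpos : 0 < C * max M₀ Mr + 1 := by
    have : 0 ≤ max M₀ Mr := hM₀0.trans (le_max_left _ _)
    positivity
  by_cases hζ : besovNorm φ p β ζ = ∞
  · rw [hζ, ENNReal.mul_top (by simpa using hpos)]
    exact le_top
  have h := hC ζ hζ η (max M₀ Mr) hρ (fun y => by
      have := hM₀ y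
      rw [norm_iteratedFDeriv_zero] at this
      exact this.trans (le_max_left _ _)) fun y => (hMr y).trans (le_max_right _ _)
  rw [← ENNReal.ofReal_toReal hζ, ← ofReal_norm]
  change _ ≤ ENNReal.ofReal _ * _
  rw [← ENNReal.ofReal_mul hpos.le]
  refine ENNReal.ofReal_le_ofReal (h.trans ?_)
  nlinarith [ENNReal.toReal_nonneg (a := besovNorm φ p β ζ)]

theorem eq_zero_of_besovNorm_eq_zero (hφ : IsMollifier φ) (hp : 1 ≤ p) (hβ : β ≤ 0)
    {ζ : Distr d} (hζ : besovNorm φ p β ζ = 0) : ζ = 0 := by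
  refine DFunLike.ext _ _ fun (η : TestFn d) => ?_
  obtain ⟨C, hC⟩ := exists_enorm_apply_le (φ := φ) hφ hp hβ η
  have h := hC ζ
  rw [hζ, mul_zero, nonpos_iff_eq_zero, enorm_eq_zero] at h
  exact h

/-- A pointwise limit of distributions whose Besov norms are bounded is a distribution. -/
theorem exists_of_tendsto (hφ : IsMollifier φ) (hp : 1 ≤ p) (hβ : β ≤ 0) {ζ : ℕ → Distr d}
    {B : ℝ≥0} (hB : ∀ n, besovNorm φ p β (ζ n) ≤ B)
    (hlim : ∀ η, ∃ l, Tendsto (fun n => ζ n η) atTop (𝓝 l)) :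
    ∃ ξ : Distr d, ∀ η, Tendsto (fun n => ζ n η) atTop (𝓝 (ξ η)) := by
  choose L hL using hlim
  obtain ⟨r, hr⟩ := exists_nat_gt (max 1 (-β))
  have hr1 : 1 ≤ r := by exact_mod_cast ((le_max_left _ _).trans hr.le : (1 : ℝ) ≤ r)
  have hrβ : 0 < r + β := by linarith [(le_max_right _ _).trans_lt hr]
  have hadd : ∀ η θ, L (η + θ) = L η + L θ := fun η θ =>
    tendsto_nhds_unique (hL _) (by simpa only [map_add] using (hL η).add (hL θ))
  have hsmul : ∀ (c : ℝ) η, L (c • η) = c • L η := fun c η =>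
    tendsto_nhds_unique (hL _) (by simpa only [map_smul] using (hL η).const_smul c)
  refine ⟨TestFunction.mkCLM ℝ L hadd hsmul fun K hK => ?_, hL⟩
  obtain ⟨ρ, hρ⟩ := K.isCompact.isBounded.subset_closedBall (0 : Space d)
  obtain ⟨C, hC0, hC⟩ := exists_abs_apply_le_of_vanishesOutside (φ := φ) hφ hp hr1 hβ hrβ ρ
  let T : 𝓓_{K}(Space d, ℝ) →L[ℝ] ℝ := ContDiffMapSupportedIn.mkCLMtoNormedSpace ℝ
    (fun ψ => L (TestFunction.ofSupportedIn hK ψ)) (fun ψ θ => hadd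
      (TestFunction.ofSupportedIn hK ψ : TestFn d) (TestFunction.ofSupportedIn hK θ))
    (fun c ψ => hsmul c (TestFunction.ofSupportedIn hK ψ : TestFn d))
    ⟨{0, r}, C * B, by positivity, fun ψ => by
      set S := (({0, r} : Finset ℕ).sup fun i =>
        ContDiffMapSupportedIn.seminorm ℝ (Space d) ℝ ⊤ K i) ψ
      have hS : ∀ i ∈ ({0, r} : Finset ℕ), ∀ y, ‖iteratedFDeriv ℝ i ψ y‖ ≤ S := fun i hi y =>
        (ContDiffMapSupportedIn.norm_iteratedFDeriv_apply_le_seminorm_top ℝ).trans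
          (Seminorm.le_finset_sup_apply hi)
      refine le_of_tendsto (hL (TestFunction.ofSupportedIn hK ψ)).norm
        (Eventually.of_forall fun n => ?_)
      have hn : besovNorm φ p β (ζ n) ≠ ∞ := ((hB n).trans_lt ENNReal.coe_lt_top).ne
      have hS0 : 0 ≤ S := apply_nonneg _ _
      refine (hC (ζ n) hn (TestFunction.ofSupportedIn hK ψ) S (fun y hy => ?_) (fun y => ?_)
        fun y => hS r (by simp) y).trans ?_
      · refine ψ.zero_on_compl fun hc => ?_
        have := hρ hc
        rw [mem_closedBall, dist_eq_norm] at this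
        exact absurd hy (not_lt.2 this)
      · have := hS 0 (by simp) y
        rwa [norm_iteratedFDeriv_zero] at this
      · gcongr
        exact ENNReal.toReal_le_of_le_ofReal B.2 (by simpa using hB n)⟩
  exact T.continuous

/-- The Besov norm dominates the scaled action on rescaled unit test functions. -/
theorem exists_rescale_le (hφ : IsMollifier φ) (hp : 1 ≤ p) {α : ℝ} (hβ : β < 0)
    (hα : α + d / p < β) :
    ∃ C : ℝ, 0 < C ∧ ∀ (ζ : Distr d), ∀ η ∈ unitTestFns d ⌈-α⌉₊, ∀ (s : ℝ) (hs : 0 < s), s < 1 →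
      ∀ x : Space d, ENNReal.ofReal (s ^ (-α)) * ‖ζ (η.rescale s hs x)‖ₑ ≤
        ENNReal.ofReal (C * (3 + ‖x‖) ^ (d + 1)) * besovNorm φ p β ζ := by
  have hp0 : 0 < p := by linarith
  have hdp : 0 ≤ d / p := by positivity
  set r := ⌈-α⌉₊ with hr
  have hr1 : 1 ≤ r := Nat.one_le_ceil_iff.2 (by linarith)
  have hrα : -α ≤ r := Nat.le_ceil _
  have hrβ : 0 < r + β := by linarith
  obtain ⟨C, hC0, hC⟩ := exists_abs_apply_le_besovNorm (φ := φ) hφ hp hr1 hβ.le hrβ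
  refine ⟨(C + 1) * ((2 : ℝ) ^ (-β) + 1), by positivity, fun ζ η hη s hs hs1 x => ?_⟩
  have hCpos : 0 < (C + 1) * ((2 : ℝ) ^ (-β) + 1) * (3 + ‖x‖) ^ (d + 1) := by positivity
  by_cases hζ : besovNorm φ p β ζ = ∞
  · rw [hζ, ENNReal.mul_top (by simpa using hCpos)]
    exact le_top
  obtain ⟨n, hn1, hn2⟩ := exists_nat_pow_near_of_lt_one hs hs1.le (y := (2 : ℝ)⁻¹)
    (by norm_num) (by norm_num)
  have hv : (η.rescale s hs x).VanishesOutside x s := by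
    have := (VanishesOutside.of_tsupport hη.1).rescale hs x
    rwa [mul_one] at this
  have hM₀ : ∀ y, |η.rescale s hs x y| ≤ (s ^ d)⁻¹ := fun y => by
    have := η.norm_iteratedFDeriv_rescale_le (hη.2 0 (Nat.zero_le _)) hs x y
    rw [norm_iteratedFDeriv_zero] at this
    simpa using this
  have hMr := η.norm_iteratedFDeriv_rescale_le (hη.2 r le_rfl) hs x
  have h := hC ζ hζ _ x s (n + 1) _ _ (by omega) hv hn1.le hM₀ hMr
  set G := (besovNorm φ p β ζ).toReal with hG
  have hG0 : 0 ≤ G := ENNReal.toReal_nonneg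
  have e0 : ∀ t : ℝ, (2 : ℝ) ^ (-(((n + 1 : ℕ) : ℝ) * t)) = ((2 : ℝ)⁻¹ ^ (n + 1)) ^ t := fun t => by
    rw [inv_pow, Real.inv_rpow (by positivity), ← Real.rpow_natCast, ← Real.rpow_mul (by norm_num),
      Real.rpow_neg (by norm_num)]
  have e1 : (2 : ℝ) ^ (-(((n + 1 : ℕ) : ℝ) * β)) ≤ (2 : ℝ) ^ (-β) * s ^ β := by
    rw [e0, Real.rpow_neg (by norm_num), ← Real.inv_rpow (by norm_num),
      ← Real.mul_rpow (by norm_num) hs.le]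
    refine Real.rpow_le_rpow_of_nonpos (by positivity) ?_ hβ.le
    rw [pow_succ']
    gcongr
  have e2 : (2 : ℝ) ^ (-(((n + 1 : ℕ) : ℝ) * (r + β))) ≤ s ^ (r + β) := by
    rw [e0]
    exact Real.rpow_le_rpow (by positivity) hn1.le hrβ.le
  have e3 : (s ^ d)⁻¹ = s ^ (-(d : ℝ)) := by rw [Real.rpow_neg hs.le, Real.rpow_natCast]
  have e4 : (s ^ r)⁻¹ = s ^ (-(r : ℝ)) := by rw [Real.rpow_neg hs.le, Real.rpow_natCast]
  have key : s ^ (-α) * |ζ (η.rescale s hs x)| ≤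
      (C + 1) * ((2 : ℝ) ^ (-β) + 1) * (3 + ‖x‖) ^ (d + 1) * G := by
    have hnorm := norm_nonneg x
    have hY : 1 + ‖x‖ + 2 * s ≤ 3 + ‖x‖ := by linarith
    have hY0 : 0 ≤ 3 + ‖x‖ := by positivity
    generalize 3 + ‖x‖ = Y at hY hY0 ⊢
    calc s ^ (-α) * |ζ (η.rescale s hs x)|
        ≤ s ^ (-α) * ((C + 1) * (s ^ (d - d / p) * Y ^ (d + 1) * G) *
          (s ^ (-(d : ℝ)) * ((2 : ℝ) ^ (-β) * s ^ β) +
            s ^ (-(d : ℝ)) * (1 * s ^ (-(r : ℝ))) * s ^ (r + β))) := by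
          gcongr
          refine h.trans ?_
          rw [e3, e4]
          gcongr
          linarith
      _ = (C + 1) * ((2 : ℝ) ^ (-β) + 1) * Y ^ (d + 1) * G *
          (s ^ (-α) * s ^ (d - d / p) * s ^ (-(d : ℝ)) * s ^ β) := by
          rw [Real.rpow_add hs, Real.rpow_neg hs.le (r : ℝ)]
          have : s ^ (r : ℝ) ≠ 0 := by positivity
          field_simp
      _ ≤ (C + 1) * ((2 : ℝ) ^ (-β) + 1) * Y ^ (d + 1) * G * 1 := by
          gcongr
          rw [← Real.rpow_add hs, ← Real.rpow_add hs, ← Real.rpow_add hs]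
          exact Real.rpow_le_one hs.le hs1.le (by linarith)
      _ = _ := mul_one _
  rw [← ENNReal.ofReal_toReal hζ, ← hG, ← ENNReal.ofReal_mul (by positivity), ← ofReal_norm,
    ← ENNReal.ofReal_mul (by positivity)]
  exact ENNReal.ofReal_le_ofReal key

theorem exists_holderSeminorm_le (hφ : IsMollifier φ) (hp : 1 ≤ p) {α : ℝ} (hβ : β < 0)
    (hα : α + d / p < β) :
    ∃ C : ℝ, 0 < C ∧ ∀ (ζ : Distr d) (E : Set (Space d)) (R : ℝ), (∀ x ∈ E, ‖x‖ ≤ R) →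
      holderSeminorm α E ζ ≤ ENNReal.ofReal (C * (3 + R) ^ (d + 1)) * besovNorm φ p β ζ := by
  obtain ⟨C, hC0, hC⟩ := exists_rescale_le (φ := φ) hφ hp hβ hα
  refine ⟨C, hC0, fun ζ E R hR => ?_⟩
  refine iSup₂_le fun η hη => iSup₂_le fun s hs => iSup₂_le fun hs1 x => iSup_le fun hx => ?_
  refine (hC ζ η hη s hs hs1 x).trans ?_
  gcongr
  exact hR x hx

theorem exists_holderGauge_le (hφ : IsMollifier φ) (hp : 1 ≤ p) {α : ℝ} (hβ : β < 0)
    (hα : α + d / p < β) :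
    ∃ C : ℝ≥0, ∀ ζ : Distr d, holderGauge α ζ ≤ C * besovNorm φ p β ζ := by
  obtain ⟨C, hC0, hC⟩ := exists_holderSeminorm_le (φ := φ) hφ hp hβ hα
  have hsum : Summable fun m : ℕ => (2 : ℝ)⁻¹ ^ (m + 1) * (C * (3 + (m + 1)) ^ (d + 1)) := by
    have h1 := summable_pow_mul_geometric_of_norm_lt_one (R := ℝ) (d + 1) (r := 2⁻¹) (by norm_num)
    have h2 := ((summable_nat_add_iff 4).2 h1).mul_left (2 ^ 3 * C)
    refine h2.congr fun m => ?_
    push_cast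
    ring
  refine ⟨Real.toNNReal (∑' m : ℕ, (2 : ℝ)⁻¹ ^ (m + 1) * (C * (3 + (m + 1)) ^ (d + 1))),
    fun ζ => ?_⟩
  change _ ≤ ENNReal.ofReal _ * _
  rw [ENNReal.ofReal_tsum_of_nonneg (fun m => by positivity) hsum, ← ENNReal.tsum_mul_right]
  refine ENNReal.tsum_le_tsum fun m => ?_
  rw [ENNReal.ofReal_mul (by positivity), mul_assoc, ENNReal.ofReal_pow (by norm_num),
    ENNReal.ofReal_inv_of_pos (by norm_num), ENNReal.ofReal_ofNat]
  gcongr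
  refine (min_le_right _ _).trans (hC ζ _ _ fun x hx => ?_)
  rw [mem_ball, dist_zero_right] at hx
  exact hx.le

theorem holderSeminorm_lt_top (hφ : IsMollifier φ) (hp : 1 ≤ p) {α : ℝ} (hβ : β < 0)
    (hα : α + d / p < β) {ζ : Distr d} (hζ : besovNorm φ p β ζ < ∞) (E : Set (Space d))
    (hE : IsCompact E) : holderSeminorm α E ζ < ∞ := by
  obtain ⟨C, hC0, hC⟩ := exists_holderSeminorm_le (φ := φ) hφ hp hβ hα
  obtain ⟨R, hR⟩ := hE.isBounded.exists_norm_le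
  exact (hC ζ E R hR).trans_lt (ENNReal.mul_lt_top ENNReal.ofReal_lt_top hζ)

end Distr

/-! ### Strong measurability through separable `L^p` spaces -/

theorem measurable_lp_of_measurable_edist {Ω E : Type*} [MeasurableSpace Ω] [PseudoEMetricSpace E]
    [SecondCountableTopology E] [MeasurableSpace E] [BorelSpace E] {Y : Ω → E}
    (h : ∀ y, Measurable fun ω => edist (Y ω) y) : Measurable Y := by
  refine measurable_of_isOpen fun U hU => ?_
  have hball : ∀ y ∈ U, ∃ ε > 0, eball y ε ⊆ U := fun y hy => EMetric.isOpen_iff.1 hU y hy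
  choose! ε hε hεU using hball
  obtain ⟨T, hTU, hT, hTeq⟩ := TopologicalSpace.isOpen_biUnion_countable U
    (fun y => eball y (ε y)) fun y _ => isOpen_eball
  have hU' : U = ⋃ y ∈ T, eball y (ε y) := by
    rw [hTeq]
    exact subset_antisymm (fun y hy => Set.mem_iUnion₂.2 ⟨y, hy, mem_eball_self (hε y hy)⟩)
      (Set.iUnion₂_subset hεU)
  rw [hU', Set.preimage_iUnion₂]
  exact MeasurableSet.biUnion hT fun y _ => measurableSet_lt (h y) measurable_const

/-- A map into a metric space is strongly measurable if its increments are controlled by those of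
countably many jointly measurable `L^p`-valued random functions: it then factors continuously
through a separable space. -/
theorem stronglyMeasurable_of_tendsto_eLpNorm {Ω I J X : Type*} [MeasurableSpace Ω]
    [MeasurableSpace I] [MeasurableSpace.CountablyGenerated I] [Countable J]
    (κ : J → Measure I) [∀ j, SFinite (κ j)] {p : ℝ≥0∞} (hp : 1 ≤ p) (hp' : p ≠ ∞)
    [PseudoEMetricSpace X] (Z : Ω → X) (F : J → Ω → I → ℝ)
    (hF : ∀ j, Measurable (Function.uncurry (F j)))
    (hfin : ∀ j ω, eLpNorm (F j ω) p (κ j) < ∞)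
    (hcont : ∀ (ω₀ : Ω) (l : Filter Ω),
      (∀ j, Tendsto (fun ω => eLpNorm (F j ω - F j ω₀) p (κ j)) l (𝓝 0)) →
      Tendsto (fun ω => edist (Z ω) (Z ω₀)) l (𝓝 0)) :
    StronglyMeasurable Z := by
  have : Fact (1 ≤ p) := ⟨hp⟩
  have : Fact (p ≠ ∞) := ⟨hp'⟩
  have hFω : ∀ j ω, Measurable (F j ω) := fun j ω => (hF j).comp measurable_prodMk_left
  have hmem : ∀ j ω, MemLp (F j ω) p (κ j) := fun j ω =>
    ⟨(hFω j ω).aestronglyMeasurable, hfin j ω⟩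
  let Y : Ω → ∀ j, Lp ℝ p (κ j) := fun ω j => (hmem j ω).toLp
  let mLp : ∀ j, MeasurableSpace (Lp ℝ p (κ j)) := fun j => borel _
  have bLp : ∀ j, BorelSpace (Lp ℝ p (κ j)) := fun j => ⟨rfl⟩
  have hY : Measurable Y := by
    refine measurable_pi_iff.2 fun j => measurable_lp_of_measurable_edist fun y => ?_
    have hy : ∀ ω, edist (Y ω j) y = eLpNorm (F j ω - (y : I → ℝ)) p (κ j) := fun ω => by
      rw [Lp.edist_def]
      exact eLpNorm_congr_ae ((hmem j ω).coeFn_toLp.sub EventuallyEq.rfl)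
    simp only [hy]
    have hp0 : p ≠ 0 := (zero_lt_one.trans_le hp).ne'
    simp only [eLpNorm_eq_lintegral_rpow_enorm_toReal hp0 hp']
    refine Measurable.pow_const (Measurable.lintegral_prod_right' (f := fun q : Ω × I =>
      ‖(F j q.1 - (y : I → ℝ)) q.2‖ₑ ^ p.toReal) ?_) _
    refine Measurable.pow_const (Measurable.enorm ?_) _
    exact (hF j).sub ((Lp.stronglyMeasurable y).measurable.comp measurable_snd)
  let tΩ : TopologicalSpace Ω := TopologicalSpace.induced Y inferInstance
  have : SecondCountableTopology Ω := secondCountableTopology_induced _ _ Y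
  have : OpensMeasurableSpace Ω := by
    refine ⟨MeasurableSpace.generateFrom_le ?_⟩
    rintro _ ⟨U, hU, rfl⟩
    exact hY hU.measurableSet
  refine Continuous.stronglyMeasurable (continuous_iff_continuousAt.2 fun ω₀ => ?_)
  refine tendsto_iff_edist_tendsto_0.2 (hcont ω₀ _ fun j => ?_)
  have h1 : Tendsto (fun ω => Y ω j) (𝓝 ω₀) (𝓝 (Y ω₀ j)) :=
    ((continuous_apply j).comp (continuous_induced_dom (f := Y))).continuousAt
  have h2 := tendsto_iff_edist_tendsto_0.1 h1
  refine h2.congr fun ω => ?_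
  rw [Lp.edist_def]
  exact eLpNorm_congr_ae ((hmem j ω).coeFn_toLp.sub (hmem j ω₀).coeFn_toLp)

/-! ### Moments of the Besov norm -/

section Moments

variable {Ω : Type*} [MeasurableSpace Ω] {μ : Measure Ω}

theorem lpMoment_mono {p : ℝ} (hp : 0 < p) {X Y : Ω → ℝ≥0∞} (h : ∀ᵐ ω ∂μ, X ω ≤ Y ω) :
    lpMoment μ p X ≤ lpMoment μ p Y := by
  unfold lpMoment
  gcongr ?_ ^ _
  refine lintegral_mono_ae (h.mono fun ω hω => ?_)
  gcongr

theorem lpMoment_const_mul {p : ℝ} (hp : 0 < p) (C : ℝ≥0) (X : Ω → ℝ≥0∞) :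
    lpMoment μ p (fun ω => C * X ω) = C * lpMoment μ p X := by
  unfold lpMoment
  simp only [ENNReal.mul_rpow_of_nonneg _ _ hp.le]
  rw [lintegral_const_mul' _ _ (ENNReal.rpow_ne_top_of_nonneg hp.le ENNReal.coe_ne_top),
    ENNReal.mul_rpow_of_nonneg _ _ (by positivity), ← ENNReal.rpow_mul, mul_one_div,
    div_self hp.ne', ENNReal.rpow_one]

theorem lpMoment_le_of_lintegral_le {p : ℝ} (hp : 0 < p) {X : Ω → ℝ≥0∞} {K : ℝ≥0} {L : ℝ≥0∞}
    (h : ∫⁻ ω, X ω ^ p ∂μ ≤ (K * L) ^ p) : lpMoment μ p X ≤ K * L := by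
  unfold lpMoment
  rwa [one_div, ENNReal.rpow_inv_le_iff hp]

variable {d : ℕ} {φ : TestFn d} {p β α₀ : ℝ}

theorem IsRandomDistr.sub {ζ ξ : Ω → Distr d} (hζ : IsRandomDistr ζ) (hξ : IsRandomDistr ξ) :
    IsRandomDistr (ζ - ξ) := fun η => (hζ η).sub (hξ η)

theorem IsRandomDistr.measurable_coeff {ζ : Ω → Distr d} (hζ : IsRandomDistr ζ) :
    Measurable fun q : Ω × (ℕ × Space d) => (ζ q.1).coeff φ q.2 :=
  (measurable_uncurry_of_continuous_of_measurable (u := fun i ω => (ζ ω).coeff φ i)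
    (fun ω => (ζ ω).continuous_coeff φ) fun _ => hζ _).comp measurable_swap

theorem IsRandomDistr.measurable_besovNorm {ζ : Ω → Distr d} (hζ : IsRandomDistr ζ) (hp : 0 < p) :
    Measurable fun ω => (ζ ω).besovNorm φ p β := by
  have h : ∀ ω, (ζ ω).besovNorm φ p β =
      (∫⁻ i, ‖(ζ ω).coeff φ i‖ₑ ^ p ∂scaleMeasure d p β) ^ p⁻¹ := fun ω => by
    rw [← Distr.besovNorm_rpow hp, ← ENNReal.rpow_mul, mul_inv_cancel₀ hp.ne', ENNReal.rpow_one]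
  simp only [h]
  exact (Measurable.lintegral_prod_right' (f := fun q : Ω × (ℕ × Space d) =>
    ‖(ζ q.1).coeff φ q.2‖ₑ ^ p) (hζ.measurable_coeff.enorm.pow_const _)).pow_const _

theorem eLpNorm_apply_dyadic_le_latticeNorm (ζ : Ω → Distr d) {n : ℕ} (hn : 1 ≤ n) (x : Space d) :
    eLpNorm (fun ω => ζ ω (φ.dyadic n x)) (ENNReal.ofReal p) μ ≤
      latticeNorm μ φ p α₀ ζ * ENNReal.ofReal ((2 : ℝ) ^ (-(n * α₀))) := by
  have h0 : ENNReal.ofReal ((2 : ℝ) ^ (-(n * α₀))) ≠ 0 := by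
    simpa using Real.rpow_pos_of_pos two_pos _
  rw [← ENNReal.div_le_iff h0 ENNReal.ofReal_ne_top]
  refine le_sInf fun C hC => ?_
  rw [ENNReal.div_le_iff h0 ENNReal.ofReal_ne_top]
  exact (hC n hn).1 x

/-- The `p`-th moment of the Besov norm of regularity `β < α₀` is controlled by the norm of
`C_p^{α₀}`: by Tonelli's theorem, the expectation may be taken inside. -/
theorem exists_lintegral_besovNorm_le (d : ℕ) (hp : 0 < p) (hβ : β < α₀) :
    ∃ K : ℝ≥0, ∀ (φ : TestFn d) {Ω : Type u} [MeasurableSpace Ω] (μ : Measure Ω)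
      [IsProbabilityMeasure μ] (ζ : Ω → Distr d), IsRandomDistr ζ →
      ∫⁻ ω, (ζ ω).besovNorm φ p β ^ p ∂μ ≤ (K * latticeNorm μ φ p α₀ ζ) ^ p := by
  set q := (2 : ℝ) ^ ((β - α₀) * p) with hq
  have hq0 : 0 < q := by positivity
  have hq1 : q < 1 := Real.rpow_lt_one_of_one_lt_of_neg (by norm_num) (by nlinarith)
  set A : ℝ≥0∞ := (∑' n : ℕ, ENNReal.ofReal q ^ (n + 1)) * weightMeasure d Set.univ with hA
  have hAtop : A ≠ ∞ := by
    refine ENNReal.mul_ne_top ?_ (measure_ne_top _ _)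
    have : ∀ n : ℕ, ENNReal.ofReal q ^ (n + 1) = ENNReal.ofReal q * ENNReal.ofReal q ^ n :=
      fun n => pow_succ' _ _
    simp only [this]
    rw [ENNReal.tsum_mul_left, ENNReal.tsum_geometric]
    refine ENNReal.mul_ne_top ENNReal.ofReal_ne_top (ENNReal.inv_ne_top.2 ?_)
    have : ENNReal.ofReal q < 1 := by
      rw [← ENNReal.ofReal_one]; exact ENNReal.ofReal_lt_ofReal_iff_of_nonneg hq0.le |>.2 hq1
    exact (tsub_pos_of_lt this).ne'
  refine ⟨(A ^ p⁻¹).toNNReal, fun φ Ω _ μ _ ζ hζ => ?_⟩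
  set L := latticeNorm μ φ p α₀ ζ with hL
  rw [ENNReal.coe_toNNReal (ENNReal.rpow_ne_top_of_nonneg (by positivity) hAtop),
    ENNReal.mul_rpow_of_nonneg _ _ hp.le, ← ENNReal.rpow_mul, inv_mul_cancel₀ hp.ne',
    ENNReal.rpow_one]
  simp only [Distr.besovNorm_rpow hp]
  have hm := (hζ.measurable_coeff (φ := φ)).enorm.pow_const p
  rw [lintegral_lintegral_swap hm.aemeasurable, lintegral_scaleMeasure hm.lintegral_prod_left',
    hA, ← ENNReal.tsum_mul_right, ← ENNReal.tsum_mul_right]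
  refine ENNReal.tsum_le_tsum fun n => ?_
  have h1 : ∀ z, ∫⁻ ω, ‖(ζ ω).coeff φ (n, z)‖ₑ ^ p ∂μ ≤
      L ^ p * ENNReal.ofReal ((2 : ℝ) ^ (-(((n + 1 : ℕ) : ℝ) * α₀ * p))) := by
    intro z
    have h2 := eLpNorm_apply_dyadic_le_latticeNorm (μ := μ) (φ := φ) (p := p) (α₀ := α₀) ζ
      (Nat.succ_le_succ (Nat.zero_le n)) z
    rw [eLpNorm_eq_lintegral_rpow_enorm_toReal (by simpa using hp) ENNReal.ofReal_ne_top,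
      ENNReal.toReal_ofReal hp.le, one_div, ENNReal.rpow_inv_le_iff hp,
      ENNReal.mul_rpow_of_nonneg _ _ hp.le, ENNReal.ofReal_rpow_of_pos (by positivity),
      ← Real.rpow_mul (by norm_num)] at h2
    refine h2.trans_eq ?_
    congr 3
    push_cast; ring
  refine (mul_le_mul_right (lintegral_mono h1) _).trans_eq ?_
  rw [lintegral_const]
  have h3 : ENNReal.ofReal ((2 : ℝ) ^ (((n + 1 : ℕ) : ℝ) * β * p)) *
      ENNReal.ofReal ((2 : ℝ) ^ (-(((n + 1 : ℕ) : ℝ) * α₀ * p))) = ENNReal.ofReal q ^ (n + 1) := by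
    rw [← ENNReal.ofReal_mul (by positivity), ← Real.rpow_add (by norm_num),
      ← ENNReal.ofReal_pow hq0.le, hq, ← Real.rpow_mul_natCast (by norm_num)]
    congr 2; ring
  rw [← h3]
  ring

end Moments

/-! ### The embedding of `C_p^{α₀}` into `L^p(Ω, C^α)` -/

/-- The moments of the Hölder gauge of a random distribution. Applied to differences, this is the
Lipschitz bound for the embedding. -/
theorem exists_lpMoment_holderGauge_le {d : ℕ} {φ : TestFn d} (hφ : IsMollifier φ) {p α₀ α β : ℝ}
    (hp : 1 ≤ p) (hβ : β < 0) (hα : α + d / p < β) (hβα₀ : β < α₀) :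
    ∃ C : ℝ≥0, ∀ (Ω : Type u) [MeasurableSpace Ω] (μ : Measure Ω) [IsProbabilityMeasure μ]
      (ζ : Ω → Distr d), IsRandomDistr ζ →
      lpMoment μ p (fun ω => holderGauge α (ζ ω)) ≤ C * latticeNorm μ φ p α₀ ζ := by
  have hp0 : 0 < p := by linarith
  obtain ⟨C, hC⟩ := Distr.exists_holderGauge_le (φ := φ) hφ hp hβ hα
  obtain ⟨K, hK⟩ := exists_lintegral_besovNorm_le.{u} d hp0 hβα₀
  refine ⟨C * K, fun Ω _ μ _ ζ hζ => ?_⟩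
  refine (lpMoment_mono hp0 (Eventually.of_forall fun ω => hC (ζ ω))).trans ?_
  rw [lpMoment_const_mul hp0, ENNReal.coe_mul, mul_assoc]
  gcongr
  exact lpMoment_le_of_lintegral_le hp0 (hK φ μ ζ hζ)

open Classical in
theorem IsRandomDistr.ite {d : ℕ} {Ω : Type*} [MeasurableSpace Ω] {ζ : Ω → Distr d}
    (hζ : IsRandomDistr ζ) {s : Set Ω} (hs : MeasurableSet s) :
    IsRandomDistr fun ω => if ω ∈ s then ζ ω else 0 := by
  intro η
  have h : (fun ω => (if ω ∈ s then ζ ω else 0) η) = fun ω => if ω ∈ s then ζ ω η else 0 := by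
    funext ω
    split_ifs <;> rfl
  rw [h]
  exact Measurable.ite hs (hζ η) measurable_const

theorem exists_stronglyMeasurable_holderDistr {d : ℕ} {φ : TestFn d} (hφ : IsMollifier φ)
    {p α β : ℝ} (hp : 1 ≤ p) (hβ : β < 0) (hα : α + d / p < β) {Ω : Type*} [MeasurableSpace Ω]
    {ζ : Ω → Distr d} (hζ : IsRandomDistr ζ) (hfin : ∀ ω, (ζ ω).besovNorm φ p β < ∞) :
    ∃ Z : Ω → HolderDistr d α, StronglyMeasurable Z ∧ ∀ ω, (Z ω).toDistr = ζ ω := by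
  obtain ⟨C, hC⟩ := Distr.exists_holderGauge_le (φ := φ) hφ hp hβ hα
  refine ⟨fun ω => ⟨ζ ω, Distr.holderSeminorm_lt_top hφ hp hβ hα (hfin ω)⟩, ?_, fun _ => rfl⟩
  refine stronglyMeasurable_of_tendsto_eLpNorm (J := Unit) (fun _ => scaleMeasure d p β)
    (p := ENNReal.ofReal p) (by simpa using ENNReal.ofReal_le_ofReal hp) ENNReal.ofReal_ne_top _
    (fun _ ω => (ζ ω).coeff φ) (fun _ => hζ.measurable_coeff) (fun _ ω => hfin ω)
    fun ω₀ l hl => ?_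
  have h1 := ENNReal.Tendsto.const_mul (a := C) (hl ()) (Or.inr ENNReal.coe_ne_top)
  rw [mul_zero] at h1
  exact tendsto_of_tendsto_of_tendsto_of_le_of_le tendsto_const_nhds h1 (fun _ => zero_le)
    fun ω => hC (ζ ω - ζ ω₀)

/-- The representative in `L^p(Ω, C^α)` vanishes on the null event that the Besov norm is
infinite. -/
theorem exists_memLpHolderDistr {d : ℕ} {φ : TestFn d} (hφ : IsMollifier φ) {p α₀ α β : ℝ}
    (hp : 1 ≤ p) (hβ : β < 0) (hα : α + d / p < β) (hβα₀ : β < α₀) {Ω : Type u}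
    [MeasurableSpace Ω] (μ : Measure Ω) [IsProbabilityMeasure μ] {ζ : Ω → Distr d}
    (hζ : MemLattice μ φ p α₀ ζ) :
    ∃ Z : Ω → HolderDistr d α, MemLpHolderDistr μ p Z ∧ ∀ᵐ ω ∂μ, (Z ω).toDistr = ζ ω := by
  classical
  have hp0 : 0 < p := by linarith
  obtain ⟨C, hC⟩ := exists_lpMoment_holderGauge_le.{u} hφ hp hβ hα hβα₀
  obtain ⟨K, hK⟩ := exists_lintegral_besovNorm_le.{u} d hp0 hβα₀
  have hm : Measurable fun ω => (ζ ω).besovNorm φ p β := hζ.1.measurable_besovNorm hp0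
  set s := {ω | (ζ ω).besovNorm φ p β < ∞} with hs
  have hsm : MeasurableSet s := measurableSet_lt hm measurable_const
  have hae : ∀ᵐ ω ∂μ, ω ∈ s := by
    have h1 : ∫⁻ ω, (ζ ω).besovNorm φ p β ^ p ∂μ ≠ ∞ :=
      ((hK φ μ ζ hζ.1).trans_lt (ENNReal.rpow_lt_top_of_nonneg hp0.le
        (ENNReal.mul_ne_top ENNReal.coe_ne_top hζ.2.ne))).ne
    filter_upwards [ae_lt_top (hm.pow_const p) h1] with ω hω
    exact (ENNReal.rpow_lt_top_iff_of_pos hp0).1 hω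
  obtain ⟨Z, hZm, hZ⟩ := exists_stronglyMeasurable_holderDistr (α := α) (φ := φ) (p := p) (β := β)
    hφ hp hβ hα (hζ.1.ite hsm) fun ω => by
      split_ifs with h
      · exact h
      · rw [Distr.besovNorm_zero]; exact ENNReal.zero_lt_top
  have hZae : ∀ᵐ ω ∂μ, (Z ω).toDistr = ζ ω := hae.mono fun ω hω => by rw [hZ, if_pos hω]
  refine ⟨Z, ⟨hZm.aestronglyMeasurable, ?_⟩, hZae⟩
  have h1 : lpMoment μ p (fun ω => holderDist α (Z ω).toDistr 0) ≤
      lpMoment μ p (fun ω => holderGauge α (ζ ω)) :=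
    lpMoment_mono hp0 (hZae.mono fun ω hω => by rw [holderDist, sub_zero, hω])
  exact h1.trans_lt ((hC Ω μ ζ hζ.1).trans_lt (ENNReal.mul_lt_top ENNReal.coe_lt_top hζ.2))

/-! ### Dyadic chaining in time -/

/-- The largest multiple of `2^{-n}` that is at most `t`. -/
noncomputable def dyadicFloor (n : ℕ) (t : ℝ≥0) : ℝ≥0 := (⌊t * 2 ^ n⌋₊ : ℝ≥0) / 2 ^ n

theorem dyadicFloor_le (n : ℕ) (t : ℝ≥0) : dyadicFloor n t ≤ t := by
  rw [dyadicFloor, div_le_iff₀ (by positivity)]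
  exact Nat.floor_le zero_le

theorem dist_dyadicFloor_le (n : ℕ) (t : ℝ≥0) : dist t (dyadicFloor n t) ≤ (2 : ℝ)⁻¹ ^ n := by
  have h1 : t * 2 ^ n < (⌊t * 2 ^ n⌋₊ : ℝ≥0) + 1 := Nat.lt_floor_add_one _
  have h2 : t ≤ dyadicFloor n t + (2 ^ n)⁻¹ := by
    rw [dyadicFloor, ← one_div, ← add_div, le_div_iff₀ (by positivity)]
    exact h1.le
  have h3 : (t : ℝ) ≤ dyadicFloor n t + (2 ^ n)⁻¹ := by exact_mod_cast h2
  have h4 : (dyadicFloor n t : ℝ) ≤ t := by exact_mod_cast dyadicFloor_le n t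
  rw [NNReal.dist_eq, abs_of_nonneg (by linarith), inv_pow]
  linarith

theorem dyadicFloor_dyadic {j n : ℕ} (h : j ≤ n) (k : ℕ) :
    dyadicFloor n ((k : ℝ≥0) / 2 ^ j) = (k : ℝ≥0) / 2 ^ j := by
  obtain ⟨i, rfl⟩ := Nat.exists_eq_add_of_le h
  have h1 : (k : ℝ≥0) / 2 ^ j * 2 ^ (j + i) = ((k * 2 ^ i : ℕ) : ℝ≥0) := by
    push_cast
    rw [pow_add]
    field_simp
  rw [dyadicFloor, h1, Nat.floor_natCast, ← h1]
  field_simp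

section Chaining

variable {X : Type*} [AddCommGroup X] {q : X → ℝ≥0∞} (hq0 : q 0 = 0)
  (hqadd : ∀ a b, q (a + b) ≤ q a + q b) (hqneg : ∀ a, q (-a) = q a)
  {f : ℝ≥0 → X} {T : ℝ≥0} {A δ : ℝ≥0∞}
  (hf : ∀ j k : ℕ, ((k + 1 : ℕ) : ℝ≥0) / 2 ^ j ≤ T →
    q (f (((k + 1 : ℕ) : ℝ≥0) / 2 ^ j) - f ((k : ℝ≥0) / 2 ^ j)) ≤ δ ^ j * A)

include hq0 hf in
/-- Consecutive dyadic floors coincide or are neighbours in the finer grid. -/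
theorem chaining_succ {t : ℝ≥0} (ht : t ≤ T) (n : ℕ) :
    q (f (dyadicFloor (n + 1) t) - f (dyadicFloor n t)) ≤ δ ^ (n + 1) * A := by
  set k := ⌊t * 2 ^ n⌋₊ with hk
  have h1 : (k : ℝ≥0) ≤ t * 2 ^ n := Nat.floor_le zero_le
  have h2 : t * 2 ^ n < (k : ℝ≥0) + 1 := Nat.lt_floor_add_one _
  have hlow : 2 * k ≤ ⌊t * 2 ^ (n + 1)⌋₊ := by
    refine Nat.le_floor ?_
    push_cast
    calc (2 : ℝ≥0) * k ≤ 2 * (t * 2 ^ n) := by gcongr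
      _ = t * 2 ^ (n + 1) := by ring
  have hup : ⌊t * 2 ^ (n + 1)⌋₊ < 2 * k + 2 := by
    rw [Nat.floor_lt zero_le]
    push_cast
    calc t * 2 ^ (n + 1) = 2 * (t * 2 ^ n) := by ring
      _ < 2 * (k + 1) := by gcongr
      _ = 2 * k + 2 := by ring
  have hn : dyadicFloor n t = ((2 * k : ℕ) : ℝ≥0) / 2 ^ (n + 1) := by
    rw [dyadicFloor, ← hk, pow_succ']
    push_cast
    rw [mul_div_mul_left _ _ two_ne_zero]
  rcases (by omega : ⌊t * 2 ^ (n + 1)⌋₊ = 2 * k ∨ ⌊t * 2 ^ (n + 1)⌋₊ = 2 * k + 1) with h | h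
  · have : dyadicFloor (n + 1) t = dyadicFloor n t := by rw [hn, dyadicFloor, h]
    rw [this, sub_self, hq0]
    exact zero_le
  · have h3 : dyadicFloor (n + 1) t = ((2 * k + 1 : ℕ) : ℝ≥0) / 2 ^ (n + 1) := by
      rw [dyadicFloor, h]
    rw [h3, hn]
    refine hf (n + 1) (2 * k) ?_
    rw [← h3]
    exact (dyadicFloor_le _ _).trans ht

include hq0 hqadd hf in
theorem chaining_le {t : ℝ≥0} (ht : t ≤ T) (n m : ℕ) :
    q (f (dyadicFloor (n + m) t) - f (dyadicFloor n t)) ≤ δ ^ n * (1 - δ)⁻¹ * A := by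
  have h1 : q (f (dyadicFloor (n + m) t) - f (dyadicFloor n t)) ≤
      ∑ i ∈ Finset.range m, δ ^ (n + (i + 1)) * A := by
    induction m with
    | zero => simp [hq0]
    | succ m ih =>
      rw [Finset.sum_range_succ, add_comm (∑ _ ∈ _, _)]
      have h2 := hqadd (f (dyadicFloor (n + m + 1) t) - f (dyadicFloor (n + m) t))
        (f (dyadicFloor (n + m) t) - f (dyadicFloor n t))
      rw [sub_add_sub_cancel] at h2
      exact h2.trans (add_le_add (chaining_succ hq0 hf ht (n + m)) ih)
  refine h1.trans ?_
  rw [← Finset.sum_mul]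
  gcongr
  rcases le_or_gt δ 1 with hδ | hδ
  · rw [← ENNReal.tsum_geometric, ← ENNReal.tsum_mul_left]
    refine (ENNReal.sum_le_tsum _).trans (ENNReal.tsum_le_tsum fun i => ?_)
    rw [← add_assoc, pow_succ, pow_add]
    exact mul_le_of_le_one_right' hδ
  · rw [tsub_eq_zero_of_le hδ.le, ENNReal.inv_zero, ENNReal.mul_top
      (pow_ne_zero n (zero_lt_one.trans hδ).ne')]
    exact le_top

include hq0 hqadd hf in
theorem chaining_limit {t : ℝ≥0} (ht : t ≤ T)
    (hlim : Tendsto (fun n => q (f t - f (dyadicFloor n t))) atTop (𝓝 0)) (n : ℕ) :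
    q (f t - f (dyadicFloor n t)) ≤ δ ^ n * (1 - δ)⁻¹ * A := by
  have h1 : Tendsto (fun m => q (f t - f (dyadicFloor (n + m) t)) + δ ^ n * (1 - δ)⁻¹ * A) atTop
      (𝓝 (0 + δ ^ n * (1 - δ)⁻¹ * A)) := by
    refine Tendsto.add_const _ ?_
    have := (tendsto_add_atTop_iff_nat n).2 hlim
    simpa only [add_comm] using this
  rw [zero_add] at h1
  refine ge_of_tendsto h1 (Eventually.of_forall fun m => ?_)
  have h2 := hqadd (f t - f (dyadicFloor (n + m) t))
    (f (dyadicFloor (n + m) t) - f (dyadicFloor n t))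
  rw [sub_add_sub_cancel] at h2
  exact h2.trans (by gcongr; exact chaining_le hq0 hqadd hf ht n m)

include hq0 hqadd hf in
theorem chaining_grid (j k i : ℕ) (h : ((k + i : ℕ) : ℝ≥0) / 2 ^ j ≤ T) :
    q (f (((k + i : ℕ) : ℝ≥0) / 2 ^ j) - f ((k : ℝ≥0) / 2 ^ j)) ≤ i * (δ ^ j * A) := by
  induction i with
  | zero => simp [hq0]
  | succ i ih =>
    have h1 : ((k + i : ℕ) : ℝ≥0) / 2 ^ j ≤ T := le_trans (by gcongr; omega) h
    have h2 := hqadd (f (((k + i + 1 : ℕ) : ℝ≥0) / 2 ^ j) - f (((k + i : ℕ) : ℝ≥0) / 2 ^ j))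
      (f (((k + i : ℕ) : ℝ≥0) / 2 ^ j) - f ((k : ℝ≥0) / 2 ^ j))
    rw [sub_add_sub_cancel] at h2
    refine h2.trans ((add_le_add (hf j (k + i) h) (ih h1)).trans_eq ?_)
    push_cast
    ring

include hq0 hqadd hqneg hf in
theorem chaining_increment {s t : ℝ≥0} (hst : s ≤ t) (ht : t ≤ T)
    (hlim : ∀ t ≤ T, Tendsto (fun n => q (f t - f (dyadicFloor n t))) atTop (𝓝 0)) (n i : ℕ)
    (hi : ⌊t * 2 ^ n⌋₊ ≤ ⌊s * 2 ^ n⌋₊ + i) :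
    q (f t - f s) ≤ (2 * (1 - δ)⁻¹ + i) * (δ ^ n * A) := by
  have hs : s ≤ T := hst.trans ht
  have e1 := chaining_limit hq0 hqadd hf ht (hlim t ht) n
  have e2 := chaining_limit hq0 hqadd hf hs (hlim s hs) n
  obtain ⟨l, hl⟩ := Nat.exists_eq_add_of_le
    (Nat.floor_le_floor (mul_le_mul_left hst (2 ^ n)) : ⌊s * 2 ^ n⌋₊ ≤ ⌊t * 2 ^ n⌋₊)
  have e3 : q (f (dyadicFloor n t) - f (dyadicFloor n s)) ≤ i * (δ ^ n * A) := by
    have h1 : dyadicFloor n t = ((⌊s * 2 ^ n⌋₊ + l : ℕ) : ℝ≥0) / 2 ^ n := by rw [dyadicFloor, hl]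
    have h2 := chaining_grid hq0 hqadd hf n ⌊s * 2 ^ n⌋₊ l
      (by rw [← h1]; exact (dyadicFloor_le _ _).trans ht)
    rw [← h1] at h2
    refine h2.trans ?_
    gcongr
    omega
  have h3 : f t - f s = (f t - f (dyadicFloor n t)) +
      ((f (dyadicFloor n t) - f (dyadicFloor n s)) + -(f s - f (dyadicFloor n s))) := by abel
  rw [h3]
  refine (hqadd _ _).trans ((add_le_add e1 ((hqadd _ _).trans (add_le_add e3
    ((hqneg _).trans_le e2)))).trans_eq ?_)
  ring

end Chaining

/-- Dyadic chaining: if the increments of `f` over the dyadic intervals of length `2^{-j}` in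
`[0,T]` are at most `2^{-jγ} A` in the gauge `q`, and `f t` is the limit of `f` along the dyadic
times just below `t`, then `f` is `γ`-Hölder on `[0,T]` with a constant proportional to `A`. -/
theorem exists_chaining_const {γ : ℝ} (hγ : 0 < γ) (T : ℝ≥0) :
    ∃ C : ℝ≥0, ∀ {X : Type u} [AddCommGroup X] {q : X → ℝ≥0∞} (_ : q 0 = 0)
      (_ : ∀ a b, q (a + b) ≤ q a + q b) (_ : ∀ a, q (-a) = q a) {f : ℝ≥0 → X} {A : ℝ≥0∞}
      (_ : ∀ j k : ℕ, ((k + 1 : ℕ) : ℝ≥0) / 2 ^ j ≤ T →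
        q (f (((k + 1 : ℕ) : ℝ≥0) / 2 ^ j) - f ((k : ℝ≥0) / 2 ^ j)) ≤
          ENNReal.ofReal ((2 : ℝ) ^ (-γ)) ^ j * A)
      (_ : ∀ t ≤ T, Tendsto (fun n => q (f t - f (dyadicFloor n t))) atTop (𝓝 0))
      {s t : ℝ≥0}, s ≤ T → t ≤ T → q (f t - f s) ≤ C * (ENNReal.ofReal (dist t s ^ γ) * A) := by
  set δ := ENNReal.ofReal ((2 : ℝ) ^ (-γ)) with hδ
  have hδ1 : δ < 1 := by
    rw [hδ, ← ENNReal.ofReal_one]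
    exact (ENNReal.ofReal_lt_ofReal_iff_of_nonneg (by positivity)).2
      (Real.rpow_lt_one_of_one_lt_of_neg (by norm_num) (by linarith))
  set D := 2 * (1 - δ)⁻¹ + ((⌈T⌉₊ + 1 : ℕ) : ℝ≥0∞) with hD
  have hDtop : D ≠ ∞ := ENNReal.add_ne_top.2 ⟨ENNReal.mul_ne_top ENNReal.ofNat_ne_top
    (ENNReal.inv_ne_top.2 (tsub_pos_of_lt hδ1).ne'), ENNReal.natCast_ne_top _⟩
  refine ⟨D.toNNReal * ((2 : ℝ) ^ γ).toNNReal, ?_⟩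
  intro X _ q hq0 hqadd hqneg f A hf hlim s t hs ht
  wlog hst : s ≤ t generalizing s t with H
  · have := H ht hs (le_of_not_ge hst)
    rwa [dist_comm, ← hqneg, neg_sub] at this
  rcases hst.eq_or_lt with rfl | hlt
  · rw [sub_self, hq0]; exact zero_le
  have hlt' : (s : ℝ) < t := by exact_mod_cast hlt
  have hdist : dist t s = (t : ℝ) - s := by
    rw [NNReal.dist_eq, abs_of_pos (by linarith)]
  -- it suffices to find a level at which the two times are close to neighbouring grid points
  suffices h : ∃ n i : ℕ, ⌊t * 2 ^ n⌋₊ ≤ ⌊s * 2 ^ n⌋₊ + i ∧ i ≤ ⌈T⌉₊ + 1 ∧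
      δ ^ n ≤ ENNReal.ofReal ((2 : ℝ) ^ γ) * ENNReal.ofReal (dist t s ^ γ) by
    obtain ⟨n, i, h1, h2, h3⟩ := h
    refine (chaining_increment hq0 hqadd hqneg hf hst ht hlim n i h1).trans ?_
    rw [ENNReal.coe_mul, ENNReal.coe_toNNReal hDtop, hD, mul_assoc]
    refine mul_le_mul' (by gcongr) ?_
    rw [← mul_assoc]
    exact mul_le_mul_left h3 A
  rcases le_or_gt ((t : ℝ) - s) 1 with h1 | h1
  · obtain ⟨n, hn1, hn2⟩ := exists_nat_pow_near_of_lt_one (sub_pos.2 hlt') h1 (y := (2 : ℝ)⁻¹)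
      (by norm_num) (by norm_num)
    refine ⟨n, 1, ?_, by omega, ?_⟩
    · rw [← Nat.floor_add_one zero_le]
      refine Nat.floor_le_floor ?_
      have h2 : ((t : ℝ) - s) * 2 ^ n ≤ 1 := by
        rw [inv_pow] at hn2
        calc ((t : ℝ) - s) * 2 ^ n ≤ (2 ^ n)⁻¹ * 2 ^ n := by gcongr
          _ = 1 := inv_mul_cancel₀ (by positivity)
      have h3 : (t : ℝ) * 2 ^ n ≤ s * 2 ^ n + 1 := by linarith
      exact_mod_cast h3
    · rw [hdist, hδ, ← ENNReal.ofReal_pow (by positivity), ← ENNReal.ofReal_mul (by positivity)]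
      refine ENNReal.ofReal_le_ofReal ?_
      rw [← Real.mul_rpow (by norm_num) (sub_pos.2 hlt').le, ← Real.rpow_mul_natCast (by norm_num)]
      have h2 : (2 : ℝ) ^ (-γ * n) = ((2 : ℝ)⁻¹ ^ n) ^ γ := by
        rw [inv_pow, Real.inv_rpow (by positivity), ← Real.rpow_natCast,
          ← Real.rpow_mul (by norm_num), ← Real.rpow_neg (by norm_num)]
        ring_nf
      rw [h2]
      refine Real.rpow_le_rpow (by positivity) ?_ hγ.le
      rw [pow_succ'] at hn1
      linarith
  · refine ⟨0, ⌈T⌉₊, ?_, by omega, ?_⟩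
    · refine le_trans ?_ (Nat.le_add_left _ _)
      rw [pow_zero, mul_one]
      exact (Nat.floor_le_floor ht).trans (Nat.floor_le_ceil T)
    · rw [pow_zero, hdist, ← ENNReal.ofReal_mul (by positivity), ← ENNReal.ofReal_one]
      refine ENNReal.ofReal_le_ofReal ?_
      rw [← Real.mul_rpow (by norm_num) (sub_pos.2 hlt').le]
      exact Real.one_le_rpow (by linarith) hγ.le

/-! ### Completeness of the Besov norm -/

theorem tendsto_metrise {ι : Type*} {l : Filter ι} {q : ι → ℕ → ℝ≥0∞}
    (h : ∀ m, Tendsto (fun i => q i m) l (𝓝 0)) : Tendsto (fun i => metrise (q i)) l (𝓝 0) := by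
  have hsum : ∑' m : ℕ, (2⁻¹ : ℝ≥0∞) ^ (m + 1) ≠ ∞ := by
    simp only [pow_succ, ENNReal.tsum_mul_right, ENNReal.tsum_geometric]
    norm_num
  refine ENNReal.tendsto_nhds_zero.2 fun ε hε => ?_
  have hε2 : 0 < ε / 2 := ENNReal.half_pos hε.ne'
  obtain ⟨N, hN⟩ := (ENNReal.tendsto_nhds_zero.1 (ENNReal.tendsto_sum_nat_add _ hsum) _ hε2).exists
  have hfin : Tendsto (fun i => ∑ m ∈ Finset.range N, q i m) l (𝓝 0) := by
    simpa using tendsto_finsetSum (Finset.range N) fun m _ => h m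
  filter_upwards [ENNReal.tendsto_nhds_zero.1 hfin _ hε2] with i hi
  rw [metrise, ← ENNReal.summable.sum_add_tsum_nat_add' (k := N), ← ENNReal.add_halves ε]
  refine add_le_add (le_trans (Finset.sum_le_sum fun m _ => ?_) hi)
    (le_trans (ENNReal.tsum_le_tsum fun m => ?_) hN)
  · refine (mul_le_of_le_one_left' ?_).trans (min_le_right _ _)
    exact pow_le_one₀ zero_le (ENNReal.inv_le_one.2 one_le_two)
  · exact mul_le_of_le_one_right' (min_le_left _ _)

namespace Distr

variable {d : ℕ} {φ : TestFn d} {p β : ℝ}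

/-- A Cauchy sequence for the Besov norm converges, and the limit inherits the bounds on the
increments by Fatou's lemma. -/
theorem exists_besovNorm_sub_le (hφ : IsMollifier φ) (hp : 1 ≤ p) (hβ : β ≤ 0) {ζ : ℕ → Distr d}
    {ε : ℕ → ℝ≥0∞} (hε : Tendsto ε atTop (𝓝 0))
    (h : ∀ n m, besovNorm φ p β (ζ (n + m) - ζ n) ≤ ε n) :
    ∃ ξ : Distr d, ∀ n, besovNorm φ p β (ξ - ζ n) ≤ ε n := by
  obtain ⟨N, hN⟩ := (hε.eventually_lt_const ENNReal.zero_lt_top).exists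
  have hcau : ∀ η, CauchySeq fun n => ζ n η := fun η => by
    obtain ⟨C, hC⟩ := exists_enorm_apply_le (β := β) hφ hp hβ η
    have hCε : Tendsto (fun n => C * ε n) atTop (𝓝 0) := by
      simpa using ENNReal.Tendsto.const_mul (a := C) hε (Or.inr ENNReal.coe_ne_top)
    refine EMetric.cauchySeq_iff'.2 fun δ hδ => ?_
    obtain ⟨n, hn⟩ := (hCε.eventually_lt_const hδ).exists
    refine ⟨n, fun k hk => ?_⟩
    obtain ⟨m, rfl⟩ := Nat.exists_eq_add_of_le hk
    rw [edist_eq_enorm_sub]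
    exact ((hC (ζ (n + m) - ζ n)).trans (mul_le_mul_right (h n m) _)).trans_lt hn
  obtain ⟨ξ, hξ⟩ := exists_of_tendsto (φ := φ) (β := β) hφ hp hβ
    (ζ := fun m => ζ (N + m) - ζ N) (B := (ε N).toNNReal)
    (fun m => by rw [ENNReal.coe_toNNReal hN.ne]; exact h N m) fun η => by
      obtain ⟨l, hl⟩ := cauchySeq_tendsto_of_complete (hcau η)
      refine ⟨l - ζ N η, Tendsto.sub_const ?_ _⟩
      have := (tendsto_add_atTop_iff_nat N).2 hl
      simp only [add_comm _ N] at this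
      exact this
  have hlim : ∀ η, Tendsto (fun n => ζ n η) atTop (𝓝 ((ξ + ζ N) η)) := fun η => by
    have h1 : Tendsto (fun m => ζ (m + N) η) atTop (𝓝 (ξ η + ζ N η)) := by
      have := (hξ η).add_const (ζ N η)
      refine this.congr fun m => ?_
      rw [add_comm m N]
      exact sub_add_cancel _ _
    exact (tendsto_add_atTop_iff_nat N).1 h1
  refine ⟨ξ + ζ N, fun n => ?_⟩
  refine (Lp.eLpNorm_lim_le_liminf_eLpNorm (f := fun m => (ζ (n + m) - ζ n).coeff φ)
    (fun m => (continuous_coeff φ _).aestronglyMeasurable) _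
    (Eventually.of_forall fun i => ?_)).trans ?_
  · have h1 := (tendsto_add_atTop_iff_nat n).2 (hlim (φ.dyadic (i.1 + 1) i.2))
    simp only [add_comm _ n] at h1
    exact h1.sub_const _
  · exact liminf_le_of_frequently_le' (Eventually.of_forall fun m => h n m).frequently

end Distr

/-! ### A Besov norm for distribution-valued paths -/

/-- The increments of a path over the dyadic intervals: the pair `(j, k + 1)` stands for the
interval from `k 2^{-j}` to `(k + 1) 2^{-j}`, and the pairs `(j, 0)` for the initial value. -/
noncomputable def dyadicIncr {X : Type*} [Sub X] (f : ℝ≥0 → X) : ℕ × ℕ → X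
  | (_, 0) => f 0
  | (j, k + 1) => f (((k + 1 : ℕ) : ℝ≥0) / 2 ^ j) - f ((k : ℝ≥0) / 2 ^ j)

open Classical in
/-- The weight `2^{jγp}` for the dyadic increments of length `2^{-j}` in `[0,T]`. The initial value
is counted once, with weight one. -/
noncomputable def incrWeight (p γ : ℝ) (T : ℝ≥0) : ℕ × ℕ → ℝ
  | (j, 0) => if j = 0 then 1 else 0
  | (j, k + 1) => if ((k + 1 : ℕ) : ℝ≥0) / 2 ^ j ≤ T then (2 : ℝ) ^ (j * γ * p) else 0

/-- The measure whose `L^p` space contains the coefficients of the dyadic increments of a path. -/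
noncomputable def incrMeasure (d : ℕ) (p β γ : ℝ) (T : ℝ≥0) :
    Measure ((ℕ × ℕ) × (ℕ × Space d)) :=
  (Measure.count.withDensity fun a => ENNReal.ofReal (incrWeight p γ T a)).prod
    (scaleMeasure d p β)

instance (d : ℕ) (p β γ : ℝ) (T : ℝ≥0) : SFinite (incrMeasure d p β γ T) := by
  unfold incrMeasure
  infer_instance

/-- The coefficients of the dyadic increments of a path. -/
noncomputable def pathCoeff {d : ℕ} (φ : TestFn d) (f : ℝ≥0 → Distr d)
    (i : (ℕ × ℕ) × (ℕ × Space d)) : ℝ :=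
  (dyadicIncr f i.1).coeff φ i.2

/-- The `ℓ^p` norm of the weighted Besov norms of the dyadic increments of a path in `[0,T]`. -/
noncomputable def pathNorm {d : ℕ} (φ : TestFn d) (p β γ : ℝ) (T : ℝ≥0) (f : ℝ≥0 → Distr d) :
    ℝ≥0∞ :=
  eLpNorm (pathCoeff φ f) (ENNReal.ofReal p) (incrMeasure d p β γ T)

theorem dyadicIncr_sub {X : Type*} [AddCommGroup X] (f g : ℝ≥0 → X) (a : ℕ × ℕ) :
    dyadicIncr (f - g) a = dyadicIncr f a - dyadicIncr g a := by
  obtain ⟨j, _ | k⟩ := a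
  · rfl
  · simp only [dyadicIncr, Pi.sub_apply]
    abel

theorem dyadicIncr_congr {X : Type*} [Sub X] {f g : ℝ≥0 → X}
    (h : ∀ j k : ℕ, f ((k : ℝ≥0) / 2 ^ j) = g ((k : ℝ≥0) / 2 ^ j)) :
    dyadicIncr f = dyadicIncr g := by
  funext ⟨j, k⟩
  obtain _ | k := k
  · simpa [dyadicIncr] using h 0 0
  · simp only [dyadicIncr, h]

section PathNorm

variable {d : ℕ} {φ : TestFn d} {p β γ : ℝ} {T : ℝ≥0}

theorem pathCoeff_sub (f g : ℝ≥0 → Distr d) :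
    pathCoeff φ (f - g) = pathCoeff φ f - pathCoeff φ g := by
  funext i
  simp only [pathCoeff, dyadicIncr_sub, Distr.coeff_sub, Pi.sub_apply]

theorem pathCoeff_congr {f g : ℝ≥0 → Distr d}
    (h : ∀ j k : ℕ, f ((k : ℝ≥0) / 2 ^ j) = g ((k : ℝ≥0) / 2 ^ j)) :
    pathCoeff φ f = pathCoeff φ g := by
  funext i
  simp only [pathCoeff, dyadicIncr_congr h]

theorem measurable_pathCoeff (f : ℝ≥0 → Distr d) : Measurable (pathCoeff φ f) :=
  (continuous_prod_of_discrete_left.2 fun a => (dyadicIncr f a).continuous_coeff φ).measurable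

theorem pathNorm_rpow (hp : 0 < p) (f : ℝ≥0 → Distr d) :
    pathNorm φ p β γ T f ^ p =
      ∑' a, ENNReal.ofReal (incrWeight p γ T a) * (dyadicIncr f a).besovNorm φ p β ^ p := by
  rw [pathNorm, eLpNorm_eq_lintegral_rpow_enorm_toReal (by simpa using hp) ENNReal.ofReal_ne_top,
    ENNReal.toReal_ofReal hp.le, ← ENNReal.rpow_mul, one_div, inv_mul_cancel₀ hp.ne',
    ENNReal.rpow_one, incrMeasure,
    lintegral_prod _ ((measurable_pathCoeff f).enorm.pow_const p).aemeasurable,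
    lintegral_withDensity_eq_lintegral_mul _ (.of_discrete) (.of_discrete),
    lintegral_count]
  simp only [Distr.besovNorm_rpow hp]
  rfl

theorem weight_mul_besovNorm_le (hp : 0 < p) (f : ℝ≥0 → Distr d) (a : ℕ × ℕ) :
    ENNReal.ofReal (incrWeight p γ T a) * (dyadicIncr f a).besovNorm φ p β ^ p ≤
      pathNorm φ p β γ T f ^ p := by
  rw [pathNorm_rpow hp]
  exact ENNReal.le_tsum a

theorem besovNorm_initial_le (hp : 0 < p) (f : ℝ≥0 → Distr d) :
    (f 0).besovNorm φ p β ≤ pathNorm φ p β γ T f := by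
  have h := weight_mul_besovNorm_le (φ := φ) (β := β) (γ := γ) (T := T) hp f (0, 0)
  simp only [incrWeight, if_true, ENNReal.ofReal_one, one_mul, dyadicIncr] at h
  exact (ENNReal.rpow_le_rpow_iff hp).1 h

theorem besovNorm_increment_le (hp : 0 < p) (f : ℝ≥0 → Distr d) (j k : ℕ)
    (h : ((k + 1 : ℕ) : ℝ≥0) / 2 ^ j ≤ T) :
    (f (((k + 1 : ℕ) : ℝ≥0) / 2 ^ j) - f ((k : ℝ≥0) / 2 ^ j)).besovNorm φ p β ≤
      ENNReal.ofReal ((2 : ℝ) ^ (-γ)) ^ j * pathNorm φ p β γ T f := by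
  have h1 := weight_mul_besovNorm_le (φ := φ) (β := β) (γ := γ) (T := T) hp f (j, k + 1)
  simp only [incrWeight, if_pos h, dyadicIncr] at h1
  rw [← ENNReal.rpow_le_rpow_iff hp, ENNReal.mul_rpow_of_nonneg _ _ hp.le]
  refine le_trans (le_of_eq ?_) (mul_le_mul_right h1 _)
  rw [← mul_assoc, ← ENNReal.ofReal_pow (by positivity), ENNReal.ofReal_rpow_of_pos (by positivity),
    ← ENNReal.ofReal_mul (by positivity), ← Real.rpow_mul_natCast (by norm_num),
    ← Real.rpow_mul (by norm_num), ← Real.rpow_add (by norm_num)]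
  rw [show -γ * j * p + j * γ * p = 0 by ring, Real.rpow_zero, ENNReal.ofReal_one, one_mul]

theorem tendsto_chaining_bound (hγ : 0 < γ) {A : ℝ≥0∞} (hA : A ≠ ∞) :
    Tendsto (fun n : ℕ => ENNReal.ofReal ((2 : ℝ) ^ (-γ)) ^ n *
      (1 - ENNReal.ofReal ((2 : ℝ) ^ (-γ)))⁻¹ * A) atTop (𝓝 0) := by
  have hδ1 : ENNReal.ofReal ((2 : ℝ) ^ (-γ)) < 1 := by
    rw [← ENNReal.ofReal_one]
    exact (ENNReal.ofReal_lt_ofReal_iff_of_nonneg (by positivity)).2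
      (Real.rpow_lt_one_of_one_lt_of_neg (by norm_num) (by linarith))
  have h := ENNReal.Tendsto.mul_const (ENNReal.tendsto_pow_atTop_nhds_zero_of_lt_one hδ1)
    (b := (1 - ENNReal.ofReal ((2 : ℝ) ^ (-γ)))⁻¹ * A) (Or.inr (ENNReal.mul_ne_top
      (ENNReal.inv_ne_top.2 (tsub_pos_of_lt hδ1).ne') hA))
  rw [zero_mul] at h
  simpa only [mul_assoc] using h

/-- A path of finite norm extends continuously from the dyadic times to all times. -/
theorem exists_extension (hφ : IsMollifier φ) (hp : 1 ≤ p) (hβ : β ≤ 0) (hγ : 0 < γ)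
    (f : ℝ≥0 → Distr d) (hf : ∀ N : ℕ, pathNorm φ p β γ N f < ∞) :
    ∃ g : ℝ≥0 → Distr d, (∀ j k : ℕ, g ((k : ℝ≥0) / 2 ^ j) = f ((k : ℝ≥0) / 2 ^ j)) ∧
      ∀ t, Tendsto (fun n => (g t - g (dyadicFloor n t)).besovNorm φ p β) atTop (𝓝 0) := by
  have hp0 : 0 < p := by linarith
  have h1 : ∀ t, ∃ ξ : Distr d, ∀ n, (ξ - f (dyadicFloor n t)).besovNorm φ p β ≤
      ENNReal.ofReal ((2 : ℝ) ^ (-γ)) ^ n * (1 - ENNReal.ofReal ((2 : ℝ) ^ (-γ)))⁻¹ *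
        pathNorm φ p β γ (⌈t⌉₊ : ℕ) f := fun t =>
    Distr.exists_besovNorm_sub_le (φ := φ) hφ hp hβ (tendsto_chaining_bound hγ (hf _).ne)
      fun n m => chaining_le (Distr.besovNorm_zero φ p β) (Distr.besovNorm_add_le φ p β hp)
        (fun j k h => besovNorm_increment_le hp0 f j k h) (Nat.le_ceil t) n m
  choose g hg using h1
  have hlim : ∀ t, Tendsto (fun n => (g t - f (dyadicFloor n t)).besovNorm φ p β) atTop (𝓝 0) :=
    fun t => tendsto_of_tendsto_of_tendsto_of_le_of_le tendsto_const_nhds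
      (tendsto_chaining_bound hγ (hf _).ne) (fun _ => zero_le) (hg t)
  have heq : ∀ j k : ℕ, g ((k : ℝ≥0) / 2 ^ j) = f ((k : ℝ≥0) / 2 ^ j) := fun j k => by
    refine sub_eq_zero.1 (Distr.eq_zero_of_besovNorm_eq_zero (φ := φ) (β := β) hφ hp hβ ?_)
    refine tendsto_nhds_unique (tendsto_const_nhds.congr' ?_) (hlim ((k : ℝ≥0) / 2 ^ j))
    filter_upwards [eventually_ge_atTop j] with n hn
    rw [dyadicFloor_dyadic hn]
  refine ⟨g, heq, fun t => (hlim t).congr fun n => ?_⟩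
  rw [dyadicFloor, heq]

/-- The chaining bound for the Hölder gauge `d_α(·, 0)` along a distribution-valued path. -/
theorem exists_timeHolderNorm_le (hφ : IsMollifier φ) (hp : 1 ≤ p) (hβ : β < 0) {α γ' : ℝ}
    (hα : α + d / p < β) (hγ' : 0 < γ') (hγγ' : γ' ≤ γ) (T : ℝ≥0) :
    ∃ C : ℝ≥0, ∀ f : ℝ≥0 → Distr d,
      (∀ t, Tendsto (fun n => holderGauge α (f t - f (dyadicFloor n t))) atTop (𝓝 0)) →
      timeHolderNorm (holderGauge α) γ' T f ≤ C * pathNorm φ p β γ T f := by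
  have hp0 : 0 < p := by linarith
  obtain ⟨C₁, hC₁⟩ := Distr.exists_holderGauge_le (φ := φ) hφ hp hβ hα
  obtain ⟨C₂, hC₂⟩ := exists_chaining_const.{0} (hγ'.trans_le hγγ') T
  refine ⟨(C₂ * (T ^ γ) * C₁ + C₁) + C₂ * (T ^ (γ - γ')) * C₁, fun f hf => ?_⟩
  have hincr : ∀ s ≤ T, ∀ t ≤ T, holderGauge α (f t - f s) ≤
      C₂ * (ENNReal.ofReal (dist t s ^ γ) * (C₁ * pathNorm φ p β γ T f)) := fun s hs t ht =>
    hC₂ (holderGauge_zero α) (holderGauge_add_le α) (holderGauge_neg α) (fun j k h => by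
      refine (hC₁ _).trans ((mul_le_mul_right
        (besovNorm_increment_le (γ := γ) hp0 f j k h) _).trans_eq ?_)
      ring) (fun t _ => hf t) hs ht
  have hdist : ∀ s ≤ T, ∀ t ≤ T, dist t s ≤ T := fun s hs t ht => by
    have hs' : (s : ℝ) ≤ T := hs
    have ht' : (t : ℝ) ≤ T := ht
    rw [NNReal.dist_eq, abs_le]
    constructor <;> linarith [s.2, t.2, NNReal.coe_nonneg s, NNReal.coe_nonneg t]
  have hT : ∀ e : ℝ, ENNReal.ofReal ((T : ℝ) ^ e) = ((T ^ e : ℝ≥0) : ℝ≥0∞) := fun e => by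
    rw [← NNReal.coe_rpow, ENNReal.ofReal_coe_nnreal]
  rw [ENNReal.coe_add, add_mul]
  refine add_le_add (iSup₂_le fun t ht => ?_) (iSup₂_le fun s hs => iSup₂_le fun t ht =>
    iSup_le fun hst => ?_)
  · have h0 := holderGauge_add_le α (f t - f 0) (f 0)
    rw [sub_add_cancel] at h0
    refine h0.trans ?_
    rw [ENNReal.coe_add, add_mul]
    refine add_le_add ((hincr 0 zero_le t ht).trans ?_) ((hC₁ _).trans
      (mul_le_mul_right (besovNorm_initial_le hp0 f) _))
    rw [ENNReal.coe_mul, ENNReal.coe_mul, ← hT]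
    simp only [mul_assoc]
    have h1 := hdist 0 zero_le t ht
    have h2 : 0 ≤ γ := by linarith
    gcongr
  · have hpos : 0 < dist t s := dist_pos.2 hst.symm
    have h1 : ENNReal.ofReal (dist t s ^ γ') ≠ 0 := by
      simpa using Real.rpow_pos_of_pos hpos γ'
    rw [ENNReal.div_le_iff h1 ENNReal.ofReal_ne_top]
    refine (hincr s hs t ht).trans ?_
    have h2 : ENNReal.ofReal (dist t s ^ γ) ≤
        ((T ^ (γ - γ') : ℝ≥0) : ℝ≥0∞) * ENNReal.ofReal (dist t s ^ γ') := by
      rw [← hT, ← ENNReal.ofReal_mul (by positivity)]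
      refine ENNReal.ofReal_le_ofReal ?_
      calc dist t s ^ γ = dist t s ^ (γ - γ') * dist t s ^ γ' := by
            rw [← Real.rpow_add hpos, sub_add_cancel]
        _ ≤ (T : ℝ) ^ (γ - γ') * dist t s ^ γ' := by
            have := hdist s hs t ht
            gcongr
    calc C₂ * (ENNReal.ofReal (dist t s ^ γ) * (C₁ * pathNorm φ p β γ T f))
        ≤ C₂ * (((T ^ (γ - γ') : ℝ≥0) : ℝ≥0∞) * ENNReal.ofReal (dist t s ^ γ') *
          (C₁ * pathNorm φ p β γ T f)) := by gcongr
      _ = _ := by rw [ENNReal.coe_mul, ENNReal.coe_mul]; ring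

theorem HolderPath.tendsto_dyadicFloor {α γ : ℝ} (hγ : 0 < γ) (f : HolderPath d α γ) (t : ℝ≥0) :
    Tendsto (fun n => holderGauge α (f.eval t - f.eval (dyadicFloor n t))) atTop (𝓝 0) := by
  obtain ⟨K, hK⟩ := f.holder t
  have h1 : Tendsto (fun n : ℕ => ((2 : ℝ)⁻¹ ^ n) ^ γ) atTop (𝓝 0) := by
    have := (tendsto_pow_atTop_nhds_zero_of_lt_one (r := (2 : ℝ)⁻¹) (by norm_num)
      (by norm_num)).rpow_const (p := γ) (Or.inr hγ.le)
    rwa [Real.zero_rpow hγ.ne'] at this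
  have h2 := ENNReal.Tendsto.const_mul (a := K) (ENNReal.tendsto_ofReal h1)
    (Or.inr ENNReal.coe_ne_top)
  rw [ENNReal.ofReal_zero, mul_zero] at h2
  refine tendsto_of_tendsto_of_tendsto_of_le_of_le tendsto_const_nhds h2 (fun _ => zero_le)
    fun n => (hK _ (dyadicFloor_le n t) t le_rfl).trans ?_
  have := dist_dyadicFloor_le n t
  gcongr

/-- On `C^γ(ℝ₊, C^α)`, the path norm of a slightly larger time exponent dominates the distance. -/
theorem exists_pathDist_le (hφ : IsMollifier φ) (hp : 1 ≤ p) (hβ : β < 0) {α γ' : ℝ}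
    (hα : α + d / p < β) (hγ' : 0 < γ') (hγγ' : γ' ≤ γ) (T : ℝ≥0) :
    ∃ C : ℝ≥0, ∀ f g : HolderPath d α γ',
      pathDist α γ' T f.eval g.eval ≤ C * pathNorm φ p β γ T (f.eval - g.eval) := by
  obtain ⟨C, hC⟩ := exists_timeHolderNorm_le hφ hp hβ hα hγ' hγγ' T
  refine ⟨C, fun f g => hC _ fun t => ?_⟩
  have h := (f.tendsto_dyadicFloor hγ' t).add (g.tendsto_dyadicFloor hγ' t)
  rw [add_zero] at h
  refine tendsto_of_tendsto_of_tendsto_of_le_of_le tendsto_const_nhds h (fun _ => zero_le)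
    fun n => ?_
  have h1 : (f.eval - g.eval) t - (f.eval - g.eval) (dyadicFloor n t) =
      (f.eval t - f.eval (dyadicFloor n t)) + -(g.eval t - g.eval (dyadicFloor n t)) := by
    simp only [Pi.sub_apply]
    abel
  rw [h1]
  exact (holderGauge_add_le _ _ _).trans_eq (by rw [holderGauge_neg])

/-- A path of finite norm agrees at the dyadic times with an element of `C^{γ'}(ℝ₊, C^α)`. -/
theorem exists_holderPath (hφ : IsMollifier φ) (hp : 1 ≤ p) (hβ : β < 0) {α γ' : ℝ}
    (hα : α + d / p < β) (hγ' : 0 < γ') (hγγ' : γ' < γ)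
    (f : ℝ≥0 → Distr d) (hf : ∀ N : ℕ, pathNorm φ p β γ N f < ∞) :
    ∃ g : HolderPath d α γ', (∀ j k : ℕ, g.eval ((k : ℝ≥0) / 2 ^ j) = f ((k : ℝ≥0) / 2 ^ j)) ∧
      ∀ t, Tendsto (fun n => (g.eval t - g.eval (dyadicFloor n t)).besovNorm φ p β)
        atTop (𝓝 0) := by
  have hp0 : 0 < p := by linarith
  have hγ : 0 < γ := hγ'.trans hγγ'
  obtain ⟨g, hgf, hg⟩ := exists_extension hφ hp hβ.le hγ f hf
  obtain ⟨C₁, hC₁⟩ := Distr.exists_holderGauge_le (φ := φ) hφ hp hβ hα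
  have hincr : ∀ T : ℝ≥0, ∃ K : ℝ≥0, ∀ s ≤ T, ∀ t ≤ T,
      (g t - g s).besovNorm φ p β ≤ K * ENNReal.ofReal (dist t s ^ γ) := fun T => by
    obtain ⟨C₂, hC₂⟩ := exists_chaining_const.{0} hγ (⌈T⌉₊ : ℕ)
    have hA := (hf ⌈T⌉₊).ne
    refine ⟨C₂ * (pathNorm φ p β γ (⌈T⌉₊ : ℕ) f).toNNReal, fun s hs t ht => ?_⟩
    rw [ENNReal.coe_mul, ENNReal.coe_toNNReal hA, mul_assoc, mul_comm (pathNorm _ _ _ _ _ _)]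
    refine hC₂ (Distr.besovNorm_zero φ p β) (Distr.besovNorm_add_le φ p β hp)
      (Distr.besovNorm_neg φ p β) (fun j k h => ?_) (fun t _ => hg t)
      (hs.trans (Nat.le_ceil T)) (ht.trans (Nat.le_ceil T))
    rw [hgf, hgf]
    exact besovNorm_increment_le hp0 f j k h
  have hfin : ∀ t, (g t).besovNorm φ p β < ∞ := fun t => by
    obtain ⟨K, hK⟩ := hincr t
    have h0 := Distr.besovNorm_add_le φ p β hp (g t - g 0) (g 0)
    rw [sub_add_cancel] at h0
    have h1 : g 0 = f 0 := by simpa using hgf 0 0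
    refine h0.trans_lt (ENNReal.add_lt_top.2 ⟨(hK 0 zero_le t le_rfl).trans_lt
      (ENNReal.mul_lt_top ENNReal.coe_lt_top ENNReal.ofReal_lt_top), ?_⟩)
    rw [h1]
    exact (besovNorm_initial_le hp0 f).trans_lt (hf 0)
  -- the room between `γ'` and `γ` gives the little Hölder property
  have hlittle : ∀ T : ℝ≥0, ∃ K : ℝ≥0, ∀ s ≤ T, ∀ t ≤ T, holderGauge α (g t - g s) ≤
      K * ENNReal.ofReal (dist t s ^ (γ - γ')) * ENNReal.ofReal (dist t s ^ γ') := fun T => by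
    obtain ⟨K, hK⟩ := hincr T
    refine ⟨C₁ * K, fun s hs t ht => (hC₁ _).trans ?_⟩
    rw [ENNReal.coe_mul, mul_assoc, mul_assoc]
    refine mul_le_mul_right ((hK s hs t ht).trans ?_) _
    rw [← ENNReal.ofReal_mul (by positivity), ← Real.rpow_add' dist_nonneg (by linarith),
      sub_add_cancel]
  have hδ : ∀ K ε : ℝ≥0, 0 < ε → ∃ δ : ℝ, 0 < δ ∧ ∀ x : ℝ, 0 ≤ x → x < δ →
      (K : ℝ≥0∞) * ENNReal.ofReal (x ^ (γ - γ')) ≤ ε := fun K ε hε => by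
    have h1 : Tendsto (fun x : ℝ => (K : ℝ≥0∞) * ENNReal.ofReal (x ^ (γ - γ'))) (𝓝 0) (𝓝 0) := by
      have h2 : Tendsto (fun x : ℝ => x ^ (γ - γ')) (𝓝 0) (𝓝 0) := by
        have := (Real.continuousAt_rpow_const 0 (γ - γ') (Or.inr (by linarith))).tendsto
        rwa [Real.zero_rpow (by linarith)] at this
      simpa using ENNReal.Tendsto.const_mul (a := K) (ENNReal.tendsto_ofReal h2)
        (Or.inr ENNReal.coe_ne_top)
    have h3 := h1.eventually_le_const (ENNReal.coe_pos.2 hε)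
    obtain ⟨δ, hδ0, hδ⟩ := Metric.eventually_nhds_iff.1 h3
    refine ⟨δ, hδ0, fun x hx0 hx => hδ ?_⟩
    rwa [Real.dist_eq, sub_zero, abs_of_nonneg hx0]
  refine ⟨⟨fun t => ⟨g t, Distr.holderSeminorm_lt_top hφ hp hβ hα (hfin t)⟩, fun T => ?_,
    fun T ε hε => ?_⟩, hgf, hg⟩
  · obtain ⟨K, hK⟩ := hlittle T
    refine ⟨K * T ^ (γ - γ'), fun s hs t ht => (hK s hs t ht).trans ?_⟩
    have hs' : (s : ℝ) ≤ T := hs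
    have ht' : (t : ℝ) ≤ T := ht
    have hd : dist t s ≤ T := by
      rw [NNReal.dist_eq, abs_le]
      constructor <;> linarith [NNReal.coe_nonneg s, NNReal.coe_nonneg t]
    rw [ENNReal.coe_mul, ← ENNReal.ofReal_coe_nnreal (p := T ^ (γ - γ')), NNReal.coe_rpow]
    gcongr
  · obtain ⟨K, hK⟩ := hlittle T
    obtain ⟨δ, hδ0, hδ⟩ := hδ K ε hε
    exact ⟨δ, hδ0, fun s hs t ht hts => (hK s hs t ht).trans
      (mul_le_mul_left (hδ _ dist_nonneg hts) _)⟩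

end PathNorm

/-! ### Moments of the path norm -/

theorem dyadicIncr_apply {Ω X : Type*} [Sub X] (ζ : ℝ≥0 → Ω → X) (a : ℕ × ℕ) (ω : Ω) :
    dyadicIncr (fun t => ζ t ω) a = dyadicIncr ζ a ω := by
  obtain ⟨j, _ | k⟩ := a <;> rfl

section PathMoments

variable {d : ℕ} {φ : TestFn d} {p α₀ β γ γ₀ : ℝ} {Ω : Type u} [MeasurableSpace Ω]
  {μ : Measure Ω}

theorem latticeNorm_zero : latticeNorm μ φ p α₀ (0 : Ω → Distr d) = 0 := by
  refine nonpos_iff_eq_zero.1 (sInf_le fun n _ => ?_)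
  have h : ∀ η : TestFn d, eLpNorm (fun ω => (0 : Ω → Distr d) ω η) (ENNReal.ofReal p) μ = 0 :=
    fun η => eLpNorm_zero
  simp only [h, zero_le, implies_true, and_self]

theorem latticeNorm_le_latticeTimeNorm {T t : ℝ≥0} (ht : t ≤ T) (ζ : ℝ≥0 → Ω → Distr d) :
    latticeNorm μ φ p α₀ (ζ t) ≤ latticeTimeNorm μ φ p α₀ γ₀ T ζ :=
  (le_iSup₂_of_le (f := fun (t : ℝ≥0) (_ : t ≤ T) => latticeNorm μ φ p α₀ (ζ t)) t ht le_rfl).trans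
    le_self_add

theorem latticeNorm_sub_le_latticeTimeNorm {T s t : ℝ≥0} (hs : s ≤ T) (ht : t ≤ T)
    (ζ : ℝ≥0 → Ω → Distr d) :
    latticeNorm μ φ p α₀ (ζ t - ζ s) ≤
      latticeTimeNorm μ φ p α₀ γ₀ T ζ * ENNReal.ofReal (dist t s ^ γ₀) := by
  rcases eq_or_ne s t with rfl | hst
  · rw [sub_self, latticeNorm_zero]
    exact zero_le
  have h1 : ENNReal.ofReal (dist t s ^ γ₀) ≠ 0 := by
    simpa using Real.rpow_pos_of_pos (dist_pos.2 hst.symm) γ₀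
  rw [← ENNReal.div_le_iff h1 ENNReal.ofReal_ne_top]
  exact (le_iSup₂_of_le (f := fun (s : ℝ≥0) (_ : s ≤ T) => ⨆ (t : ℝ≥0) (_ : t ≤ T) (_ : s ≠ t),
    latticeNorm μ φ p α₀ (ζ t - ζ s) / ENNReal.ofReal (dist t s ^ γ₀)) s hs
    (le_iSup₂_of_le t ht (le_iSup_of_le hst le_rfl))).trans le_add_self

theorem IsRandomDistr.dyadicIncr {ζ : ℝ≥0 → Ω → Distr d} (hζ : ∀ t, IsRandomDistr (ζ t))
    (a : ℕ × ℕ) : IsRandomDistr (dyadicIncr ζ a) := by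
  obtain ⟨j, _ | k⟩ := a
  · exact hζ 0
  · exact (hζ _).sub (hζ _)

theorem measurable_pathCoeff_uncurry {ζ : ℝ≥0 → Ω → Distr d} (hζ : ∀ t, IsRandomDistr (ζ t)) :
    Measurable fun q : Ω × ((ℕ × ℕ) × (ℕ × Space d)) => pathCoeff φ (fun t => ζ t q.1) q.2 := by
  have h : Measurable fun q : (ℕ × ℕ) × (Ω × (ℕ × Space d)) =>
      (dyadicIncr ζ q.1 q.2.1).coeff φ q.2.2 :=
    measurable_from_prod_countable_right fun a =>
      (IsRandomDistr.dyadicIncr hζ a).measurable_coeff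
  simp only [pathCoeff, dyadicIncr_apply]
  exact h.comp ((measurable_fst.comp measurable_snd).prodMk
    (measurable_fst.prodMk (measurable_snd.comp measurable_snd)))

theorem measurable_pathNorm {ζ : ℝ≥0 → Ω → Distr d} (hζ : ∀ t, IsRandomDistr (ζ t)) (hp : 0 < p)
    (T : ℝ≥0) : Measurable fun ω => pathNorm φ p β γ T fun t => ζ t ω := by
  have h : ∀ ω, pathNorm φ p β γ T (fun t => ζ t ω) = (∑' a, ENNReal.ofReal (incrWeight p γ T a) *
      (dyadicIncr ζ a ω).besovNorm φ p β ^ p) ^ p⁻¹ := fun ω => by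
    simp only [← dyadicIncr_apply]
    rw [← pathNorm_rpow hp, ← ENNReal.rpow_mul, mul_inv_cancel₀ hp.ne', ENNReal.rpow_one]
  simp only [h]
  exact (Measurable.tsum fun a => (((IsRandomDistr.dyadicIncr hζ a).measurable_besovNorm
    hp).pow_const p).const_mul _).pow_const _

/-- The sum over the dyadic increments in `[0,T]` that makes the moments of the path norm finite:
there are about `2^j T` of them at level `j`, and each contributes `2^{-jκ}` with `κ > 1`. -/
theorem exists_tsum_incrWeight_le (hp : 0 < p) (hγ : γ < γ₀ - 1 / p) (T : ℝ≥0) :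
    ∃ S : ℝ≥0, ∑' a : ℕ × ℕ, ENNReal.ofReal (incrWeight p γ T a) *
      ENNReal.ofReal ((2 : ℝ) ^ (-(a.1 * γ₀ * p))) ≤ S := by
  set θ := (2 : ℝ) ^ ((γ - γ₀) * p) with hθ
  have hθ0 : 0 < θ := by positivity
  have hθ1 : 2 * θ < 1 := by
    have h1 : (γ - γ₀) * p < -1 := by
      have : (γ - γ₀) * p < -(1 / p) * p := by
        refine mul_lt_mul_of_pos_right ?_ hp
        linarith
      rwa [neg_mul, one_div, inv_mul_cancel₀ hp.ne'] at this
    calc 2 * θ = (2 : ℝ) ^ (1 + (γ - γ₀) * p) := by rw [Real.rpow_add (by norm_num), Real.rpow_one]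
      _ < 1 := Real.rpow_lt_one_of_one_lt_of_neg (by norm_num) (by linarith)
  have hterm : ∀ j k : ℕ, ENNReal.ofReal (incrWeight p γ T (j, k)) *
      ENNReal.ofReal ((2 : ℝ) ^ (-(j * γ₀ * p))) ≤ ENNReal.ofReal (θ ^ j) := by
    intro j k
    have h1 : ENNReal.ofReal ((2 : ℝ) ^ (j * γ * p)) *
        ENNReal.ofReal ((2 : ℝ) ^ (-(j * γ₀ * p))) = ENNReal.ofReal (θ ^ j) := by
      rw [← ENNReal.ofReal_mul (by positivity), ← Real.rpow_add (by norm_num), hθ,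
        ← Real.rpow_mul_natCast (by norm_num)]
      congr 2; ring
    obtain _ | k := k
    · rw [incrWeight]
      split_ifs with h
      · simp [h]
      · simp
    · rw [incrWeight]
      split_ifs with h
      · exact h1.le
      · simp
  have hzero : ∀ j k : ℕ, k ∉ Finset.range (⌊T * 2 ^ j⌋₊ + 1) →
      ENNReal.ofReal (incrWeight p γ T (j, k)) *
        ENNReal.ofReal ((2 : ℝ) ^ (-(j * γ₀ * p))) = 0 := by
    intro j k hk
    rw [Finset.mem_range, not_lt, Nat.add_one_le_iff] at hk
    obtain ⟨k, rfl⟩ : ∃ l, k = l + 1 := ⟨k - 1, by omega⟩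
    have h : ¬ ((k + 1 : ℕ) : ℝ≥0) / 2 ^ j ≤ T := fun h => by
      rw [div_le_iff₀ (by positivity)] at h
      exact absurd (Nat.le_floor h) (not_le.2 hk)
    rw [incrWeight, if_neg h]
    simp
  have hrow : ∀ j : ℕ, ∑' k : ℕ, ENNReal.ofReal (incrWeight p γ T (j, k)) *
      ENNReal.ofReal ((2 : ℝ) ^ (-(j * γ₀ * p))) ≤ ((T + 1 : ℝ≥0) : ℝ≥0∞) *
        ENNReal.ofReal (2 * θ) ^ j := by
    intro j
    rw [tsum_eq_sum (hzero j)]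
    refine (Finset.sum_le_card_nsmul _ _ _ fun k _ => hterm j k).trans ?_
    rw [Finset.card_range, nsmul_eq_mul, ← ENNReal.ofReal_pow (by positivity), mul_pow,
      ENNReal.ofReal_mul (by positivity), ← mul_assoc]
    gcongr
    have h1 : ((⌊T * 2 ^ j⌋₊ + 1 : ℕ) : ℝ≥0) ≤ (T + 1) * 2 ^ j := by
      push_cast
      rw [add_mul, one_mul]
      exact add_le_add (Nat.floor_le zero_le) (one_le_pow₀ one_le_two)
    have h2 : ENNReal.ofReal ((2 : ℝ) ^ j) = ((2 ^ j : ℝ≥0) : ℝ≥0∞) := by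
      rw [← ENNReal.ofReal_coe_nnreal]; norm_num
    rw [h2, ← ENNReal.coe_mul]
    exact_mod_cast h1
  refine ⟨(∑' j : ℕ, ((T + 1 : ℝ≥0) : ℝ≥0∞) * ENNReal.ofReal (2 * θ) ^ j).toNNReal, ?_⟩
  rw [ENNReal.coe_toNNReal]
  · rw [ENNReal.tsum_prod']
    exact ENNReal.tsum_le_tsum hrow
  · rw [ENNReal.tsum_mul_left, ENNReal.tsum_geometric]
    refine ENNReal.mul_ne_top ENNReal.coe_ne_top (ENNReal.inv_ne_top.2 (tsub_pos_of_lt ?_).ne')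
    rw [← ENNReal.ofReal_one]
    exact (ENNReal.ofReal_lt_ofReal_iff_of_nonneg (by positivity)).2 hθ1

/-- The `p`-th moment of the path norm with exponents `β < α₀` and `γ < γ₀ - 1/p` is controlled by
the norm of `C_p^{γ₀,α₀}` on `[0,T]`. -/
theorem exists_lintegral_pathNorm_le (d : ℕ) (hp : 0 < p) (hβ : β < α₀) (hγ : γ < γ₀ - 1 / p)
    (T : ℝ≥0) :
    ∃ K : ℝ≥0, ∀ (φ : TestFn d) {Ω : Type u} [MeasurableSpace Ω] (μ : Measure Ω)
      [IsProbabilityMeasure μ] (ζ : ℝ≥0 → Ω → Distr d), (∀ t, IsRandomDistr (ζ t)) →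
      ∫⁻ ω, (pathNorm φ p β γ T fun t => ζ t ω) ^ p ∂μ ≤
        (K * latticeTimeNorm μ φ p α₀ γ₀ T ζ) ^ p := by
  obtain ⟨K, hK⟩ := exists_lintegral_besovNorm_le.{u} d hp hβ
  obtain ⟨S, hS⟩ := exists_tsum_incrWeight_le hp hγ T
  refine ⟨S ^ p⁻¹ * K, fun φ Ω _ μ _ ζ hζ => ?_⟩
  set Λ := latticeTimeNorm μ φ p α₀ γ₀ T ζ with hΛ
  simp only [pathNorm_rpow hp, dyadicIncr_apply]
  rw [lintegral_tsum fun a => ((((IsRandomDistr.dyadicIncr hζ a).measurable_besovNorm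
    hp).pow_const p).const_mul _).aemeasurable]
  have hterm : ∀ a, ∫⁻ ω, ENNReal.ofReal (incrWeight p γ T a) *
      (dyadicIncr ζ a ω).besovNorm φ p β ^ p ∂μ ≤ ENNReal.ofReal (incrWeight p γ T a) *
        ENNReal.ofReal ((2 : ℝ) ^ (-(a.1 * γ₀ * p))) * (K * Λ) ^ p := by
    intro a
    rw [lintegral_const_mul' _ _ ENNReal.ofReal_ne_top, mul_assoc]
    by_cases hw : incrWeight p γ T a = 0
    · simp [hw]
    refine mul_le_mul_right ((hK φ μ _ (IsRandomDistr.dyadicIncr hζ a)).trans ?_) _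
    have h1 : latticeNorm μ φ p α₀ (dyadicIncr ζ a) ≤
        Λ * ENNReal.ofReal ((2 : ℝ) ^ (-(a.1 * γ₀))) := by
      obtain ⟨j, _ | k⟩ := a
      · rw [incrWeight] at hw
        have hj : j = 0 := by
          by_contra h
          exact hw (if_neg h)
        simpa [hj, dyadicIncr] using latticeNorm_le_latticeTimeNorm zero_le ζ
      · rw [incrWeight] at hw
        have hk : ((k + 1 : ℕ) : ℝ≥0) / 2 ^ j ≤ T := by
          by_contra h
          exact hw (if_neg h)
        have hk' : (k : ℝ≥0) / 2 ^ j ≤ ((k + 1 : ℕ) : ℝ≥0) / 2 ^ j := by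
          gcongr
          omega
        refine (latticeNorm_sub_le_latticeTimeNorm (γ₀ := γ₀) (hk'.trans hk) hk ζ).trans_eq ?_
        congr 2
        rw [NNReal.dist_eq]
        push_cast
        rw [← sub_div, add_sub_cancel_left, abs_of_pos (by positivity), one_div,
          Real.inv_rpow (by positivity), ← Real.rpow_natCast, ← Real.rpow_mul (by norm_num),
          ← Real.rpow_neg (by norm_num)]
    calc (K * latticeNorm μ φ p α₀ (dyadicIncr ζ a)) ^ p
        ≤ (K * (Λ * ENNReal.ofReal ((2 : ℝ) ^ (-(a.1 * γ₀))))) ^ p := by gcongr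
      _ = ENNReal.ofReal ((2 : ℝ) ^ (-(a.1 * γ₀ * p))) * (K * Λ) ^ p := by
        rw [← mul_assoc, ENNReal.mul_rpow_of_nonneg _ _ hp.le,
          ENNReal.ofReal_rpow_of_pos (by positivity), ← Real.rpow_mul (by norm_num), mul_comm,
          neg_mul]
  refine (ENNReal.tsum_le_tsum hterm).trans ?_
  have hS' : (((S ^ p⁻¹ * K : ℝ≥0) : ℝ≥0∞) * Λ) ^ p = S * (K * Λ) ^ p := by
    rw [ENNReal.coe_mul, mul_assoc, ENNReal.mul_rpow_of_nonneg _ (K * Λ) hp.le,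
      ENNReal.coe_rpow_of_nonneg _ (by positivity), ← ENNReal.rpow_mul, inv_mul_cancel₀ hp.ne',
      ENNReal.rpow_one]
  rw [ENNReal.tsum_mul_right, hS']
  exact mul_le_mul_left hS _

theorem ae_pathNorm_lt_top [IsProbabilityMeasure μ] (hp : 0 < p) (hβ : β < α₀)
    (hγ : γ < γ₀ - 1 / p) {ζ : ℝ≥0 → Ω → Distr d} (hζ : MemLatticeTime μ φ p α₀ γ₀ ζ) :
    ∀ᵐ ω ∂μ, ∀ N : ℕ, pathNorm φ p β γ N (fun t => ζ t ω) < ∞ := by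
  refine ae_all_iff.2 fun N => ?_
  obtain ⟨K, hK⟩ := exists_lintegral_pathNorm_le.{u} d hp hβ hγ N
  have h1 : ∫⁻ ω, pathNorm φ p β γ N (fun t => ζ t ω) ^ p ∂μ ≠ ∞ :=
    ((hK φ μ ζ fun t => (hζ.1 t).1).trans_lt (ENNReal.rpow_lt_top_of_nonneg hp.le
      (ENNReal.mul_ne_top ENNReal.coe_ne_top (hζ.2 N).ne))).ne
  filter_upwards [ae_lt_top ((measurable_pathNorm (fun t => (hζ.1 t).1) hp N).pow_const p) h1]
    with ω hω
  exact (ENNReal.rpow_lt_top_iff_of_pos hp).1 hω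

/-- At each time, the random distribution is almost surely the limit in Besov norm of its values at
the dyadic times below: the `p`-th moments of the differences are summable. -/
theorem ae_tendsto_dyadicFloor [IsProbabilityMeasure μ] (hp : 0 < p) (hβ : β < α₀)
    (hγ₀ : 0 < γ₀) {ζ : ℝ≥0 → Ω → Distr d} (hζ : MemLatticeTime μ φ p α₀ γ₀ ζ) (t : ℝ≥0) :
    ∀ᵐ ω ∂μ, Tendsto (fun n => (ζ t ω - ζ (dyadicFloor n t) ω).besovNorm φ p β) atTop (𝓝 0) := by
  obtain ⟨K, hK⟩ := exists_lintegral_besovNorm_le.{u} d hp hβ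
  set Λ := latticeTimeNorm μ φ p α₀ γ₀ t ζ with hΛ
  have hrand : ∀ n, IsRandomDistr (ζ t - ζ (dyadicFloor n t)) := fun n =>
    (hζ.1 _).1.sub (hζ.1 _).1
  set θ := ENNReal.ofReal ((2 : ℝ) ^ (-γ₀ * p)) with hθ
  have hθ1 : θ < 1 := by
    rw [hθ, ← ENNReal.ofReal_one]
    exact (ENNReal.ofReal_lt_ofReal_iff_of_nonneg (by positivity)).2
      (Real.rpow_lt_one_of_one_lt_of_neg (by norm_num) (by nlinarith))
  have hterm : ∀ n, ∫⁻ ω, ((ζ t - ζ (dyadicFloor n t)) ω).besovNorm φ p β ^ p ∂μ ≤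
      θ ^ n * (K * Λ) ^ p := fun n => by
    have h1 : dist t (dyadicFloor n t) ^ γ₀ ≤ ((2 : ℝ)⁻¹ ^ n) ^ γ₀ :=
      Real.rpow_le_rpow dist_nonneg (dist_dyadicFloor_le n t) hγ₀.le
    calc ∫⁻ ω, ((ζ t - ζ (dyadicFloor n t)) ω).besovNorm φ p β ^ p ∂μ
        ≤ (K * latticeNorm μ φ p α₀ (ζ t - ζ (dyadicFloor n t))) ^ p := hK φ μ _ (hrand n)
      _ ≤ (K * (Λ * ENNReal.ofReal (((2 : ℝ)⁻¹ ^ n) ^ γ₀))) ^ p := by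
        gcongr
        refine (latticeNorm_sub_le_latticeTimeNorm (γ₀ := γ₀) (dyadicFloor_le n t) le_rfl
          ζ).trans ?_
        gcongr
      _ = θ ^ n * (K * Λ) ^ p := by
        rw [← mul_assoc, ENNReal.mul_rpow_of_nonneg _ _ hp.le, mul_comm,
          ENNReal.ofReal_rpow_of_pos (by positivity), hθ, ← ENNReal.ofReal_pow (by positivity)]
        congr 2
        rw [inv_pow, Real.inv_rpow (by positivity), ← Real.rpow_neg (by positivity),
          ← Real.rpow_natCast, ← Real.rpow_mul (by norm_num), ← Real.rpow_mul (by norm_num),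
          ← Real.rpow_mul_natCast (by norm_num)]
        ring_nf
  have hmeas : ∀ n, Measurable fun ω => ((ζ t - ζ (dyadicFloor n t)) ω).besovNorm φ p β ^ p :=
    fun n => ((hrand n).measurable_besovNorm hp).pow_const p
  have hsum : ∫⁻ ω, ∑' n, ((ζ t - ζ (dyadicFloor n t)) ω).besovNorm φ p β ^ p ∂μ ≠ ∞ := by
    rw [lintegral_tsum fun n => (hmeas n).aemeasurable]
    refine ((ENNReal.tsum_le_tsum hterm).trans_lt ?_).ne
    rw [ENNReal.tsum_mul_right, ENNReal.tsum_geometric]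
    exact ENNReal.mul_lt_top (ENNReal.inv_lt_top.2 (tsub_pos_of_lt hθ1))
      (ENNReal.rpow_lt_top_of_nonneg hp.le (ENNReal.mul_ne_top ENNReal.coe_ne_top (hζ.2 t).ne))
  filter_upwards [ae_lt_top (Measurable.tsum hmeas) hsum] with ω hω
  have h1 := (ENNReal.tendsto_atTop_zero_of_tsum_ne_top hω.ne).ennrpow_const p⁻¹
  rw [ENNReal.zero_rpow_of_pos (by positivity)] at h1
  refine h1.congr fun n => ?_
  rw [← ENNReal.rpow_mul, mul_inv_cancel₀ hp.ne', ENNReal.rpow_one]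
  rfl

end PathMoments

/-! ### The embedding of `C_p^{γ₀,α₀}` into `L^p(Ω, C^γ(ℝ₊, C^α))` -/

section PathEmbedding

variable {d : ℕ} {φ : TestFn d} {p α₀ α β γ γ' γ₀ : ℝ}

theorem exists_stronglyMeasurable_holderPath (hφ : IsMollifier φ) (hp : 1 ≤ p) (hβ : β < 0)
    (hα : α + d / p < β) (hγ : 0 < γ) (hγγ' : γ < γ') {Ω : Type*} [MeasurableSpace Ω]
    {ζ : ℝ≥0 → Ω → Distr d} (hζ : ∀ t, IsRandomDistr (ζ t))
    (hfin : ∀ ω, ∀ N : ℕ, pathNorm φ p β γ' N (fun t => ζ t ω) < ∞) :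
    ∃ Z : Ω → HolderPath d α γ, StronglyMeasurable Z ∧
      (∀ ω (j k : ℕ), (Z ω).eval ((k : ℝ≥0) / 2 ^ j) = ζ ((k : ℝ≥0) / 2 ^ j) ω) ∧
      ∀ ω t, Tendsto (fun n => ((Z ω).eval t - (Z ω).eval (dyadicFloor n t)).besovNorm φ p β)
        atTop (𝓝 0) := by
  choose Z hZ hZlim using fun ω =>
    exists_holderPath hφ hp hβ hα hγ hγγ' (fun t => ζ t ω) (hfin ω)
  refine ⟨Z, ?_, hZ, hZlim⟩
  have hdist : ∀ T : ℝ≥0, ∃ C : ℝ≥0, ∀ f g : HolderPath d α γ,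
      pathDist α γ T f.eval g.eval ≤ C * pathNorm φ p β γ' T (f.eval - g.eval) :=
    exists_pathDist_le hφ hp hβ hα hγ hγγ'.le
  choose C hC using hdist
  refine stronglyMeasurable_of_tendsto_eLpNorm (J := ℕ)
    (fun m => incrMeasure d p β γ' (m + 1 : ℕ)) (p := ENNReal.ofReal p)
    (by simpa using ENNReal.ofReal_le_ofReal hp) ENNReal.ofReal_ne_top Z
    (fun _ ω => pathCoeff φ fun t => ζ t ω) (fun _ => measurable_pathCoeff_uncurry hζ)
    (fun m ω => hfin ω (m + 1)) fun ω₀ l hl => ?_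
  refine tendsto_metrise fun m => ?_
  have h1 := ENNReal.Tendsto.const_mul (a := C (m + 1 : ℕ)) (hl m) (Or.inr ENNReal.coe_ne_top)
  rw [mul_zero] at h1
  refine tendsto_of_tendsto_of_tendsto_of_le_of_le tendsto_const_nhds h1 (fun _ => zero_le)
    fun ω => ?_
  have h2 := hC (m + 1 : ℕ) (Z ω) (Z ω₀)
  rw [pathNorm, pathCoeff_sub, pathCoeff_congr (g := fun t => ζ t ω) (hZ ω),
    pathCoeff_congr (g := fun t => ζ t ω₀) (hZ ω₀)] at h2
  exact_mod_cast h2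

/-- The modification is built from the values at the dyadic times, and vanishes on the null event
that some path norm is infinite. -/
theorem exists_memLpHolderPath (hφ : IsMollifier φ) (hp : 1 ≤ p) (hβ : β < 0)
    (hα : α + d / p < β) (hβα₀ : β < α₀) (hγ : 0 < γ) (hγγ' : γ < γ') (hγ' : γ' < γ₀ - 1 / p)
    {Ω : Type u} [MeasurableSpace Ω] (μ : Measure Ω) [IsProbabilityMeasure μ]
    {ζ : ℝ≥0 → Ω → Distr d} (hζ : MemLatticeTime μ φ p α₀ γ₀ ζ) :
    ∃ Z : Ω → HolderPath d α γ, MemLpHolderPath μ p Z ∧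
      ∀ t, ∀ᵐ ω ∂μ, (Z ω).eval t = ζ t ω := by
  classical
  have hp0 : 0 < p := by linarith
  have hγ₀ : 0 < γ₀ := by
    have : 0 < 1 / p := by positivity
    linarith
  have hrand : ∀ t, IsRandomDistr (ζ t) := fun t => (hζ.1 t).1
  set s := {ω | ∀ N : ℕ, pathNorm φ p β γ' N (fun t => ζ t ω) < ∞} with hs
  have hsm : MeasurableSet s := by
    have : s = ⋂ N : ℕ, {ω | pathNorm φ p β γ' N (fun t => ζ t ω) < ∞} := by
      ext ω
      simp [hs]
    rw [this]
    exact MeasurableSet.iInter fun N =>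
      measurableSet_lt (measurable_pathNorm hrand hp0 N) measurable_const
  have hae : ∀ᵐ ω ∂μ, ω ∈ s := ae_pathNorm_lt_top hp0 hβα₀ hγ' hζ
  have hzero : ∀ T : ℝ≥0, pathNorm φ p β γ' T (fun _ => (0 : Distr d)) = 0 := fun T => by
    have h := pathCoeff_sub (φ := φ) (fun _ : ℝ≥0 => (0 : Distr d)) fun _ => 0
    rw [sub_self, sub_self] at h
    exact (congrArg (fun F => eLpNorm F (ENNReal.ofReal p) (incrMeasure d p β γ' T)) h).trans
      eLpNorm_zero
  obtain ⟨Z, hZm, hZ, hZlim⟩ := exists_stronglyMeasurable_holderPath (α := α) (γ := γ) hφ hp hβ hα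
    hγ hγγ' (ζ := fun t ω => if ω ∈ s then ζ t ω else 0) (fun t => (hrand t).ite hsm)
    fun ω N => by
      by_cases h : ω ∈ s
      · simp only [if_pos h]
        exact h N
      · simp only [if_neg h, hzero]
        exact ENNReal.zero_lt_top
  have hZs : ∀ ω ∈ s, ∀ j k : ℕ, (Z ω).eval ((k : ℝ≥0) / 2 ^ j) = ζ ((k : ℝ≥0) / 2 ^ j) ω :=
    fun ω hω j k => by rw [hZ, if_pos hω]
  refine ⟨Z, ⟨hZm.aestronglyMeasurable, fun T => ?_⟩, fun t => ?_⟩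
  · obtain ⟨C, hC⟩ := exists_timeHolderNorm_le hφ hp hβ hα hγ hγγ'.le T
    obtain ⟨K, hK⟩ := exists_lintegral_pathNorm_le.{u} d hp0 hβα₀ hγ' T
    refine (lpMoment_mono hp0 (Y := fun ω => C * pathNorm φ p β γ' T fun t => ζ t ω) ?_).trans_lt ?_
    · filter_upwards [hae] with ω hω
      rw [pathDist, sub_zero]
      refine (hC _ ((Z ω).tendsto_dyadicFloor hγ)).trans_eq ?_
      rw [pathNorm, pathCoeff_congr (g := fun t => ζ t ω) (hZs ω hω), pathNorm]
    · rw [lpMoment_const_mul hp0]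
      exact ENNReal.mul_lt_top ENNReal.coe_lt_top ((lpMoment_le_of_lintegral_le hp0
        (hK φ μ ζ hrand)).trans_lt (ENNReal.mul_lt_top ENNReal.coe_lt_top (hζ.2 T)))
  · filter_upwards [hae, ae_tendsto_dyadicFloor hp0 hβα₀ hγ₀ hζ t] with ω hω hlim
    -- both `Z t` and `ζ t` are the limit of the values at the dyadic times below `t`
    refine sub_eq_zero.1 (Distr.eq_zero_of_besovNorm_eq_zero (φ := φ) (β := β) hφ hp hβ.le
      (nonpos_iff_eq_zero.1 ?_))
    have h1 := (hZlim ω t).add hlim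
    rw [add_zero] at h1
    refine ge_of_tendsto h1 (Eventually.of_forall fun n => ?_)
    have h2 : (Z ω).eval t - ζ t ω = ((Z ω).eval t - (Z ω).eval (dyadicFloor n t)) +
        -(ζ t ω - ζ (dyadicFloor n t) ω) := by
      rw [dyadicFloor, hZs ω hω]
      abel
    rw [h2]
    refine (Distr.besovNorm_add_le φ p β hp _ _).trans_eq ?_
    rw [Distr.besovNorm_neg]

/-- Only the values of the modifications at the countably many dyadic times enter the path norm, so
the choice of the modifications does not matter. -/
theorem exists_lpMoment_pathDist_le (hφ : IsMollifier φ) (hp : 1 ≤ p) (hβ : β < 0)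
    (hα : α + d / p < β) (hβα₀ : β < α₀) (hγ : 0 < γ) (hγγ' : γ < γ') (hγ' : γ' < γ₀ - 1 / p)
    (T : ℝ≥0) :
    ∃ C : ℝ≥0, ∀ (Ω : Type u) [MeasurableSpace Ω] (μ : Measure Ω) [IsProbabilityMeasure μ]
      (ζ ζ' : ℝ≥0 → Ω → Distr d) (Z Z' : Ω → HolderPath d α γ),
      (∀ t, IsRandomDistr (ζ t)) → (∀ t, IsRandomDistr (ζ' t)) →
      (∀ t, ∀ᵐ ω ∂μ, (Z ω).eval t = ζ t ω) → (∀ t, ∀ᵐ ω ∂μ, (Z' ω).eval t = ζ' t ω) →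
      lpMoment μ p (fun ω => pathDist α γ T (Z ω).eval (Z' ω).eval) ≤
        C * latticeTimeNorm μ φ p α₀ γ₀ T (ζ - ζ') := by
  have hp0 : 0 < p := by linarith
  obtain ⟨C, hC⟩ := exists_pathDist_le hφ hp hβ hα hγ hγγ'.le T
  obtain ⟨K, hK⟩ := exists_lintegral_pathNorm_le.{u} d hp0 hβα₀ hγ' T
  refine ⟨C * K, fun Ω _ μ _ ζ ζ' Z Z' hζ hζ' hZ hZ' => ?_⟩
  refine (lpMoment_mono hp0
    (Y := fun ω => C * pathNorm φ p β γ' T fun t => (ζ - ζ') t ω) ?_).trans ?_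
  · have h1 : ∀ᵐ ω ∂μ, ∀ j k : ℕ, (Z ω).eval ((k : ℝ≥0) / 2 ^ j) = ζ ((k : ℝ≥0) / 2 ^ j) ω :=
      ae_all_iff.2 fun j => ae_all_iff.2 fun k => hZ _
    have h2 : ∀ᵐ ω ∂μ, ∀ j k : ℕ, (Z' ω).eval ((k : ℝ≥0) / 2 ^ j) = ζ' ((k : ℝ≥0) / 2 ^ j) ω :=
      ae_all_iff.2 fun j => ae_all_iff.2 fun k => hZ' _
    filter_upwards [h1, h2] with ω hω hω'
    refine (hC _ _).trans_eq ?_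
    rw [pathNorm, pathNorm, pathCoeff_congr (g := fun t => (ζ - ζ') t ω) fun j k => ?_]
    simp only [Pi.sub_apply, hω, hω']
  · rw [lpMoment_const_mul hp0, ENNReal.coe_mul, mul_assoc]
    gcongr
    exact lpMoment_le_of_lintegral_le hp0 (hK φ μ (ζ - ζ') fun t => (hζ t).sub (hζ' t))

end PathEmbedding

theorem proposition4p6 (d : ℕ) (hd : 1 ≤ d) (φ : TestFn d) (hφ : IsMollifier φ)
    (α₀ p γ₀ α γ : ℝ) (hα₀ : α₀ < 0) (hp : (d : ℝ) < p) (hγ₀ : 1 / p < γ₀)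
    (hγ : 0 < γ) (hγγ₀ : γ < γ₀ - 1 / p) (hα : α < α₀ - d / p) :
    -- the embedding of `C_p^{α₀}` into `L^p(Ω, C^α)` and its continuity
    ((∀ (Ω : Type u) [MeasurableSpace Ω] (μ : Measure Ω) [IsProbabilityMeasure μ]
        (ζ : Ω → Distr d), MemLattice μ φ p α₀ ζ →
        ∃ Z : Ω → HolderDistr d α, MemLpHolderDistr μ p Z ∧ ∀ᵐ ω ∂μ, (Z ω).toDistr = ζ ω) ∧
      ∃ C : ℝ≥0, ∀ (Ω : Type u) [MeasurableSpace Ω] (μ : Measure Ω) [IsProbabilityMeasure μ]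
        (ζ ζ' : Ω → Distr d), MemLattice μ φ p α₀ ζ → MemLattice μ φ p α₀ ζ' →
        lpMoment μ p (fun ω => holderDist α (ζ ω) (ζ' ω)) ≤ C * latticeNorm μ φ p α₀ (ζ - ζ')) ∧
    -- the embedding of `C_p^{γ₀,α₀}` into `L^p(Ω, C^γ(ℝ₊, C^α))` and its continuity
    ((∀ (Ω : Type u) [MeasurableSpace Ω] (μ : Measure Ω) [IsProbabilityMeasure μ]
        (ζ : ℝ≥0 → Ω → Distr d), MemLatticeTime μ φ p α₀ γ₀ ζ →
        ∃ Z : Ω → HolderPath d α γ, MemLpHolderPath μ p Z ∧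
          ∀ t, ∀ᵐ ω ∂μ, (Z ω).eval t = ζ t ω) ∧
      ∀ T : ℝ≥0, ∃ C : ℝ≥0,
        ∀ (Ω : Type u) [MeasurableSpace Ω] (μ : Measure Ω) [IsProbabilityMeasure μ]
          (ζ ζ' : ℝ≥0 → Ω → Distr d) (Z Z' : Ω → HolderPath d α γ),
          MemLatticeTime μ φ p α₀ γ₀ ζ → MemLatticeTime μ φ p α₀ γ₀ ζ' →
          AEStronglyMeasurable Z μ → AEStronglyMeasurable Z' μ →
          (∀ t, ∀ᵐ ω ∂μ, (Z ω).eval t = ζ t ω) → (∀ t, ∀ᵐ ω ∂μ, (Z' ω).eval t = ζ' t ω) →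
          lpMoment μ p (fun ω => pathDist α γ T (Z ω).eval (Z' ω).eval) ≤
            C * latticeTimeNorm μ φ p α₀ γ₀ T (ζ - ζ')) := by
  have hp1 : 1 ≤ p := by
    have : (1 : ℝ) ≤ d := by exact_mod_cast hd
    linarith
  obtain ⟨β, hαβ, hβα₀⟩ := exists_between (show α + d / p < α₀ by linarith)
  obtain ⟨γ', hγγ', hγ'⟩ := exists_between hγγ₀
  have hβ : β < 0 := hβα₀.trans hα₀
  refine ⟨⟨fun Ω _ μ _ ζ hζ => exists_memLpHolderDistr hφ hp1 hβ hαβ hβα₀ μ hζ, ?_⟩,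
    fun Ω _ μ _ ζ hζ => exists_memLpHolderPath hφ hp1 hβ hαβ hβα₀ hγ hγγ' hγ' μ hζ, fun T => ?_⟩
  · obtain ⟨C, hC⟩ := exists_lpMoment_holderGauge_le.{u} hφ hp1 hβ hαβ hβα₀
    exact ⟨C, fun Ω _ μ _ ζ ζ' hζ hζ' => hC Ω μ (ζ - ζ') (hζ.1.sub hζ'.1)⟩
  · obtain ⟨C, hC⟩ := exists_lpMoment_pathDist_le.{u} hφ hp1 hβ hαβ hβα₀ hγ hγγ' hγ' T
    exact ⟨C, fun Ω _ μ _ ζ ζ' Z Z' hζ hζ' _ _ hZ hZ' =>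
      hC Ω μ ζ ζ' Z Z' (fun t => (hζ.1 t).1) (fun t => (hζ'.1 t).1) hZ hZ'⟩
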